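/- Let $d\ge 2$ and let $\Omega\subset\mathbb R^d$ be a bounded, simply connected Lipschitz domain. A mesh $\mathcal T$ of $\Omega$ is a finite set of pairwise disjoint bounded Lipschitz domains $T\subset\Omega$ with $\overline\Omega=\bigcup_{T\in\mathcal T}\overline T$. Let $H^1(\mathcal T)=\prod_{T}H^1(T)$ and $H(\mathrm{div},\mathcal T)=\prod_T H(\mathrm{div},T)$ be the broken spaces with norms $\|v\|_{1,\mathcal T}^2=\|v\|^2+\|\nabla v\|_{\mathcal T}^2$ and $\|\tau\|_{\mathrm{div},\mathcal T}^2=\|\tau\|^2+\|\mathrm{div}\,\tau\|_{\mathcal T}^2$; $(\cdot,\cdot)_{\mathcal T}$ denotes the elementwise $L_2$ product, with derivatives taken elementwise. Define $\mathrm{tr}^{\nabla}:H^1(\mathcal T)\to H(\mathrm{div},\mathcal T)'$ and $\mathrm{tr}^{\mathrm{div}}:H(\mathrm{div},\mathcal T)\to H^1(\mathcal T)'$ by $$\langle \mathrm{tr}^{\nabla}v,\tau\rangle=\langle \mathrm{tr}^{\mathrm{div}}\tau,v\rangle=(v,\mathrm{div}\,\tau)_{\mathcal T}+(\nabla v,\tau)_{\mathcal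 T},$$ and the trace spaces $H^{1/2}(\mathcal S)=\mathrm{tr}^\nabla(H^1(\Omega))$, $H^{1/2}_0(\mathcal S)=\mathrm{tr}^\nabla(H^1_0(\Omega))$, $H^{-1/2}(\mathcal S)=\mathrm{tr}^{\mathrm{div}}(H(\mathrm{div},\Omega))$, $H^{-1/2}_0(\mathcal S)=\mathrm{tr}^{\mathrm{div}}(H_0(\mathrm{div},\Omega))$, where $H_0(\mathrm{div},\Omega)$ consists of the fields with vanishing normal trace on $\partial\Omega$, with $$\|\hat v\|_{1/2,\mathcal S}=\inf\{\|v\|_{1}: v\in H^1(\Omega),\ \mathrm{tr}^\nabla v=\hat v\},\qquad \|\hat\tau\|_{-1/2,\mathcal S}=\inf\{\|\tau\|_{\mathrm{div}}:\tau\in H(\mathrm{div},\Omega),\ \mathrm{tr}^{\mathrm{div}}\tau=\hat\tau\}.$$ Let $$\mathfrak U=L_2(\Omega)^d\times L_2(\Omega)\times L_2(\Omega)^d\times L_2(\Omega)\times H^{-1/2}_0(\mathcal S)\times H^{1/2}_0(\mathcal S)\times H^{-1/2}(\mathcal S)\times H^{1/2}(\mathcal S),$$ $$\mathfrak V(\mathcal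 T)=H(\mathrm{div},\mathcal T)\times H^1(\mathcal T)\times H(\mathrm{div},\mathcal T)\times H^1(\mathcal T),$$ with squared norms the sums of the squared norms of the components. For $\mathfrak u=(u_1,u_2,u_3,u_4,\hat u_1,\hat u_2,\hat u_3,\hat u_4)\in\mathfrak U$ and $\mathfrak v=(v_1,v_2,v_3,v_4)\in\mathfrak V(\mathcal T)$ let $$b(\mathfrak u,\mathfrak v)=(u_1,v_1-\nabla v_4)_{\mathcal T}-(u_2,v_4+\mathrm{div}\,v_3)_{\mathcal T}-(u_3,v_3+\nabla v_2)_{\mathcal T}-(u_4,v_2+\mathrm{div}\,v_1)_{\mathcal T}+\langle\hat u_1,v_4\rangle+\langle\hat u_2,v_3\rangle+\langle\hat u_3,v_2\rangle+\langle\hat u_4,v_1\rangle .$$ For $f\in L_2(\Omega)^d$ let $L(\mathfrak v)=(f,v_1)$, and let $\mathfrak T:\mathfrak U\to\mathfrak V(\mathcal T)$ be the trial-to-test operator given by $\langle\mathfrak T\mathfrak u,\mathfrak v\rangle_{\mathfrak V(\mathcal T)}=b(\mathfrak u,\mathfrak v)$ for all $\mathfrak v\in\mathfrak V(\mathcal T)$.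 **Theorem.** There is a constant $C>0$, depending only on $\Omega$, such that for every mesh $\mathcal T$ of $\Omega$ and every $f\in L_2(\Omega)^d$ the following holds. There is a unique $\mathfrak u\in\mathfrak U$ with $b(\mathfrak u,\mathfrak v)=L(\mathfrak v)$ for all $\mathfrak v\in\mathfrak V(\mathcal T)$. For every finite-dimensional subspace $\mathfrak U_h\subset\mathfrak U$ there is a unique $\mathfrak u_h\in\mathfrak U_h$ such that $$b(\mathfrak u_h,\mathfrak T\,\delta\mathfrak u)=L(\mathfrak T\,\delta\mathfrak u)\qquad\text{for all }\delta\mathfrak u\in\mathfrak U_h,$$ and it satisfies $$\|\mathfrak u-\mathfrak u_h\|_{\mathfrak U}\le C\,\|\mathfrak u-\mathfrak w\|_{\mathfrak U}\qquad\text{for all }\mathfrak w\in\mathfrak U_h .$$ -/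

import Mathlib

open MeasureTheory Topology
open scoped InnerProductSpace ContDiff

noncomputable section

namespace DPG

/-- `ℝᵈ` with the Euclidean norm. -/
abbrev Space (d : ℕ) : Type := EuclideanSpace ℝ (Fin d)

variable {d : ℕ}

/-! ### Domains and meshes -/

/-- `Ω` is a bounded Lipschitz domain: a bounded, open, connected, non-empty set such that, near each
boundary point and after a rotation, `Ω` is the set of points lying strictly above the graph of a
Lipschitz function.  Here `ν` is the "vertical" direction, `y - ⟪ν, y⟫ ν` the horizontal part of `y`
(only the values of `γ` on the hyperplane `ν^⊥` matter). -/
structure IsLipschitzDomain (Ω : Set (Space d)) : Prop where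
  isOpen : IsOpen Ω
  isConnected : IsConnected Ω
  isBounded : Bornology.IsBounded Ω
  local_graph : ∀ x ∈ frontier Ω, ∃ ν : Space d, ‖ν‖ = 1 ∧
    ∃ (K : NNReal) (γ : Space d → ℝ), LipschitzWith K γ ∧
      ∃ U ∈ 𝓝 x, ∀ y ∈ U, (y ∈ Ω ↔ γ (y - ⟪ν, y⟫_ℝ • ν) < ⟪ν, y⟫_ℝ)

/-- A mesh of `Ω`: finitely many pairwise disjoint Lipschitz elements `T ⊆ Ω` whose closures cover
the closure of `Ω`. -/
structure Mesh (Ω : Set (Space d)) where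
  elements : Set (Set (Space d))
  finite : elements.Finite
  lipschitz : ∀ T ∈ elements, IsLipschitzDomain T
  subset : ∀ T ∈ elements, T ⊆ Ω
  disjoint : elements.PairwiseDisjoint id
  cover : closure Ω = ⋃ T ∈ elements, closure T

/-! ### Lebesgue spaces, test functions, weak derivatives -/

/-- Scalar fields `L₂(Ω)`. -/
abbrev L2s (Ω : Set (Space d)) : Type := Lp ℝ 2 (volume.restrict Ω)

/-- Vector fields `L₂(Ω)ᵈ`. -/
abbrev L2v (Ω : Set (Space d)) : Type := Lp (Space d) 2 (volume.restrict Ω)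

/-- `φ ∈ C_c^∞(T)` (extended by zero). -/
structure IsTestFunction (T : Set (Space d)) (φ : Space d → ℝ) : Prop where
  smooth : ContDiff ℝ ∞ φ
  compact : HasCompactSupport φ
  support : tsupport φ ⊆ T

/-- The classical partial derivative `∂φ/∂xᵢ`. -/
def pderiv (i : Fin d) (φ : Space d → ℝ) (x : Space d) : ℝ :=
  fderiv ℝ φ x (EuclideanSpace.single i 1)

/-- `g = ∇v` on `T` in the weak sense, for `T ⊆ Ω`, `v ∈ L₂(Ω)`, `g ∈ L₂(Ω)ᵈ`. -/
def IsWeakGradOn (Ω T : Set (Space d)) (v : L2s Ω) (g : L2v Ω) : Prop :=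
  ∀ φ : Space d → ℝ, IsTestFunction T φ → ∀ i : Fin d,
    ∫ x in Ω, v x * pderiv i φ x = -∫ x in Ω, g x i * φ x

/-- `s = div τ` on `T` in the weak sense, for `T ⊆ Ω`, `τ ∈ L₂(Ω)ᵈ`, `s ∈ L₂(Ω)`. -/
def IsWeakDivOn (Ω T : Set (Space d)) (τ : L2v Ω) (s : L2s Ω) : Prop :=
  ∀ φ : Space d → ℝ, IsTestFunction T φ →
    ∑ i : Fin d, ∫ x in Ω, τ x i * pderiv i φ x = -∫ x in Ω, s x * φ x

/-! Facts that make the weak derivatives linear and closed. -/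

theorem IsTestFunction.memLp {T : Set (Space d)} {φ : Space d → ℝ} (h : IsTestFunction T φ)
    (Ω : Set (Space d)) : MemLp φ 2 (volume.restrict Ω) :=
  (h.smooth.continuous.memLp_of_hasCompactSupport h.compact).restrict Ω

theorem IsTestFunction.memLp_pderiv {T : Set (Space d)} {φ : Space d → ℝ}
    (h : IsTestFunction T φ) (Ω : Set (Space d)) (i : Fin d) :
    MemLp (pderiv i φ) 2 (volume.restrict Ω) := by
  refine (Continuous.memLp_of_hasCompactSupport ?_ ?_).restrict Ω
  · exact (h.smooth.continuous_fderiv (by simp)).clm_apply continuous_const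
  · exact h.compact.fderiv_apply (𝕜 := ℝ) _

theorem exists_pairing_scalar (Ω : Set (Space d)) {ψ : Space d → ℝ}
    (h : MemLp ψ 2 (volume.restrict Ω)) :
    ∃ ℓ : L2s Ω →L[ℝ] ℝ, ∀ v : L2s Ω, ∫ x in Ω, v x * ψ x = ℓ v := by
  refine ⟨innerSL ℝ (h.toLp ψ), fun v => ?_⟩
  rw [innerSL_apply_apply, L2.inner_def]
  refine integral_congr_ae ?_
  filter_upwards [h.coeFn_toLp] with x hx
  simp [hx]

theorem exists_pairing_vector (Ω : Set (Space d)) {ψ : Space d → ℝ}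
    (h : MemLp ψ 2 (volume.restrict Ω)) (i : Fin d) :
    ∃ ℓ : L2v Ω →L[ℝ] ℝ, ∀ g : L2v Ω, ∫ x in Ω, g x i * ψ x = ℓ g := by
  obtain ⟨ℓ, hℓ⟩ := exists_pairing_scalar Ω h
  refine ⟨ℓ.comp ((EuclideanSpace.proj i : Space d →L[ℝ] ℝ).compLpL 2 (volume.restrict Ω)),
    fun g => ?_⟩
  rw [ContinuousLinearMap.comp_apply, ← hℓ]
  refine integral_congr_ae ?_
  filter_upwards [(EuclideanSpace.proj i : Space d →L[ℝ] ℝ).coeFn_compLpL g] with x hx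
  rw [hx]
  simp

/-! ### Sobolev spaces

A function in `H¹` is stored together with its (unique) weak gradient, a field in `H(div)` together
with its (unique) weak divergence.  The spaces are subspaces of the Hilbert space
`L₂ ⊕ L₂` with inner product `(v, w) + (∇v, ∇w)`, resp. `(τ, σ) + (div τ, div σ)`. -/

/-- The Hilbert space of pairs `(v, g)`, with `‖(v, g)‖² = ‖v‖² + ‖g‖²`. -/
abbrev PairGrad (Ω : Set (Space d)) : Type := WithLp 2 (L2s Ω × L2v Ω)

/-- The Hilbert space of pairs `(τ, s)`, with `‖(τ, s)‖² = ‖τ‖² + ‖s‖²`. -/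
abbrev PairDiv (Ω : Set (Space d)) : Type := WithLp 2 (L2v Ω × L2s Ω)

theorem exists_functional_grad (Ω : Set (Space d)) {T : Set (Space d)} {φ : Space d → ℝ}
    (h : IsTestFunction T φ) (i : Fin d) :
    ∃ ℓ : PairGrad Ω →L[ℝ] ℝ, ∀ p : PairGrad Ω,
      (∫ x in Ω, p.fst x * pderiv i φ x = -∫ x in Ω, p.snd x i * φ x) ↔ ℓ p = 0 := by
  obtain ⟨ℓ₁, h₁⟩ := exists_pairing_scalar Ω (h.memLp_pderiv Ω i)
  obtain ⟨ℓ₂, h₂⟩ := exists_pairing_vector Ω (h.memLp Ω) i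
  refine ⟨ℓ₁.comp (WithLp.fstL 2 ℝ _ _) + ℓ₂.comp (WithLp.sndL 2 ℝ _ _), fun p => ?_⟩
  rw [h₁, h₂]
  exact eq_neg_iff_add_eq_zero

theorem exists_functional_div (Ω : Set (Space d)) {T : Set (Space d)} {φ : Space d → ℝ}
    (h : IsTestFunction T φ) :
    ∃ ℓ : PairDiv Ω →L[ℝ] ℝ, ∀ p : PairDiv Ω,
      (∑ i : Fin d, ∫ x in Ω, p.fst x i * pderiv i φ x = -∫ x in Ω, p.snd x * φ x) ↔
        ℓ p = 0 := by
  choose ℓ₁ h₁ using fun i => exists_pairing_vector Ω (h.memLp_pderiv Ω i) i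
  obtain ⟨ℓ₂, h₂⟩ := exists_pairing_scalar Ω (h.memLp Ω)
  refine ⟨(∑ i, ℓ₁ i).comp (WithLp.fstL 2 ℝ _ _) + ℓ₂.comp (WithLp.sndL 2 ℝ _ _), fun p => ?_⟩
  simp only [h₁, h₂, add_apply, ContinuousLinearMap.comp_apply,
    sum_apply]
  exact eq_neg_iff_add_eq_zero

/-- The broken space `H¹(𝒯) = ∏_{T ∈ 𝒯} H¹(T)`, for a family `𝒯` of open subsets of `Ω`: pairs
`(v, ∇v)` with `v ∈ L₂(Ω)` and `∇v ∈ L₂(Ω)ᵈ` the piecewise weak gradient.  (The elements of a mesh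
are disjoint and cover `Ω` up to a null set, so a family of functions on the elements is the same as
a function on `Ω`, and the norm induced by `PairGrad Ω` is the product norm.) -/
def BrokenH1 (Ω : Set (Space d)) (𝒯 : Set (Set (Space d))) : Submodule ℝ (PairGrad Ω) where
  carrier := {p | ∀ T ∈ 𝒯, IsWeakGradOn Ω T p.fst p.snd}
  zero_mem' := fun T _ φ hφ i => by
    obtain ⟨ℓ, hℓ⟩ := exists_functional_grad Ω hφ i
    exact (hℓ 0).2 (map_zero ℓ)
  add_mem' := fun {p q} hp hq T hT φ hφ i => by
    obtain ⟨ℓ, hℓ⟩ := exists_functional_grad Ω hφ i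
    exact (hℓ (p + q)).2
      (by rw [map_add, (hℓ p).1 (hp T hT φ hφ i), (hℓ q).1 (hq T hT φ hφ i), add_zero])
  smul_mem' := fun c p hp T hT φ hφ i => by
    obtain ⟨ℓ, hℓ⟩ := exists_functional_grad Ω hφ i
    exact (hℓ (c • p)).2 (by rw [map_smul, (hℓ p).1 (hp T hT φ hφ i), smul_zero])

/-- The broken space `H(div, 𝒯) = ∏_{T ∈ 𝒯} H(div, T)`: pairs `(τ, div τ)` with `τ ∈ L₂(Ω)ᵈ` and
`div τ ∈ L₂(Ω)` the piecewise weak divergence. -/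
def BrokenHdiv (Ω : Set (Space d)) (𝒯 : Set (Set (Space d))) : Submodule ℝ (PairDiv Ω) where
  carrier := {p | ∀ T ∈ 𝒯, IsWeakDivOn Ω T p.fst p.snd}
  zero_mem' := fun T _ φ hφ => by
    obtain ⟨ℓ, hℓ⟩ := exists_functional_div Ω hφ
    exact (hℓ 0).2 (map_zero ℓ)
  add_mem' := fun {p q} hp hq T hT φ hφ => by
    obtain ⟨ℓ, hℓ⟩ := exists_functional_div Ω hφ
    exact (hℓ (p + q)).2
      (by rw [map_add, (hℓ p).1 (hp T hT φ hφ), (hℓ q).1 (hq T hT φ hφ), add_zero])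
  smul_mem' := fun c p hp T hT φ hφ => by
    obtain ⟨ℓ, hℓ⟩ := exists_functional_div Ω hφ
    exact (hℓ (c • p)).2 (by rw [map_smul, (hℓ p).1 (hp T hT φ hφ), smul_zero])

instance (Ω : Set (Space d)) (𝒯 : Set (Set (Space d))) : CompleteSpace (BrokenH1 Ω 𝒯) := by
  have h : IsClosed (BrokenH1 Ω 𝒯 : Set (PairGrad Ω)) := by
    change IsClosed {p : PairGrad Ω | ∀ T ∈ 𝒯, IsWeakGradOn Ω T p.fst p.snd}
    simp only [IsWeakGradOn, Set.ofPred_forall]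
    refine isClosed_iInter fun T => isClosed_iInter fun _ => isClosed_iInter fun φ =>
      isClosed_iInter fun hφ => isClosed_iInter fun i => ?_
    obtain ⟨ℓ, hℓ⟩ := exists_functional_grad Ω hφ i
    simp only [hℓ]
    exact isClosed_eq ℓ.continuous continuous_const
  exact h.completeSpace_coe

instance (Ω : Set (Space d)) (𝒯 : Set (Set (Space d))) : CompleteSpace (BrokenHdiv Ω 𝒯) := by
  have h : IsClosed (BrokenHdiv Ω 𝒯 : Set (PairDiv Ω)) := by
    change IsClosed {p : PairDiv Ω | ∀ T ∈ 𝒯, IsWeakDivOn Ω T p.fst p.snd}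
    simp only [IsWeakDivOn, Set.ofPred_forall]
    refine isClosed_iInter fun T => isClosed_iInter fun _ => isClosed_iInter fun φ =>
      isClosed_iInter fun hφ => ?_
    obtain ⟨ℓ, hℓ⟩ := exists_functional_div Ω hφ
    simp only [hℓ]
    exact isClosed_eq ℓ.continuous continuous_const
  exact h.completeSpace_coe

/-- `H¹(Ω)`. -/
def H1 (Ω : Set (Space d)) : Submodule ℝ (PairGrad Ω) := BrokenH1 Ω {Ω}

/-- `H(div, Ω)`. -/
def Hdiv (Ω : Set (Space d)) : Submodule ℝ (PairDiv Ω) := BrokenHdiv Ω {Ω}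

/-- `H¹₀(Ω)`: the closure of `C_c^∞(Ω)` in `H¹(Ω)`. -/
def H10 (Ω : Set (Space d)) : Submodule ℝ (PairGrad Ω) :=
  (Submodule.span ℝ {p : PairGrad Ω | ∃ φ : Space d → ℝ, IsTestFunction Ω φ ∧
    p.fst =ᵐ[volume.restrict Ω] φ ∧
    ∀ i : Fin d, (fun x => p.snd x i) =ᵐ[volume.restrict Ω] pderiv i φ}).topologicalClosure

/-- `H₀(div, Ω)`: the fields `τ ∈ H(div, Ω)` with vanishing normal trace `(τ · n)|_{∂Ω}`, the normal
trace being the functional `v ↦ (v, div τ)_Ω + (∇v, τ)_Ω` on `H¹(Ω)`. -/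
def Hdiv0 (Ω : Set (Space d)) : Submodule ℝ (PairDiv Ω) where
  carrier := {τ | τ ∈ Hdiv Ω ∧
    ∀ v ∈ H1 Ω, ⟪(v : PairGrad Ω).fst, τ.snd⟫_ℝ + ⟪v.snd, τ.fst⟫_ℝ = 0}
  zero_mem' := ⟨zero_mem _, fun v _ => by simp⟩
  add_mem' := fun {σ τ} hσ hτ => ⟨add_mem hσ.1 hτ.1, fun v hv => by
    rw [WithLp.add_snd, WithLp.add_fst, inner_add_right, inner_add_right]
    linarith [hσ.2 v hv, hτ.2 v hv]⟩
  smul_mem' := fun c τ hτ => ⟨Submodule.smul_mem _ c hτ.1, fun v hv => by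
    rw [WithLp.smul_snd, WithLp.smul_fst, real_inner_smul_right, real_inner_smul_right, ← mul_add,
      hτ.2 v hv, mul_zero]⟩

/-! ### Broken spaces on a mesh, traces -/

section MeshSpaces

variable {Ω : Set (Space d)} (𝒯 : Mesh Ω)

/-- `H¹(𝒯)`. -/
abbrev H1T : Type := BrokenH1 Ω 𝒯.elements

/-- `H(div, 𝒯)`. -/
abbrev HdivT : Type := BrokenHdiv Ω 𝒯.elements

variable {𝒯}

/-- `v ↦ v`, `H¹(𝒯) → L₂(Ω)`. -/
def fn : H1T 𝒯 →L[ℝ] L2s Ω := (WithLp.fstL 2 ℝ _ _).comp (Submodule.subtypeL _)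

/-- The piecewise gradient `H¹(𝒯) → L₂(Ω)ᵈ`. -/
def grad : H1T 𝒯 →L[ℝ] L2v Ω := (WithLp.sndL 2 ℝ _ _).comp (Submodule.subtypeL _)

/-- `τ ↦ τ`, `H(div, 𝒯) → L₂(Ω)ᵈ`. -/
def field : HdivT 𝒯 →L[ℝ] L2v Ω := (WithLp.fstL 2 ℝ _ _).comp (Submodule.subtypeL _)

/-- The piecewise divergence `H(div, 𝒯) → L₂(Ω)`. -/
def dive : HdivT 𝒯 →L[ℝ] L2s Ω := (WithLp.sndL 2 ℝ _ _).comp (Submodule.subtypeL _)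

variable (𝒯)

/-- The trace operator `tr^∇ : H¹(𝒯) → H(div, 𝒯)'`,
`⟨tr^∇ v, τ⟩ = (v, div τ)_𝒯 + (∇v, τ)_𝒯`. -/
def traceGrad : H1T 𝒯 →ₗ[ℝ] (HdivT 𝒯 →L[ℝ] ℝ) where
  toFun v := (innerSL ℝ (fn v)).comp dive + (innerSL ℝ (grad v)).comp field
  map_add' v w := by ext τ; simp; ring
  map_smul' c v := by ext τ; simp

/-- The trace operator `tr^div : H(div, 𝒯) → H¹(𝒯)'`, `⟨tr^div τ, v⟩ = ⟨tr^∇ v, τ⟩`. -/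
def traceDiv : HdivT 𝒯 →ₗ[ℝ] (H1T 𝒯 →L[ℝ] ℝ) where
  toFun τ := (innerSL ℝ (dive τ)).comp fn + (innerSL ℝ (field τ)).comp grad
  map_add' τ σ := by ext v; simp; ring
  map_smul' c τ := by ext v; simp

theorem traceGrad_apply (v : H1T 𝒯) (τ : HdivT 𝒯) :
    traceGrad 𝒯 v τ = ⟪fn v, dive τ⟫_ℝ + ⟪grad v, field τ⟫_ℝ := rfl

theorem traceDiv_apply (τ : HdivT 𝒯) (v : H1T 𝒯) :
    traceDiv 𝒯 τ v = traceGrad 𝒯 v τ := by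
  rw [traceGrad_apply, real_inner_comm, real_inner_comm (field τ)]
  rfl

/-- `H^{1/2}(𝒮) = tr^∇(H¹(Ω))`. -/
def TrH1 : Submodule ℝ (HdivT 𝒯 →L[ℝ] ℝ) := ((H1 Ω).submoduleOf _).map (traceGrad 𝒯)

/-- `H^{1/2}_0(𝒮) = tr^∇(H¹₀(Ω))`. -/
def TrH10 : Submodule ℝ (HdivT 𝒯 →L[ℝ] ℝ) := ((H10 Ω).submoduleOf _).map (traceGrad 𝒯)

/-- `H^{-1/2}(𝒮) = tr^div(H(div, Ω))`. -/
def TrHdiv : Submodule ℝ (H1T 𝒯 →L[ℝ] ℝ) := ((Hdiv Ω).submoduleOf _).map (traceDiv 𝒯)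

/-- `H^{-1/2}_0(𝒮) = tr^div(H₀(div, Ω))`. -/
def TrHdiv0 : Submodule ℝ (H1T 𝒯 →L[ℝ] ℝ) := ((Hdiv0 Ω).submoduleOf _).map (traceDiv 𝒯)

variable {𝒯}

/-- The canonical trace norm `‖v̂‖_{1/2,𝒮} = inf {‖v‖₁ ; v ∈ H¹(Ω), tr^∇ v = v̂}`. -/
def normHalf (v' : HdivT 𝒯 →L[ℝ] ℝ) : ℝ :=
  sInf {r | ∃ v : H1T 𝒯, (v : PairGrad Ω) ∈ H1 Ω ∧ traceGrad 𝒯 v = v' ∧ r = ‖v‖}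

/-- The canonical trace norm `‖τ̂‖_{-1/2,𝒮} = inf {‖τ‖_div ; τ ∈ H(div, Ω), tr^div τ = τ̂}`. -/
def normNegHalf (τ' : H1T 𝒯 →L[ℝ] ℝ) : ℝ :=
  sInf {r | ∃ τ : HdivT 𝒯, (τ : PairDiv Ω) ∈ Hdiv Ω ∧ traceDiv 𝒯 τ = τ' ∧ r = ‖τ‖}

/-! ### The variational formulation and the DPG scheme -/

variable (𝒯)

/-- The trial space `𝔘 = 𝔘₀ × 𝔘̂` of tuples `((u₁, u₂, u₃, u₄), (û₁, û₂, û₃, û₄))`. -/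
def Trial : Type :=
  (L2v Ω × L2s Ω × L2v Ω × L2s Ω) × (TrHdiv0 𝒯 × TrH10 𝒯 × TrHdiv 𝒯 × TrH1 𝒯)

instance : AddCommGroup (Trial 𝒯) :=
  inferInstanceAs (AddCommGroup
    ((L2v Ω × L2s Ω × L2v Ω × L2s Ω) × (TrHdiv0 𝒯 × TrH10 𝒯 × TrHdiv 𝒯 × TrH1 𝒯)))

instance : Module ℝ (Trial 𝒯) :=
  inferInstanceAs (Module ℝ
    ((L2v Ω × L2s Ω × L2v Ω × L2s Ω) × (TrHdiv0 𝒯 × TrH10 𝒯 × TrHdiv 𝒯 × TrH1 𝒯)))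

/-- The test space `𝔙(𝒯) = H(div, 𝒯) × H¹(𝒯) × H(div, 𝒯) × H¹(𝒯)` of tuples `(v₁, v₂, v₃, v₄)`, a
Hilbert space with the sum of the four inner products. -/
abbrev Test : Type :=
  WithLp 2 (WithLp 2 (HdivT 𝒯 × H1T 𝒯) × WithLp 2 (HdivT 𝒯 × H1T 𝒯))

variable {𝒯}

/-- The norm of the trial space. -/
def normU (u : Trial 𝒯) : ℝ :=
  Real.sqrt (‖u.1.1‖ ^ 2 + ‖u.1.2.1‖ ^ 2 + ‖u.1.2.2.1‖ ^ 2 + ‖u.1.2.2.2‖ ^ 2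
    + normNegHalf (u.2.1 : H1T 𝒯 →L[ℝ] ℝ) ^ 2
    + normHalf (u.2.2.1 : HdivT 𝒯 →L[ℝ] ℝ) ^ 2
    + normNegHalf (u.2.2.2.1 : H1T 𝒯 →L[ℝ] ℝ) ^ 2
    + normHalf (u.2.2.2.2 : HdivT 𝒯 →L[ℝ] ℝ) ^ 2)

/-- The component `v₁` of a test function. -/
def test1 : Test 𝒯 →L[ℝ] HdivT 𝒯 := (WithLp.fstL 2 ℝ _ _).comp (WithLp.fstL 2 ℝ _ _)

/-- The component `v₂` of a test function. -/
def test2 : Test 𝒯 →L[ℝ] H1T 𝒯 := (WithLp.sndL 2 ℝ _ _).comp (WithLp.fstL 2 ℝ _ _)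

/-- The component `v₃` of a test function. -/
def test3 : Test 𝒯 →L[ℝ] HdivT 𝒯 := (WithLp.fstL 2 ℝ _ _).comp (WithLp.sndL 2 ℝ _ _)

/-- The component `v₄` of a test function. -/
def test4 : Test 𝒯 →L[ℝ] H1T 𝒯 := (WithLp.sndL 2 ℝ _ _).comp (WithLp.sndL 2 ℝ _ _)

/-- The bilinear form
`b(u, v) = (u₁, v₁ - ∇v₄) - (u₂, v₄ + div v₃) - (u₃, v₃ + ∇v₂) - (u₄, v₂ + div v₁)
  + ⟨û₁, v₄⟩ + ⟨û₂, v₃⟩ + ⟨û₃, v₂⟩ + ⟨û₄, v₁⟩`. -/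
def bForm (u : Trial 𝒯) (v : Test 𝒯) : ℝ :=
  ⟪u.1.1, field (test1 v) - grad (test4 v)⟫_ℝ
    - ⟪u.1.2.1, fn (test4 v) + dive (test3 v)⟫_ℝ
    - ⟪u.1.2.2.1, field (test3 v) + grad (test2 v)⟫_ℝ
    - ⟪u.1.2.2.2, fn (test2 v) + dive (test1 v)⟫_ℝ
    + (u.2.1 : H1T 𝒯 →L[ℝ] ℝ) (test4 v)
    + (u.2.2.1 : HdivT 𝒯 →L[ℝ] ℝ) (test3 v)
    + (u.2.2.2.1 : H1T 𝒯 →L[ℝ] ℝ) (test2 v)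
    + (u.2.2.2.2 : HdivT 𝒯 →L[ℝ] ℝ) (test1 v)

/-- The functional `L(v) = (f, v₁)`. -/
def load (f : L2v Ω) (v : Test 𝒯) : ℝ := ⟪f, field (test1 v)⟫_ℝ

/-- `Bu = b(u, ·)` as a bounded functional on the test space. -/
def bFunctional (u : Trial 𝒯) : Test 𝒯 →L[ℝ] ℝ :=
  (innerSL ℝ u.1.1).comp (field.comp test1 - grad.comp test4)
    - (innerSL ℝ u.1.2.1).comp (fn.comp test4 + dive.comp test3)
    - (innerSL ℝ u.1.2.2.1).comp (field.comp test3 + grad.comp test2)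
    - (innerSL ℝ u.1.2.2.2).comp (fn.comp test2 + dive.comp test1)
    + (u.2.1 : H1T 𝒯 →L[ℝ] ℝ).comp test4
    + (u.2.2.1 : HdivT 𝒯 →L[ℝ] ℝ).comp test3
    + (u.2.2.2.1 : H1T 𝒯 →L[ℝ] ℝ).comp test2
    + (u.2.2.2.2 : HdivT 𝒯 →L[ℝ] ℝ).comp test1

theorem bFunctional_apply (u : Trial 𝒯) (v : Test 𝒯) : bFunctional u v = bForm u v := rfl

/-- The trial-to-test operator `𝔗 : 𝔘 → 𝔙(𝒯)`, the Riesz representative of `b(u, ·)`. -/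
def trialToTest (u : Trial 𝒯) : Test 𝒯 := (InnerProductSpace.toDual ℝ (Test 𝒯)).symm (bFunctional u)

/-- The defining property of the trial-to-test operator. -/
theorem inner_trialToTest (u : Trial 𝒯) (v : Test 𝒯) : ⟪trialToTest u, v⟫_ℝ = bForm u v := by
  rw [trialToTest, InnerProductSpace.toDual_symm_apply, bFunctional_apply]

/-- `u` solves the ultraweak formulation: `b(u, v) = L(v)` for all `v ∈ 𝔙(𝒯)`. -/
def IsSolution (f : L2v Ω) (u : Trial 𝒯) : Prop := ∀ v : Test 𝒯, bForm u v = load f v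

/-- `u_h ∈ 𝔘_h` solves the DPG scheme: `b(u_h, 𝔗 δu) = L(𝔗 δu)` for all `δu ∈ 𝔘_h`. -/
def IsDPGSolution (f : L2v Ω) (Uh : Submodule ℝ (Trial 𝒯)) (uh : Trial 𝒯) : Prop :=
  uh ∈ Uh ∧ ∀ δu ∈ Uh, bForm uh (trialToTest δu) = load f (trialToTest δu)

end MeshSpaces

end DPG

end

noncomputable section

namespace DPG

variable {d : ℕ}

/-! ### Test functions as elements of the Sobolev spaces -/

/-! Since `𝔗u` is the Riesz representative of `b(u, ·)`, the scheme is the normal equation `⟪𝔗u_h,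
𝔗δ⟫ = ⟪𝔗u, 𝔗δ⟫`, so `u_h` is the best approximation of `u` in the norm `‖𝔗 ·‖`. Everything therefore
reduces to the equivalence of `‖𝔗 ·‖` with `normU`, with constants independent of the mesh:
boundedness (`norm_trialToTest_le`) and the inf-sup condition (`IsLipschitzDomain.exists_normU_le`).

The core is a problem on `Ω` that does not see the mesh: the system `u₁ + ∇u₄ = f₁`, `u₂ - div u₁ =
f₂`, `u₃ - ∇u₂ = f₃`, `u₄ - div u₃ = f₄` with `u₁ ∈ H₀(div)`, `u₂ ∈ H¹₀`, `u₃ ∈ H(div)`, `u₄ ∈ H¹`.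
Green's formula for the pairs `(u₁, u₄)` and `(u₂, u₃)` gives an energy identity for `‖u₁‖² +
‖u₃‖²`. The Friedrichs inequality controls `u₂`. A Poincaré inequality controls `u₄` up to a
weighted mean, and that mean is read off from the fourth equation by testing with a weight in `H¹₀`
(`IsLipschitzDomain.first_order_system_bound`). The bound makes the range closed. The adjoint system
is the same system up to signs and relabelling, so the range is everything
(`IsLipschitzDomain.first_order_system_surjective`).

On the mesh, conforming test functions annihilate the trace terms of `b`. Testing with the
conforming solution for suitable data bounds the four fields
(`IsLipschitzDomain.exists_field_bound`). Testing with one broken component at a time then bounds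
each trace in its dual norm. The dual norms coincide with the minimum extension norms
(`normNegHalf_eq`, `normHalf_eq`): swapping the function and derivative components of a Riesz
representative yields an extension of the same norm. Solvability of the ultraweak problem comes from
the same conforming system, together with its traces. -/

theorem IsTestFunction.mono {S T : Set (Space d)} {φ : Space d → ℝ} (h : IsTestFunction S φ)
    (hST : S ⊆ T) : IsTestFunction T φ :=
  ⟨h.smooth, h.compact, h.support.trans hST⟩

theorem IsTestFunction.eq_zero {T : Set (Space d)} {φ : Space d → ℝ} (h : IsTestFunction T φ)
    {x : Space d} (hx : x ∉ T) : φ x = 0 :=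
  image_eq_zero_of_notMem_tsupport fun hx' => hx (h.support hx')

theorem IsTestFunction.continuous_pderiv {T : Set (Space d)} {φ : Space d → ℝ}
    (h : IsTestFunction T φ) (i : Fin d) : Continuous (pderiv i φ) :=
  (h.smooth.continuous_fderiv (by simp)).clm_apply continuous_const

theorem IsTestFunction.pderiv_eq_zero {T : Set (Space d)} {φ : Space d → ℝ}
    (h : IsTestFunction T φ) (i : Fin d) {x : Space d} (hx : x ∉ T) : pderiv i φ x = 0 := by
  have : fderiv ℝ φ x = 0 :=
    image_eq_zero_of_notMem_tsupport fun hx' => hx (h.support (tsupport_fderiv_subset ℝ hx'))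
  simp [pderiv, this]

theorem IsTestFunction.differentiable {T : Set (Space d)} {φ : Space d → ℝ}
    (h : IsTestFunction T φ) : Differentiable ℝ φ :=
  h.smooth.differentiable (by simp)

/-- Integration by parts for a test function against a smooth function. -/
theorem IsTestFunction.integral_mul_pderiv {S T : Set (Space d)} {φ ψ : Space d → ℝ}
    (hφ : IsTestFunction S φ) (hψ : IsTestFunction T ψ) (i : Fin d) :
    ∫ x, φ x * pderiv i ψ x = -∫ x, pderiv i φ x * ψ x := by
  refine integral_mul_fderiv_eq_neg_fderiv_mul_of_integrable (f := φ) (g := ψ) ?_ ?_ ?_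
    (fun x _ => hφ.differentiable x) (fun x _ => hψ.differentiable x)
  · exact ((hφ.continuous_pderiv i).mul hψ.smooth.continuous).integrable_of_hasCompactSupport
      hψ.compact.mul_left
  · exact (hφ.smooth.continuous.mul (hψ.continuous_pderiv i)).integrable_of_hasCompactSupport
      hφ.compact.mul_right
  · exact (hφ.smooth.continuous.mul hψ.smooth.continuous).integrable_of_hasCompactSupport
      hφ.compact.mul_right

theorem IsTestFunction.memLp_gradient {T : Set (Space d)} {φ : Space d → ℝ}
    (h : IsTestFunction T φ) (Ω : Set (Space d)) :
    MemLp (fun x => WithLp.toLp 2 (fun i => pderiv i φ x) : Space d → Space d) 2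
      (volume.restrict Ω) := by
  refine (Continuous.memLp_of_hasCompactSupport ?_ ?_).restrict Ω
  · exact (PiLp.continuous_toLp 2 _).comp (continuous_pi fun i => h.continuous_pderiv i)
  · refine (h.compact.fderiv (𝕜 := ℝ)).mono' fun x hx => subset_tsupport _ ?_
    contrapose! hx
    have : fderiv ℝ φ x = 0 := by simpa using hx
    simp only [Function.mem_support, not_not]
    ext i
    simp [pderiv, this]

theorem IsTestFunction.memLp_smul_single {T : Set (Space d)} {φ : Space d → ℝ}
    (h : IsTestFunction T φ) (Ω : Set (Space d)) (i : Fin d) :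
    MemLp (fun x => φ x • EuclideanSpace.single i (1 : ℝ) : Space d → Space d) 2
      (volume.restrict Ω) := by
  refine (Continuous.memLp_of_hasCompactSupport ?_ ?_).restrict Ω
  · exact h.smooth.continuous.smul continuous_const
  · exact h.compact.smul_right

/-- The pair `(φ, ∇φ)`. -/
def IsTestFunction.pairGrad {T : Set (Space d)} {φ : Space d → ℝ} (h : IsTestFunction T φ)
    (Ω : Set (Space d)) : PairGrad Ω :=
  WithLp.toLp 2 ((h.memLp Ω).toLp, (h.memLp_gradient Ω).toLp)

/-- The pair `(φ eᵢ, ∂ᵢφ)`. -/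
def IsTestFunction.pairDiv {T : Set (Space d)} {φ : Space d → ℝ} (h : IsTestFunction T φ)
    (Ω : Set (Space d)) (i : Fin d) : PairDiv Ω :=
  WithLp.toLp 2 ((h.memLp_smul_single Ω i).toLp, (h.memLp_pderiv Ω i).toLp)

/-! ### Weak derivatives as orthogonality relations -/

section Pairings

variable {Ω T : Set (Space d)} {φ : Space d → ℝ}

theorem IsTestFunction.inner_pairGrad_fst (h : IsTestFunction T φ) (v : L2s Ω) :
    ⟪v, (h.pairGrad Ω).fst⟫_ℝ = ∫ x in Ω, v x * φ x := by
  rw [L2.inner_def]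
  refine integral_congr_ae ?_
  filter_upwards [(h.memLp Ω).coeFn_toLp] with x hx
  rw [IsTestFunction.pairGrad, WithLp.toLp_fst, hx, RCLike.inner_apply, conj_trivial, mul_comm]

theorem IsTestFunction.inner_pairDiv_snd (h : IsTestFunction T φ) (v : L2s Ω)
    (i : Fin d) :
    ⟪v, (h.pairDiv Ω i).snd⟫_ℝ = ∫ x in Ω, v x * pderiv i φ x := by
  rw [L2.inner_def]
  refine integral_congr_ae ?_
  filter_upwards [(h.memLp_pderiv Ω i).coeFn_toLp] with x hx
  rw [IsTestFunction.pairDiv, WithLp.toLp_snd, hx, RCLike.inner_apply, conj_trivial, mul_comm]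

theorem IsTestFunction.inner_pairDiv_fst (h : IsTestFunction T φ) (g : L2v Ω)
    (i : Fin d) :
    ⟪g, (h.pairDiv Ω i).fst⟫_ℝ = ∫ x in Ω, g x i * φ x := by
  rw [L2.inner_def]
  refine integral_congr_ae ?_
  filter_upwards [(h.memLp_smul_single Ω i).coeFn_toLp] with x hx
  rw [IsTestFunction.pairDiv, WithLp.toLp_fst, hx, real_inner_smul_right,
    EuclideanSpace.inner_single_right]
  simp [mul_comm]

theorem integrable_coord_mul (g : L2v Ω) {ψ : Space d → ℝ}
    (hψ : MemLp ψ 2 (volume.restrict Ω)) (i : Fin d) :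
    IntegrableOn (fun x => g x i * ψ x) Ω := by
  have hg : MemLp (fun x => g x i) 2 (volume.restrict Ω) :=
    (EuclideanSpace.proj i : Space d →L[ℝ] ℝ).comp_memLp' (Lp.memLp g)
  exact hg.integrable_mul hψ

theorem IsTestFunction.inner_pairGrad_snd (h : IsTestFunction T φ) (g : L2v Ω) :
    ⟪g, (h.pairGrad Ω).snd⟫_ℝ = ∑ i, ∫ x in Ω, g x i * pderiv i φ x := by
  rw [L2.inner_def, ← integral_finsetSum]
  · refine integral_congr_ae ?_
    filter_upwards [(h.memLp_gradient Ω).coeFn_toLp] with x hx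
    rw [IsTestFunction.pairGrad, WithLp.toLp_snd, hx, PiLp.inner_apply]
    simp [mul_comm]
  · exact fun i _ => integrable_coord_mul g (h.memLp_pderiv Ω i) i

end Pairings

/-- A weak gradient pair is one that is orthogonal, after swapping components, to all `(φ eᵢ, ∂ᵢφ)`;
likewise for the divergence and `(φ, ∇φ)`. In this form closedness, Green's formula and the Riesz
arguments become statements about Hilbert spaces. -/
theorem isWeakGradOn_iff {Ω T : Set (Space d)} {v : L2s Ω} {g : L2v Ω} :
    IsWeakGradOn Ω T v g ↔ ∀ φ : Space d → ℝ, ∀ h : IsTestFunction T φ, ∀ i : Fin d,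
      ⟪v, (h.pairDiv Ω i).snd⟫_ℝ + ⟪g, (h.pairDiv Ω i).fst⟫_ℝ = 0 := by
  refine forall_congr' fun φ => forall_congr' fun h => forall_congr' fun i => ?_
  rw [h.inner_pairDiv_fst, h.inner_pairDiv_snd, eq_neg_iff_add_eq_zero]

theorem isWeakDivOn_iff {Ω T : Set (Space d)} {τ : L2v Ω} {s : L2s Ω} :
    IsWeakDivOn Ω T τ s ↔ ∀ φ : Space d → ℝ, ∀ h : IsTestFunction T φ,
      ⟪s, (h.pairGrad Ω).fst⟫_ℝ + ⟪τ, (h.pairGrad Ω).snd⟫_ℝ = 0 := by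
  refine forall_congr' fun φ => forall_congr' fun h => ?_
  rw [h.inner_pairGrad_fst, h.inner_pairGrad_snd, eq_neg_iff_add_eq_zero, add_comm]

theorem mem_brokenH1_iff {Ω : Set (Space d)} {𝒯 : Set (Set (Space d))} {p : PairGrad Ω} :
    p ∈ BrokenH1 Ω 𝒯 ↔ ∀ T ∈ 𝒯, ∀ φ : Space d → ℝ, ∀ h : IsTestFunction T φ, ∀ i : Fin d,
      ⟪p.fst, (h.pairDiv Ω i).snd⟫_ℝ + ⟪p.snd, (h.pairDiv Ω i).fst⟫_ℝ = 0 :=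
  forall₂_congr fun _ _ => isWeakGradOn_iff

theorem mem_brokenHdiv_iff {Ω : Set (Space d)} {𝒯 : Set (Set (Space d))} {p : PairDiv Ω} :
    p ∈ BrokenHdiv Ω 𝒯 ↔ ∀ T ∈ 𝒯, ∀ φ : Space d → ℝ, ∀ h : IsTestFunction T φ,
      ⟪p.snd, (h.pairGrad Ω).fst⟫_ℝ + ⟪p.fst, (h.pairGrad Ω).snd⟫_ℝ = 0 :=
  forall₂_congr fun _ _ => isWeakDivOn_iff

theorem mem_H1_iff {Ω : Set (Space d)} {p : PairGrad Ω} :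
    p ∈ H1 Ω ↔ ∀ φ : Space d → ℝ, ∀ h : IsTestFunction Ω φ, ∀ i : Fin d,
      ⟪p.fst, (h.pairDiv Ω i).snd⟫_ℝ + ⟪p.snd, (h.pairDiv Ω i).fst⟫_ℝ = 0 := by
  rw [H1, mem_brokenH1_iff]
  simp only [Set.mem_singleton_iff, forall_eq]

theorem mem_Hdiv_iff {Ω : Set (Space d)} {p : PairDiv Ω} :
    p ∈ Hdiv Ω ↔ ∀ φ : Space d → ℝ, ∀ h : IsTestFunction Ω φ,
      ⟪p.snd, (h.pairGrad Ω).fst⟫_ℝ + ⟪p.fst, (h.pairGrad Ω).snd⟫_ℝ = 0 := by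
  rw [Hdiv, mem_brokenHdiv_iff]
  simp only [Set.mem_singleton_iff, forall_eq]

theorem H1_le_brokenH1 {Ω : Set (Space d)} {𝒯 : Set (Set (Space d))} (h𝒯 : ∀ T ∈ 𝒯, T ⊆ Ω) :
    H1 Ω ≤ BrokenH1 Ω 𝒯 := fun _ hp T hT φ hφ i => hp Ω rfl φ (hφ.mono (h𝒯 T hT)) i

theorem Hdiv_le_brokenHdiv {Ω : Set (Space d)} {𝒯 : Set (Set (Space d))}
    (h𝒯 : ∀ T ∈ 𝒯, T ⊆ Ω) : Hdiv Ω ≤ BrokenHdiv Ω 𝒯 :=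
  fun _ hp T hT φ hφ => hp Ω rfl φ (hφ.mono (h𝒯 T hT))

/-- Integration by parts against `ψ ∈ C_c^∞(Ω)`. The support of `ψ` alone turns integrals over `Ω`
into integrals over the whole space, so `φ` need not be supported in `Ω`. -/
theorem IsTestFunction.pairGrad_mem_H1 {Ω T : Set (Space d)} {φ : Space d → ℝ}
    (h : IsTestFunction T φ) : h.pairGrad Ω ∈ H1 Ω := by
  refine mem_H1_iff.2 fun ψ hψ i => ?_
  rw [real_inner_comm, real_inner_comm (hψ.pairDiv Ω i).fst, h.inner_pairGrad_fst,
    h.inner_pairGrad_snd]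
  have e₁ : ∫ x in Ω, (hψ.pairDiv Ω i).snd x * φ x = ∫ x in Ω, pderiv i ψ x * φ x := by
    refine integral_congr_ae ?_
    filter_upwards [(hψ.memLp_pderiv Ω i).coeFn_toLp] with x hx
    rw [IsTestFunction.pairDiv, WithLp.toLp_snd, hx]
  have e₂ : ∑ j, ∫ x in Ω, (hψ.pairDiv Ω i).fst x j * pderiv j φ x
      = ∫ x in Ω, ψ x * pderiv i φ x := by
    rw [Finset.sum_eq_single i]
    · refine integral_congr_ae ?_
      filter_upwards [(hψ.memLp_smul_single Ω i).coeFn_toLp] with x hx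
      rw [IsTestFunction.pairDiv, WithLp.toLp_fst, hx]
      simp
    · intro j _ hj
      refine integral_eq_zero_of_ae ?_
      filter_upwards [(hψ.memLp_smul_single Ω i).coeFn_toLp] with x hx
      rw [IsTestFunction.pairDiv, WithLp.toLp_fst, hx]
      simp [hj]
    · simp
  rw [e₁, e₂, setIntegral_eq_integral_of_forall_compl_eq_zero
      (fun x hx => by rw [hψ.pderiv_eq_zero i hx, zero_mul]),
    setIntegral_eq_integral_of_forall_compl_eq_zero
      (fun x hx => by rw [hψ.eq_zero hx, zero_mul]), hψ.integral_mul_pderiv h i, add_neg_cancel]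

/-- `(∂ᵢφ, ψ) + (φ, ∂ᵢψ) = 0`, as membership of `φ eᵢ` in `H(div)`. -/
theorem IsTestFunction.pairDiv_mem_Hdiv {Ω T : Set (Space d)} {φ : Space d → ℝ}
    (h : IsTestFunction T φ) (i : Fin d) : h.pairDiv Ω i ∈ Hdiv Ω := by
  refine mem_Hdiv_iff.2 fun ψ hψ => ?_
  rw [hψ.inner_pairGrad_fst, hψ.inner_pairGrad_snd]
  have e₁ : ∫ x in Ω, (h.pairDiv Ω i).snd x * ψ x = ∫ x in Ω, pderiv i φ x * ψ x := by
    refine integral_congr_ae ?_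
    filter_upwards [(h.memLp_pderiv Ω i).coeFn_toLp] with x hx
    rw [IsTestFunction.pairDiv, WithLp.toLp_snd, hx]
  have e₂ : ∑ j, ∫ x in Ω, (h.pairDiv Ω i).fst x j * pderiv j ψ x
      = ∫ x in Ω, φ x * pderiv i ψ x := by
    rw [Finset.sum_eq_single i]
    · refine integral_congr_ae ?_
      filter_upwards [(h.memLp_smul_single Ω i).coeFn_toLp] with x hx
      rw [IsTestFunction.pairDiv, WithLp.toLp_fst, hx]
      simp
    · intro j _ hj
      refine integral_eq_zero_of_ae ?_
      filter_upwards [(h.memLp_smul_single Ω i).coeFn_toLp] with x hx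
      rw [IsTestFunction.pairDiv, WithLp.toLp_fst, hx]
      simp [hj]
    · simp
  rw [e₁, e₂, setIntegral_eq_integral_of_forall_compl_eq_zero
      (fun x hx => by rw [hψ.eq_zero hx, mul_zero]),
    setIntegral_eq_integral_of_forall_compl_eq_zero
      (fun x hx => by rw [hψ.pderiv_eq_zero i hx, mul_zero]), h.integral_mul_pderiv hψ i,
    add_neg_cancel]

/-! ### The spaces with boundary conditions and Green's formula -/

theorem IsTestFunction.pairDiv_mem_Hdiv0 {Ω : Set (Space d)} {φ : Space d → ℝ}
    (h : IsTestFunction Ω φ) (i : Fin d) : h.pairDiv Ω i ∈ Hdiv0 Ω :=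
  ⟨h.pairDiv_mem_Hdiv i, fun _ hv => mem_H1_iff.1 hv φ h i⟩

theorem IsTestFunction.pairGrad_mem_H10 {Ω : Set (Space d)} {φ : Space d → ℝ}
    (h : IsTestFunction Ω φ) : h.pairGrad Ω ∈ H10 Ω := by
  refine Submodule.le_topologicalClosure _ (Submodule.subset_span ⟨φ, h, ?_, fun i => ?_⟩)
  · exact (h.memLp Ω).coeFn_toLp
  · filter_upwards [(h.memLp_gradient Ω).coeFn_toLp] with x hx
    rw [IsTestFunction.pairGrad, WithLp.toLp_snd, hx]

/-- `C_c^∞(Ω)` inside `H¹(Ω)`, as the generators in the definition of `H¹₀(Ω)`. -/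
theorem H10_eq_closure_span (Ω : Set (Space d)) :
    H10 Ω = (Submodule.span ℝ {p : PairGrad Ω | ∃ φ, ∃ h : IsTestFunction Ω φ,
      p = h.pairGrad Ω}).topologicalClosure := by
  rw [H10]
  congr 2
  ext p
  refine exists_congr fun φ => ⟨fun ⟨h, h₁, h₂⟩ => ⟨h, ?_⟩, ?_⟩
  · apply (WithLp.equiv 2 _).injective
    refine Prod.ext ?_ ?_
    · exact Lp.ext (h₁.trans (h.memLp Ω).coeFn_toLp.symm)
    · refine Lp.ext ?_
      filter_upwards [(h.memLp_gradient Ω).coeFn_toLp, ae_all_iff.2 h₂] with x hx hx₂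
      ext i
      exact (hx₂ i).trans (congrArg (fun y : Space d => y i) hx).symm
  · rintro ⟨h, rfl⟩
    refine ⟨h, (h.memLp Ω).coeFn_toLp, fun i => ?_⟩
    filter_upwards [(h.memLp_gradient Ω).coeFn_toLp] with x hx
    rw [IsTestFunction.pairGrad, WithLp.toLp_snd, hx]

/-- A closed condition that holds for test functions holds on `H¹₀(Ω)`. -/
theorem H10_le_of_isClosed {Ω : Set (Space d)} {K : Submodule ℝ (PairGrad Ω)}
    (hK : IsClosed (K : Set (PairGrad Ω)))
    (h : ∀ φ : Space d → ℝ, ∀ hφ : IsTestFunction Ω φ, hφ.pairGrad Ω ∈ K) : H10 Ω ≤ K := by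
  rw [H10_eq_closure_span]
  refine Submodule.topologicalClosure_minimal _ (Submodule.span_le.2 ?_) hK
  rintro p ⟨φ, hφ, rfl⟩
  exact h φ hφ

theorem isClosed_H1 (Ω : Set (Space d)) : IsClosed (H1 Ω : Set (PairGrad Ω)) :=
  (completeSpace_coe_iff_isComplete.1
    (inferInstanceAs (CompleteSpace (BrokenH1 Ω {Ω})))).isClosed

theorem isClosed_Hdiv (Ω : Set (Space d)) : IsClosed (Hdiv Ω : Set (PairDiv Ω)) :=
  (completeSpace_coe_iff_isComplete.1
    (inferInstanceAs (CompleteSpace (BrokenHdiv Ω {Ω})))).isClosed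

theorem isClosed_H10 (Ω : Set (Space d)) : IsClosed (H10 Ω : Set (PairGrad Ω)) :=
  Submodule.isClosed_topologicalClosure _

theorem H10_le_H1 (Ω : Set (Space d)) : H10 Ω ≤ H1 Ω :=
  H10_le_of_isClosed (isClosed_H1 Ω) fun _ hφ => hφ.pairGrad_mem_H1

/-- The functional `p ↦ (p₁, s) + (p₂, τ)`, whose kernel is closed. -/
theorem isClosed_ker_pairing {E F : Type*} [NormedAddCommGroup E] [InnerProductSpace ℝ E]
    [NormedAddCommGroup F] [InnerProductSpace ℝ F] (s : E) (τ : F) :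
    IsClosed {p : WithLp 2 (E × F) | ⟪p.fst, s⟫_ℝ + ⟪p.snd, τ⟫_ℝ = 0} := by
  refine isClosed_eq ?_ continuous_const
  exact ((WithLp.fstL 2 ℝ E F).continuous.inner continuous_const).add
    ((WithLp.sndL 2 ℝ E F).continuous.inner continuous_const)

/-- The vanishing normal trace is an intersection, over `v ∈ H¹(Ω)`, of kernels of continuous
functionals. -/
theorem isClosed_Hdiv0 (Ω : Set (Space d)) : IsClosed (Hdiv0 Ω : Set (PairDiv Ω)) := by
  have : (Hdiv0 Ω : Set (PairDiv Ω)) = (Hdiv Ω : Set (PairDiv Ω)) ∩ ⋂ v ∈ H1 Ω,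
      {τ : PairDiv Ω | ⟪τ.fst, v.snd⟫_ℝ + ⟪τ.snd, v.fst⟫_ℝ = 0} := by
    ext τ
    simp only [Set.mem_inter_iff, Set.mem_iInter, Set.mem_ofPred_eq]
    refine and_congr_right fun _ => forall₂_congr fun v _ => ?_
    rw [real_inner_comm τ.fst, real_inner_comm τ.snd, add_comm]
  rw [this]
  exact (isClosed_Hdiv Ω).inter (isClosed_biInter fun v _ => isClosed_ker_pairing _ _)

/-- Green's formula between `H¹₀(Ω)` and `H(div, Ω)`. -/
theorem inner_add_inner_eq_zero_of_mem_H10 {Ω : Set (Space d)} {v : PairGrad Ω} (hv : v ∈ H10 Ω)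
    {τ : PairDiv Ω} (hτ : τ ∈ Hdiv Ω) : ⟪v.fst, τ.snd⟫_ℝ + ⟪v.snd, τ.fst⟫_ℝ = 0 := by
  let K : Submodule ℝ (PairGrad Ω) := LinearMap.ker
    (((innerSL ℝ τ.snd).comp (WithLp.fstL 2 ℝ _ _) +
      (innerSL ℝ τ.fst).comp (WithLp.sndL 2 ℝ _ _) : PairGrad Ω →L[ℝ] ℝ) : PairGrad Ω →ₗ[ℝ] ℝ)
  have hK : ∀ p, p ∈ K ↔ ⟪p.fst, τ.snd⟫_ℝ + ⟪p.snd, τ.fst⟫_ℝ = 0 := fun p => by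
    rw [real_inner_comm, real_inner_comm τ.fst]; rfl
  refine (hK v).1 (H10_le_of_isClosed ?_ (fun φ hφ => (hK _).2 ?_) hv)
  · exact ContinuousLinearMap.isClosed_ker _
  · rw [real_inner_comm, real_inner_comm τ.fst]
    exact mem_Hdiv_iff.1 hτ φ hφ

/-- `H¹₀(Ω)` is characterized by Green's formula against `H(div, Ω)`. -/
theorem mem_H10_iff {Ω : Set (Space d)} {p : PairGrad Ω} :
    p ∈ H10 Ω ↔ ∀ τ ∈ Hdiv Ω, ⟪p.fst, τ.snd⟫_ℝ + ⟪p.snd, τ.fst⟫_ℝ = 0 := by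
  refine ⟨fun hp τ hτ => inner_add_inner_eq_zero_of_mem_H10 hp hτ, fun hp => ?_⟩
  have : CompleteSpace (H10 Ω) := (isClosed_H10 Ω).completeSpace_coe
  rw [← Submodule.orthogonal_orthogonal (H10 Ω), Submodule.mem_orthogonal]
  intro q hq
  -- Double orthogonal complement: orthogonality of `q` to the pairs `(φ, ∇φ)` says exactly that
  -- `q.fst` is the weak divergence of `q.snd`, so the hypothesis on `p` applies to the swapped `q`.
  have hq' : (WithLp.toLp 2 (q.snd, q.fst) : PairDiv Ω) ∈ Hdiv Ω := by
    refine mem_Hdiv_iff.2 fun φ h => ?_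
    have := (Submodule.mem_orthogonal' _ _).1 hq _ h.pairGrad_mem_H10
    rwa [WithLp.prod_inner_apply] at this
  rw [real_inner_comm, WithLp.prod_inner_apply]
  exact hp _ hq'

/-! ### Linear combinations of test functions -/

theorem IsTestFunction.zero (T : Set (Space d)) : IsTestFunction T (0 : Space d → ℝ) :=
  ⟨contDiff_const, HasCompactSupport.zero, by simp [tsupport]⟩

theorem IsTestFunction.add {T : Set (Space d)} {φ ψ : Space d → ℝ} (hφ : IsTestFunction T φ)
    (hψ : IsTestFunction T ψ) : IsTestFunction T (φ + ψ) :=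
  ⟨hφ.smooth.add hψ.smooth, hφ.compact.add hψ.compact,
    (tsupport_add φ ψ).trans (Set.union_subset hφ.support hψ.support)⟩

theorem IsTestFunction.const_smul {T : Set (Space d)} {φ : Space d → ℝ} (hφ : IsTestFunction T φ)
    (c : ℝ) : IsTestFunction T (c • φ) :=
  ⟨contDiff_const.smul hφ.smooth, hφ.compact.smul_left (f := fun _ => c),
    (tsupport_smul_subset_right (fun _ => c) φ).trans hφ.support⟩

theorem pderiv_add {S T : Set (Space d)} {φ ψ : Space d → ℝ} (hφ : IsTestFunction S φ)
    (hψ : IsTestFunction T ψ) (i : Fin d) (x : Space d) :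
    pderiv i (φ + ψ) x = pderiv i φ x + pderiv i ψ x := by
  rw [pderiv, fderiv_add (hφ.differentiable x) (hψ.differentiable x)]
  rfl

theorem pderiv_const_smul {T : Set (Space d)} {φ : Space d → ℝ} (hφ : IsTestFunction T φ) (c : ℝ)
    (i : Fin d) (x : Space d) : pderiv i (c • φ) x = c * pderiv i φ x := by
  rw [pderiv, fderiv_const_smul (hφ.differentiable x)]
  rfl

theorem IsTestFunction.pairGrad_add {Ω T : Set (Space d)} {φ ψ : Space d → ℝ}
    (hφ : IsTestFunction T φ) (hψ : IsTestFunction T ψ) :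
    (hφ.add hψ).pairGrad Ω = hφ.pairGrad Ω + hψ.pairGrad Ω := by
  apply (WithLp.equiv 2 _).injective
  refine Prod.ext (MemLp.toLp_add (hφ.memLp Ω) (hψ.memLp Ω)) ?_
  refine Eq.trans (MemLp.toLp_congr ((hφ.add hψ).memLp_gradient Ω) ((hφ.memLp_gradient Ω).add (hψ.memLp_gradient Ω))
    (.of_forall fun x => ?_)) (MemLp.toLp_add (hφ.memLp_gradient Ω) (hψ.memLp_gradient Ω))
  ext i
  exact pderiv_add hφ hψ i x

theorem IsTestFunction.pairGrad_const_smul {Ω T : Set (Space d)} {φ : Space d → ℝ}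
    (hφ : IsTestFunction T φ) (c : ℝ) :
    (hφ.const_smul c).pairGrad Ω = c • hφ.pairGrad Ω := by
  apply (WithLp.equiv 2 _).injective
  refine Prod.ext (MemLp.toLp_const_smul c (hφ.memLp Ω)) ?_
  refine Eq.trans (MemLp.toLp_congr ((hφ.const_smul c).memLp_gradient Ω)
    ((hφ.memLp_gradient Ω).const_smul c)
    (.of_forall fun x => ?_)) (MemLp.toLp_const_smul c (hφ.memLp_gradient Ω))
  ext i
  exact pderiv_const_smul hφ c i x

/-- The pairs `(φ, ∇φ)` form a subspace. -/
theorem exists_eq_pairGrad_of_mem_span {Ω : Set (Space d)} {p : PairGrad Ω}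
    (hp : p ∈ Submodule.span ℝ {p : PairGrad Ω | ∃ φ, ∃ h : IsTestFunction Ω φ,
      p = h.pairGrad Ω}) : ∃ φ, ∃ h : IsTestFunction Ω φ, p = h.pairGrad Ω := by
  induction hp using Submodule.span_induction with
  | mem p hp => exact hp
  | zero =>
    refine ⟨_, (IsTestFunction.zero Ω).const_smul 0, ?_⟩
    rw [(IsTestFunction.zero Ω).pairGrad_const_smul, zero_smul]
  | add p q _ _ hp hq =>
    obtain ⟨φ, hφ, rfl⟩ := hp
    obtain ⟨ψ, hψ, rfl⟩ := hq
    exact ⟨_, hφ.add hψ, (hφ.pairGrad_add hψ).symm⟩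
  | smul c p _ hp =>
    obtain ⟨φ, hφ, rfl⟩ := hp
    exact ⟨_, hφ.const_smul c, (hφ.pairGrad_const_smul c).symm⟩

/-! ### The Friedrichs inequality -/

theorem IsTestFunction.coord_mul {T : Set (Space d)} {φ : Space d → ℝ} (h : IsTestFunction T φ)
    (i : Fin d) : IsTestFunction T (fun x => x i * φ x) :=
  ⟨(EuclideanSpace.proj i : Space d →L[ℝ] ℝ).contDiff.mul h.smooth, h.compact.mul_left,
    (tsupport_mul_subset_right (f := fun x : Space d => x i)).trans h.support⟩

theorem IsTestFunction.pderiv_coord_mul {T : Set (Space d)} {φ : Space d → ℝ}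
    (h : IsTestFunction T φ) (i : Fin d) (x : Space d) :
    pderiv i (fun x => x i * φ x) x = φ x + x i * pderiv i φ x := by
  have h₁ : HasFDerivAt (fun x : Space d => x i) (EuclideanSpace.proj i : Space d →L[ℝ] ℝ) x :=
    (EuclideanSpace.proj i : Space d →L[ℝ] ℝ).hasFDerivAt
  have h₂ : fderiv ℝ (fun x : Space d => x i * φ x) x = _ :=
    (h₁.mul (h.differentiable x).hasFDerivAt).fderiv
  rw [pderiv, h₂]
  simp [pderiv]
  ring

/-- Integrating `∂ᵢ(xᵢφ) φ` by parts gives `‖φ‖² = -2 ∫ xᵢ φ ∂ᵢφ`, and `|xᵢ| ≤ R` on `Ω`. A single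
coordinate direction suffices. -/
theorem IsTestFunction.friedrichs {Ω : Set (Space d)} {R : ℝ} (hR : ∀ x ∈ Ω, ‖x‖ ≤ R) (i : Fin d)
    {φ : Space d → ℝ} (h : IsTestFunction Ω φ) :
    ‖(h.pairGrad Ω).fst‖ ≤ 2 * R * ‖(h.pairGrad Ω).snd‖ := by
  have hψ := h.coord_mul i
  set P := h.pairGrad Ω with hP
  set Q := hψ.pairDiv Ω i with hQ
  have hφP : P.fst =ᵐ[volume.restrict Ω] φ := (h.memLp Ω).coeFn_toLp
  have e₁ : ‖P.fst‖ ^ 2 = ∫ x, φ x * φ x := by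
    rw [← real_inner_self_eq_norm_sq, hP, h.inner_pairGrad_fst,
      ← setIntegral_eq_integral_of_forall_compl_eq_zero (s := Ω)
        (f := fun x => φ x * φ x) (fun x hx => by rw [h.eq_zero hx, zero_mul])]
    refine integral_congr_ae ?_
    filter_upwards [hφP] with x hx
    rw [← hP, hx]
  have e₂ : ⟪P.snd, Q.fst⟫_ℝ = ∫ x, x i * φ x * pderiv i φ x := by
    rw [hQ, hψ.inner_pairDiv_fst, ← setIntegral_eq_integral_of_forall_compl_eq_zero (s := Ω)
        (f := fun x => x i * φ x * pderiv i φ x)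
        (fun x hx => by rw [h.eq_zero hx, mul_zero, zero_mul])]
    refine integral_congr_ae ?_
    filter_upwards [(h.memLp_gradient Ω).coeFn_toLp] with x hx
    rw [hP, IsTestFunction.pairGrad, WithLp.toLp_snd, hx]
    ring
  have e₃ : ‖P.fst‖ ^ 2 = -2 * ⟪P.snd, Q.fst⟫_ℝ := by
    have := hψ.integral_mul_pderiv h i
    have e : ∫ x, pderiv i (fun x => x i * φ x) x * φ x
        = (∫ x, φ x * φ x) + ∫ x, x i * φ x * pderiv i φ x := by
      rw [← integral_add]
      · refine integral_congr_ae (.of_forall fun x => ?_)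
        simp only [h.pderiv_coord_mul]
        ring
      · exact (h.smooth.continuous.mul h.smooth.continuous).integrable_of_hasCompactSupport
          h.compact.mul_right
      · exact (hψ.smooth.continuous.mul (h.continuous_pderiv i)).integrable_of_hasCompactSupport
          hψ.compact.mul_right
    rw [e₁, e₂]
    linarith
  have e₄ : ‖Q.fst‖ ≤ R * ‖P.fst‖ := by
    refine Lp.norm_le_mul_norm_of_ae_le_mul ?_
    have hmem : ∀ᵐ x ∂volume.restrict Ω, φ x = 0 ∨ x ∈ Ω := .of_forall fun x => by
      by_cases hx : x ∈ Ω
      exacts [.inr hx, .inl (h.eq_zero hx)]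
    filter_upwards [(hψ.memLp_smul_single Ω i).coeFn_toLp, hφP, hmem] with x hx₁ hx₂ hx₃
    rw [hQ, IsTestFunction.pairDiv, WithLp.toLp_fst, hx₁, hx₂]
    rcases hx₃ with hx₃ | hx₃
    · simp [hx₃]
    · rw [norm_smul, norm_mul]
      have : ‖x i‖ ≤ R := (PiLp.norm_apply_le x i).trans (hR x hx₃)
      simpa using mul_le_mul_of_nonneg_right this (norm_nonneg (φ x))
  have e₅ : ‖P.fst‖ ^ 2 ≤ 2 * (‖P.snd‖ * (R * ‖P.fst‖)) := by
    have := (abs_real_inner_le_norm P.snd Q.fst).trans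
      (mul_le_mul_of_nonneg_left e₄ (norm_nonneg _))
    rw [e₃]
    linarith [neg_abs_le ⟪P.snd, Q.fst⟫_ℝ]
  rcases (norm_nonneg P.fst).eq_or_lt with h0 | h0
  · rw [← h0] at e₄ ⊢
    -- Dividing by `‖φ‖` is impossible here, so the sign of `R` is needed. It follows from a point
    -- of `Ω`; for empty `Ω` both sides vanish.
    by_cases hne : Ω.Nonempty
    · obtain ⟨x, hx⟩ := hne
      have := (norm_nonneg x).trans (hR x hx)
      positivity
    · have : P.snd = 0 := by
        rw [Set.not_nonempty_iff_eq_empty] at hne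
        subst hne
        refine Lp.ext ?_
        simp [Filter.EventuallyEq]
      simp [this]
  · nlinarith

theorem friedrichs {Ω : Set (Space d)} (hΩ : Bornology.IsBounded Ω) (i : Fin d) :
    ∃ C : ℝ, 0 ≤ C ∧ ∀ p ∈ H10 Ω, ‖p.fst‖ ≤ C * ‖p.snd‖ := by
  obtain ⟨R, hR0, hR⟩ := hΩ.exists_pos_norm_le
  refine ⟨2 * R, by positivity, fun p hp => ?_⟩
  rw [H10_eq_closure_span] at hp
  have hcl : IsClosed {p : PairGrad Ω | ‖p.fst‖ ≤ 2 * R * ‖p.snd‖} :=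
    isClosed_le (WithLp.fstL 2 ℝ _ _).continuous.norm
      (continuous_const.mul (WithLp.sndL 2 ℝ _ _).continuous.norm)
  refine closure_minimal ?_ hcl hp
  intro p hp
  obtain ⟨φ, h, rfl⟩ := exists_eq_pairGrad_of_mem_span hp
  exact h.friedrichs hR i

/-! ### Density of test functions in `L₂` -/

/-- `C_c^∞(M)` as a subspace of `L₂(M)`. -/
def testL2 (M : Set (Space d)) : Submodule ℝ (L2s M) where
  carrier := {f | ∃ ψ : Space d → ℝ, IsTestFunction M ψ ∧ f =ᵐ[volume.restrict M] ψ}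
  zero_mem' := ⟨0, .zero M, Lp.coeFn_zero _ _ _⟩
  add_mem' := fun {f g} ⟨ψ, hψ, hf⟩ ⟨χ, hχ, hg⟩ =>
    ⟨ψ + χ, hψ.add hχ, (Lp.coeFn_add f g).trans (hf.add hg)⟩
  smul_mem' := fun c f ⟨ψ, hψ, hf⟩ =>
    ⟨c • ψ, hψ.const_smul c, (Lp.coeFn_smul c f).trans (hf.const_smul c)⟩

/-- By the fundamental lemma of the calculus of variations, nothing but zero is orthogonal to all
test functions. Boundedness of `M` makes `L₂` functions integrable, as that lemma requires. -/
theorem testL2_dense {M : Set (Space d)} (hM : IsOpen M) (hb : Bornology.IsBounded M) :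
    (testL2 M).topologicalClosure = ⊤ := by
  have : IsFiniteMeasure (volume.restrict M) := ⟨by simpa using hb.measure_lt_top⟩
  rw [Submodule.topologicalClosure_eq_top_iff, Submodule.eq_bot_iff]
  intro f hf
  have hint : IntegrableOn f M := (Lp.memLp f).integrable one_le_two
  have h0 := hM.ae_eq_zero_of_integral_contDiff_smul_eq_zero hint.locallyIntegrableOn
    fun ψ h₁ h₂ h₃ => by
      have hψ : IsTestFunction M ψ := ⟨h₁, h₂, h₃⟩
      have := (Submodule.mem_orthogonal' _ _).1 hf (hψ.memLp M).toLp
        ⟨ψ, hψ, (hψ.memLp M).coeFn_toLp⟩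
      have e := hψ.inner_pairGrad_fst f
      rw [IsTestFunction.pairGrad, WithLp.toLp_fst, this,
        setIntegral_eq_integral_of_forall_compl_eq_zero
          (fun x hx => by rw [hψ.eq_zero hx, mul_zero])] at e
      simpa [mul_comm] using e.symm
  refine Lp.ext ?_
  filter_upwards [(ae_restrict_iff' hM.measurableSet).2 h0, Lp.coeFn_zero ℝ 2 (volume.restrict M)]
    with x hx hx'
  rw [hx, hx']
  rfl

/-- The `L₂` norm is determined by duality with test functions. -/
theorem norm_le_of_forall_test {M : Set (Space d)} (hM : IsOpen M)
    (hb : Bornology.IsBounded M) {w : L2s M} {K : ℝ} (hK : 0 ≤ K)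
    (h : ∀ ψ : Space d → ℝ, ∀ hψ : IsTestFunction M ψ,
      |∫ x in M, w x * ψ x| ≤ K * ‖(hψ.memLp M).toLp‖) : ‖w‖ ≤ K := by
  have hcl : IsClosed {f : L2s M | |⟪w, f⟫_ℝ| ≤ K * ‖f‖} :=
    isClosed_le (continuous_const.inner continuous_id).abs (continuous_const.mul continuous_norm)
  have hw : w ∈ (testL2 M).topologicalClosure := by rw [testL2_dense hM hb]; trivial
  -- The bound passes to the closure, hence may be tested with `w` itself.
  have := closure_minimal (s := (testL2 M : Set (L2s M))) ?_ hcl hw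
  · change |⟪w, w⟫_ℝ| ≤ K * ‖w‖ at this
    rw [real_inner_self_eq_norm_sq, abs_of_nonneg (by positivity)] at this
    rcases (norm_nonneg w).eq_or_lt with h0 | h0
    · rwa [← h0]
    · nlinarith
  · rintro f ⟨ψ, hψ, hf⟩
    have e : f = (hψ.memLp M).toLp := Lp.ext (hf.trans (hψ.memLp M).coeFn_toLp.symm)
    have := h ψ hψ
    rw [← hψ.inner_pairGrad_fst] at this
    rw [e]
    exact this

/-! ### Translations of `H¹` functions -/

theorem IsTestFunction.comp_sub {S T : Set (Space d)} {ψ : Space d → ℝ} (hψ : IsTestFunction S ψ)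
    (a : Space d) (h : ∀ y ∈ S, y + a ∈ T) : IsTestFunction T (fun z => ψ (z - a)) := by
  have hs : tsupport (fun z => ψ (z - a)) = (fun z => z - a) ⁻¹' tsupport ψ :=
    tsupport_comp_eq_preimage ψ (Homeomorph.subRight a)
  refine ⟨hψ.smooth.comp (contDiff_id.sub contDiff_const),
    hψ.compact.comp_homeomorph (Homeomorph.subRight a), ?_⟩
  rw [hs]
  intro z hz
  simpa using h _ (hψ.support hz)

theorem fderiv_apply_eq_sum_pderiv (ψ : Space d → ℝ) (z h : Space d) :
    fderiv ℝ ψ z h = ∑ i, h i * pderiv i ψ z := by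
  conv_lhs => rw [← (EuclideanSpace.basisFun (Fin d) ℝ).sum_repr h]
  simp [pderiv]

theorem norm_toLp_comp_sub_le {S T : Set (Space d)} {ψ : Space d → ℝ} (hψ : IsTestFunction S ψ)
    (a : Space d) (h : ∀ y ∈ S, y + a ∈ T) :
    ‖((hψ.comp_sub a h).memLp T).toLp‖ ≤ ‖(hψ.memLp S).toLp‖ := by
  have key : ∫ z in T, ψ (z - a) * ψ (z - a) = ∫ y in S, ψ y * ψ y := by
    rw [setIntegral_eq_integral_of_forall_compl_eq_zero
        (fun x hx => by rw [(hψ.comp_sub a h).eq_zero hx, zero_mul]),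
      setIntegral_eq_integral_of_forall_compl_eq_zero
        (fun x hx => by rw [hψ.eq_zero hx, zero_mul])]
    exact integral_sub_right_eq_self (fun z => ψ z * ψ z) a
  have nsq : ∀ {U : Set (Space d)} {χ : Space d → ℝ} (hχ : IsTestFunction U χ),
      ‖(hχ.memLp U).toLp‖ ^ 2 = ∫ y in U, χ y * χ y := fun {U χ} hχ => by
    rw [← real_inner_self_eq_norm_sq]
    refine (hχ.inner_pairGrad_fst (hχ.memLp U).toLp).trans (integral_congr_ae ?_)
    filter_upwards [(hχ.memLp U).coeFn_toLp] with x hx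
    rw [hx]
  refine le_of_sq_le_sq ?_ (norm_nonneg _)
  rw [nsq (hψ.comp_sub a h), nsq hψ, key]

/-- `∫ v(z) (h · ∇ψ)(z) dz = - ∫ h · ∇v(z) ψ(z) dz` is bounded by `|h| ‖∇v‖ ‖ψ‖`. -/
theorem abs_integral_mul_fderiv_le {Ω : Set (Space d)} {p : PairGrad Ω} (hp : p ∈ H1 Ω)
    {ψ : Space d → ℝ} (hψ : IsTestFunction Ω ψ) (h : Space d) :
    |∫ z in Ω, p.fst z * fderiv ℝ ψ z h| ≤ ‖h‖ * ‖p.snd‖ * ‖(hψ.memLp Ω).toLp‖ := by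
  have hmem : MemLp (fun x => ψ x • h) 2 (volume.restrict Ω) :=
    (Continuous.memLp_of_hasCompactSupport (hψ.smooth.continuous.smul continuous_const)
      hψ.compact.smul_right).restrict Ω
  have hint : ∀ i, IntegrableOn (fun z => p.fst z * pderiv i ψ z) Ω := fun i =>
    (Lp.memLp p.fst).integrable_mul (hψ.memLp_pderiv Ω i)
  have e₁ : ∫ z in Ω, p.fst z * fderiv ℝ ψ z h = -⟪p.snd, hmem.toLp⟫_ℝ := by
    calc ∫ z in Ω, p.fst z * fderiv ℝ ψ z h
        = ∫ z in Ω, ∑ i, h i * (p.fst z * pderiv i ψ z) := by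
          refine integral_congr_ae (.of_forall fun z => ?_)
          simp only [fderiv_apply_eq_sum_pderiv, Finset.mul_sum]
          exact Finset.sum_congr rfl fun i _ => by ring
      _ = ∑ i, h i * ∫ z in Ω, p.fst z * pderiv i ψ z := by
          rw [integral_finsetSum _ fun i _ => (hint i).const_mul _]
          simp only [integral_const_mul]
      _ = ∑ i, h i * -∫ z in Ω, p.snd z i * ψ z :=
          Finset.sum_congr rfl fun i _ => by rw [hp Ω rfl ψ hψ i]
      _ = -∫ z in Ω, ∑ i, h i * (p.snd z i * ψ z) := by
          rw [integral_finsetSum _ fun i _ =>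
            (integrable_coord_mul p.snd (hψ.memLp Ω) i).const_mul _]
          simp only [integral_const_mul, mul_neg, Finset.sum_neg_distrib]
      _ = -⟪p.snd, hmem.toLp⟫_ℝ := by
          rw [L2.inner_def]
          congr 1
          refine integral_congr_ae ?_
          filter_upwards [hmem.coeFn_toLp] with z hz
          rw [hz, real_inner_smul_right, PiLp.inner_apply, Finset.mul_sum]
          refine Finset.sum_congr rfl fun i _ => ?_
          simp
          ring
  have e₂ : ‖hmem.toLp‖ ≤ ‖h‖ * ‖(hψ.memLp Ω).toLp‖ := by
    refine Lp.norm_le_mul_norm_of_ae_le_mul ?_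
    filter_upwards [hmem.coeFn_toLp, (hψ.memLp Ω).coeFn_toLp] with z hz hz'
    rw [hz, hz', norm_smul, mul_comm]
  rw [e₁, abs_neg]
  calc |⟪p.snd, hmem.toLp⟫_ℝ| ≤ ‖p.snd‖ * ‖hmem.toLp‖ := abs_real_inner_le_norm _ _
    _ ≤ ‖p.snd‖ * (‖h‖ * ‖(hψ.memLp Ω).toLp‖) := by gcongr
    _ = _ := by ring

/-- The translation acts on `ψ` rather than on the `H¹` function, so no density of smooth functions
in `H¹(Ω)` is needed. The map `s ↦ ∫ v ψ(· - s h)` is differentiable under the integral, its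
derivative is bounded through the weak gradient, and the mean value inequality on `[0, 1]`
concludes. -/
theorem abs_integral_mul_comp_sub_sub_le {Ω M : Set (Space d)} (hΩ : Bornology.IsBounded Ω)
    {p : PairGrad Ω} (hp : p ∈ H1 Ω) {h : Space d}
    (hM : ∀ y ∈ M, ∀ s ∈ Set.Icc (0 : ℝ) 1, y + s • h ∈ Ω) {ψ : Space d → ℝ}
    (hψ : IsTestFunction M ψ) :
    |(∫ z in Ω, p.fst z * ψ (z - h)) - ∫ z in Ω, p.fst z * ψ z| ≤
      ‖h‖ * ‖p.snd‖ * ‖(hψ.memLp M).toLp‖ := by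
  have : IsFiniteMeasure (volume.restrict Ω) := ⟨by simpa using hΩ.measure_lt_top⟩
  have hpi : IntegrableOn p.fst Ω := (Lp.memLp p.fst).integrable one_le_two
  obtain ⟨C, hC⟩ := (hψ.compact.fderiv (𝕜 := ℝ)).exists_bound_of_continuous
    (hψ.smooth.continuous_fderiv (by simp))
  obtain ⟨D, hD⟩ := hψ.compact.exists_bound_of_continuous hψ.smooth.continuous
  have hcont : ∀ s : ℝ, Continuous fun z : Space d => z - s • h := fun s =>
    continuous_id.sub continuous_const
  have hderiv : ∀ s : ℝ, HasDerivAt (fun s : ℝ => ∫ z in Ω, p.fst z * ψ (z - s • h))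
      (∫ z in Ω, p.fst z * -(fderiv ℝ ψ (z - s • h) h)) s := by
    intro s
    refine (hasDerivAt_integral_of_dominated_loc_of_deriv_le (bound := fun z => |p.fst z| * (C * ‖h‖))
      (F' := fun s z => p.fst z * -(fderiv ℝ ψ (z - s • h) h))
      Filter.univ_mem (.of_forall fun t => ?_) ?_ ?_ (.of_forall fun z t _ => ?_)
      (hpi.abs.mul_const _) (.of_forall fun z t _ => ?_)).2
    · exact (Lp.aestronglyMeasurable _).mul
        (hψ.smooth.continuous.comp (hcont t)).aestronglyMeasurable
    · exact hpi.mul_bdd (hψ.smooth.continuous.comp (hcont s)).aestronglyMeasurable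
        (.of_forall fun z => hD _)
    · exact (Lp.aestronglyMeasurable _).mul (((hψ.smooth.continuous_fderiv (by simp)).comp
        (hcont s)).clm_apply continuous_const).neg.aestronglyMeasurable
    · rw [norm_mul, norm_neg, Real.norm_eq_abs]
      refine mul_le_mul_of_nonneg_left ?_ (abs_nonneg _)
      exact (ContinuousLinearMap.le_opNorm _ _).trans
        (mul_le_mul_of_nonneg_right (hC _) (norm_nonneg _))
    · refine HasDerivAt.const_mul _ ?_
      have h₁ : HasDerivAt (fun t : ℝ => z - t • h) (-h) t := by
        simpa using ((hasDerivAt_id t).smul_const h).const_sub z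
      have := (hψ.differentiable (z - t • h)).hasFDerivAt.comp_hasDerivAt t h₁
      rw [map_neg] at this
      exact this
  have hb := norm_image_sub_le_of_norm_deriv_le_segment_01'
    (f := fun s : ℝ => ∫ z in Ω, p.fst z * ψ (z - s • h))
    (C := ‖h‖ * ‖p.snd‖ * ‖(hψ.memLp M).toLp‖)
    (fun s _ => (hderiv s).hasDerivWithinAt) fun s hs => ?_
  · simpa using hb
  -- The segment condition keeps every intermediate translate of `ψ` supported in `Ω`, so the weak
  -- gradient may be tested with it.
  · have hMs : ∀ y ∈ M, y + s • h ∈ Ω := fun y hy => hM y hy s ⟨hs.1, hs.2.le⟩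
    have := abs_integral_mul_fderiv_le hp (hψ.comp_sub (s • h) hMs) h
    simp only [fderiv_comp_sub] at this
    simp only [mul_neg, integral_neg, norm_neg, Real.norm_eq_abs]
    refine this.trans (mul_le_mul_of_nonneg_left (norm_toLp_comp_sub_le hψ _ hMs) (by positivity))

theorem eLpNorm_two_sq {α : Type*} [MeasurableSpace α] (μ : Measure α) (f : α → ℝ) :
    eLpNorm f 2 μ ^ 2 = ∫⁻ x, ENNReal.ofReal (f x ^ 2) ∂μ := by
  have := eLpNorm_nnreal_pow_eq_lintegral (f := f) (p := 2) (μ := μ) two_ne_zero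
  have h2 : ((2 : NNReal) : ℝ) = ((2 : ℕ) : ℝ) := by norm_num
  rw [h2, ENNReal.rpow_natCast] at this
  rw [show (2 : ENNReal) = ((2 : NNReal) : ENNReal) by norm_num, this]
  refine lintegral_congr fun x => ?_
  rw [ENNReal.rpow_natCast, ← ofReal_norm, ← ENNReal.ofReal_pow (norm_nonneg _),
    Real.norm_eq_abs, sq_abs]

/-- The chosen representative is measurable on all of space, so its translates are measurable too.
-/
theorem measurable_coeFn {Ω : Set (Space d)} (v : L2s Ω) : Measurable v :=
  (Lp.stronglyMeasurable v).measurable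

/-- `‖v(· + h) - v‖_{L₂(M)} ≤ |h| ‖∇v‖_{L₂(Ω)}` if `M + [0, 1] h ⊆ Ω`. -/
theorem lintegral_translate_sub_sq_le {Ω M : Set (Space d)} (hΩ : Bornology.IsBounded Ω)
    (hMo : IsOpen M) {p : PairGrad Ω} (hp : p ∈ H1 Ω) {h : Space d}
    (hM : ∀ y ∈ M, ∀ s ∈ Set.Icc (0 : ℝ) 1, y + s • h ∈ Ω) :
    ∫⁻ y in M, ENNReal.ofReal ((p.fst (y + h) - p.fst y) ^ 2) ≤
      ENNReal.ofReal (‖h‖ ^ 2 * ‖p.snd‖ ^ 2) := by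
  have hM0 : M ⊆ Ω := fun y hy => by simpa using hM y hy 0 ⟨le_rfl, zero_le_one⟩
  have hM1 : ∀ y ∈ M, y + h ∈ Ω := fun y hy => by simpa using hM y hy 1 ⟨zero_le_one, le_rfl⟩
  have hMb := hΩ.subset hM0
  have m₁ : MemLp p.fst 2 (volume.restrict M) :=
    (Lp.memLp p.fst).mono_measure (Measure.restrict_mono hM0 le_rfl)
  have m₂ : MemLp (fun y => p.fst (y + h)) 2 (volume.restrict M) := by
    set S : Set (Space d) := (fun z => z - h) ⁻¹' M with hS
    have hSm : MeasurableSet S := (hMo.preimage (by fun_prop)).measurableSet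
    have hpre : (fun y => y + h) ⁻¹' S = M := by ext y; simp [hS]
    have hSΩ : S ⊆ Ω := fun z hz => by simpa using hM1 _ hz
    have := (measurePreserving_add_right (volume : Measure (Space d)) h).restrict_preimage hSm
    rw [hpre] at this
    exact ((Lp.memLp p.fst).mono_measure
      (Measure.restrict_mono hSΩ le_rfl)).comp_measurePreserving this
  have m := m₂.sub m₁
  -- By duality with test functions on `M`; a change of variables moves the shift from `v` to `ψ`.
  have key : ‖m.toLp‖ ≤ ‖h‖ * ‖p.snd‖ := by
    refine norm_le_of_forall_test hMo hMb (by positivity) fun ψ hψ => ?_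
    refine le_of_eq_of_le ?_ (abs_integral_mul_comp_sub_sub_le hΩ hp hM hψ)
    congr 1
    have e₁ : ∫ x in M, (m.toLp : L2s M) x * ψ x = ∫ x in M, (p.fst (x + h) * ψ x - p.fst x * ψ x) := by
      refine integral_congr_ae ?_
      filter_upwards [m.coeFn_toLp] with x hx
      rw [hx, ← sub_mul]
      rfl
    have e₂ := integral_sub (m₂.integrable_mul (hψ.memLp M)) (m₁.integrable_mul (hψ.memLp M))
    simp only [Pi.mul_apply] at e₂
    rw [e₁, e₂]
    congr 1
    · rw [setIntegral_eq_integral_of_forall_compl_eq_zero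
          (fun x hx => by rw [hψ.eq_zero hx, mul_zero]),
        setIntegral_eq_integral_of_forall_compl_eq_zero
          (fun x hx => by rw [(hψ.comp_sub h hM1).eq_zero hx, mul_zero]),
        ← integral_add_right_eq_self (fun z => p.fst z * ψ (z - h)) h]
      simp
    · rw [setIntegral_eq_integral_of_forall_compl_eq_zero
          (fun x hx => by rw [hψ.eq_zero hx, mul_zero]),
        setIntegral_eq_integral_of_forall_compl_eq_zero
          (fun x hx => by rw [(hψ.mono hM0).eq_zero hx, mul_zero])]
  have h2 : eLpNorm (fun y => p.fst (y + h) - p.fst y) 2 (volume.restrict M) ≤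
      ENNReal.ofReal (‖h‖ * ‖p.snd‖) := by
    rw [Lp.norm_toLp] at key
    exact (ENNReal.le_ofReal_iff_toReal_le m.2.ne (by positivity)).2 key
  rw [← eLpNorm_two_sq, ← mul_pow, ENNReal.ofReal_pow (by positivity)]
  gcongr

/-! ### The Poincaré inequality on Lipschitz domains -/

/-- On `N ∩ Ω`, every `H¹(Ω)` function is within `C ‖∇v‖²` (in squared norm) of a constant. -/
def PoincareOn (Ω N : Set (Space d)) : Prop :=
  ∃ C : ENNReal, C ≠ ⊤ ∧ ∀ p ∈ H1 Ω, ∃ c : ℝ,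
    ∫⁻ x in N ∩ Ω, ENNReal.ofReal ((p.fst x - c) ^ 2) ≤ C * ENNReal.ofReal (‖p.snd‖ ^ 2)

theorem PoincareOn.mono {Ω N N' : Set (Space d)} (h : PoincareOn Ω N) (hN : N' ∩ Ω ⊆ N) :
    PoincareOn Ω N' := by
  obtain ⟨C, hC, h⟩ := h
  refine ⟨C, hC, fun p hp => ?_⟩
  obtain ⟨c, hc⟩ := h p hp
  exact ⟨c, (lintegral_mono_set (show N' ∩ Ω ⊆ N ∩ Ω from fun x hx => ⟨hN hx, hx.2⟩)).trans hc⟩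

theorem ofReal_sub_sq_le (a b c : ℝ) : ENNReal.ofReal ((a - c) ^ 2) ≤
    2 * ENNReal.ofReal ((a - b) ^ 2) + 2 * ENNReal.ofReal ((b - c) ^ 2) := by
  rw [← ENNReal.ofReal_ofNat, ← ENNReal.ofReal_mul (by norm_num),
    ← ENNReal.ofReal_mul (by norm_num), ← ENNReal.ofReal_add (by positivity) (by positivity)]
  exact ENNReal.ofReal_le_ofReal (by nlinarith [sq_nonneg (a - b - (b - c))])

/-- The double integral of `|v(y) - v(z)|²` over `B × B` is at most the integral over shifts `|h| <
2r` of the translation differences. For `z ∈ B` the segment from `z` to `z + h` stays in the ball of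
radius `r + 2r`, whence the factor 3. -/
theorem poincareOn_ball {Ω : Set (Space d)} (hΩ : Bornology.IsBounded Ω) {x : Space d} {r : ℝ}
    (hr : 0 < r) (hB : Metric.ball x (3 * r) ⊆ Ω) : PoincareOn Ω (Metric.ball x r) := by
  set B := Metric.ball x r with hBdef
  set D := Metric.ball (0 : Space d) (2 * r) with hD
  have hB0 : volume B ≠ 0 := (Metric.measure_ball_pos _ _ hr).ne'
  have hBt : volume B ≠ ⊤ := Metric.isBounded_ball.measure_lt_top.ne
  have hDt : volume D ≠ ⊤ := Metric.isBounded_ball.measure_lt_top.ne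
  refine ⟨volume D * ENNReal.ofReal ((2 * r) ^ 2) / volume B,
    ENNReal.div_ne_top (ENNReal.mul_ne_top hDt ENNReal.ofReal_ne_top) hB0, fun p hp => ?_⟩
  have hmeas := measurable_coeFn p.fst
  set f : Space d → ENNReal := fun z => ∫⁻ y in B, ENNReal.ofReal ((p.fst y - p.fst z) ^ 2)
    with hf
  have hjm : Measurable (Function.uncurry fun z y : Space d =>
      ENNReal.ofReal ((p.fst y - p.fst z) ^ 2)) := by
    refine ENNReal.measurable_ofReal.comp (Measurable.pow_const ?_ 2)
    exact (hmeas.comp measurable_snd).sub (hmeas.comp measurable_fst)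
  have hfm : Measurable f := hjm.lintegral_prod_right'
  have htrans : ∀ h ∈ D, ∫⁻ z in B, ENNReal.ofReal ((p.fst (z + h) - p.fst z) ^ 2) ≤
      ENNReal.ofReal ((2 * r) ^ 2) * ENNReal.ofReal (‖p.snd‖ ^ 2) := by
    intro h hh
    have hh' : ‖h‖ < 2 * r := by simpa [hD] using hh
    refine (lintegral_translate_sub_sq_le hΩ Metric.isOpen_ball hp fun y hy s hs => hB ?_).trans ?_
    · rw [Metric.mem_ball, dist_eq_norm] at hy ⊢
      have h1 : ‖s • h‖ ≤ ‖h‖ := by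
        rw [norm_smul, Real.norm_eq_abs, abs_of_nonneg hs.1]
        exact mul_le_of_le_one_left (norm_nonneg _) hs.2
      have h2 := norm_add_le (y - x) (s • h)
      rw [show y + s • h - x = y - x + s • h by abel]
      linarith
    · rw [← ENNReal.ofReal_mul (by positivity)]
      refine ENNReal.ofReal_le_ofReal ?_
      gcongr
  have hdouble : ∫⁻ z in B, f z ≤
      volume D * (ENNReal.ofReal ((2 * r) ^ 2) * ENNReal.ofReal (‖p.snd‖ ^ 2)) := by
    calc ∫⁻ z in B, f z
        ≤ ∫⁻ z in B, ∫⁻ h in D, ENNReal.ofReal ((p.fst (z + h) - p.fst z) ^ 2) := by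
          refine setLIntegral_mono' measurableSet_ball fun z hz => ?_
          have e := (measurePreserving_add_left (volume : Measure (Space d)) z).setLIntegral_comp_preimage
            (s := B) measurableSet_ball
            (f := fun y => ENNReal.ofReal ((p.fst y - p.fst z) ^ 2))
            (ENNReal.measurable_ofReal.comp ((hmeas.sub measurable_const).pow_const 2))
          rw [hf]
          simp only
          rw [← e]
          refine lintegral_mono_set fun h hh => ?_
          have h1 : ‖z + h - x‖ < r := mem_ball_iff_norm.1 hh
          have h2 : ‖z - x‖ < r := mem_ball_iff_norm.1 hz
          have h3 := norm_sub_le (z + h - x) (z - x)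
          rw [show z + h - x - (z - x) = h by abel] at h3
          simpa [hD] using (by linarith : ‖h‖ < 2 * r)
      _ = ∫⁻ h in D, ∫⁻ z in B, ENNReal.ofReal ((p.fst (z + h) - p.fst z) ^ 2) := by
          refine lintegral_lintegral_swap (Measurable.aemeasurable ?_)
          refine ENNReal.measurable_ofReal.comp (Measurable.pow_const ?_ 2)
          exact (hmeas.comp (measurable_fst.add measurable_snd)).sub (hmeas.comp measurable_fst)
      _ ≤ ∫⁻ _ in D, ENNReal.ofReal ((2 * r) ^ 2) * ENNReal.ofReal (‖p.snd‖ ^ 2) :=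
          setLIntegral_mono' measurableSet_ball htrans
      _ = _ := by rw [setLIntegral_const, mul_comm]
  -- The constant is a value `v(z)`, at a point `z` where the inner integral does not exceed its
  -- average over `B`.
  obtain ⟨z, hz, hzle⟩ := exists_le_setLAverage hB0 hBt hfm.aemeasurable
  refine ⟨p.fst z, (lintegral_mono_set Set.inter_subset_left).trans (hzle.trans ?_)⟩
  rw [setLAverage_eq]
  refine (ENNReal.div_le_div_right hdouble _).trans (le_of_eq ?_)
  rw [ENNReal.div_eq_inv_mul, ENNReal.div_eq_inv_mul]
  ring

/-- Compare `v(x)` with `v(x + h)` by the translation estimate, and `v(x + h)` with the constant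
that works on `N`. -/
theorem poincareOn_translate {Ω M : Set (Space d)} (hΩ : Bornology.IsBounded Ω)
    (hM : IsOpen M) {N : Set (Space d)} (hN : PoincareOn Ω N) {h : Space d}
    (hseg : ∀ y ∈ M, ∀ s ∈ Set.Icc (0 : ℝ) 1, y + s • h ∈ Ω) (hMN : ∀ y ∈ M, y + h ∈ N) :
    PoincareOn Ω M := by
  obtain ⟨C, hC, hN⟩ := hN
  refine ⟨2 * ENNReal.ofReal (‖h‖ ^ 2) + 2 * C, by finiteness, fun p hp => ?_⟩
  obtain ⟨c, hc⟩ := hN p hp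
  have hmeas := measurable_coeFn p.fst
  refine ⟨c, (lintegral_mono_set Set.inter_subset_left).trans ?_⟩
  have h₁ := lintegral_translate_sub_sq_le hΩ hM hp hseg
  have h₂ : ∫⁻ x in M, ENNReal.ofReal ((p.fst (x + h) - c) ^ 2) ≤
      C * ENNReal.ofReal (‖p.snd‖ ^ 2) := by
    refine le_trans ?_ hc
    set S : Set (Space d) := (fun z => z - h) ⁻¹' M with hS
    have hSm : MeasurableSet S := (hM.preimage (by fun_prop)).measurableSet
    have e := (measurePreserving_add_right (volume : Measure (Space d)) h).setLIntegral_comp_preimage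
      hSm (f := fun y => ENNReal.ofReal ((p.fst y - c) ^ 2))
      (ENNReal.measurable_ofReal.comp ((hmeas.sub measurable_const).pow_const 2))
    have hpre : (fun y => y + h) ⁻¹' S = M := by ext y; simp [hS]
    rw [hpre] at e
    rw [e]
    refine lintegral_mono_set fun z hz => ⟨?_, ?_⟩
    · simpa using hMN _ hz
    · simpa using hseg _ hz 1 ⟨zero_le_one, le_rfl⟩
  calc ∫⁻ x in M, ENNReal.ofReal ((p.fst x - c) ^ 2)
      ≤ ∫⁻ x in M, (2 * ENNReal.ofReal ((p.fst (x + h) - p.fst x) ^ 2) +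
          2 * ENNReal.ofReal ((p.fst (x + h) - c) ^ 2)) := lintegral_mono fun x => by
        have := ofReal_sub_sq_le (p.fst x) (p.fst (x + h)) c
        rwa [show (p.fst x - p.fst (x + h)) ^ 2 = (p.fst (x + h) - p.fst x) ^ 2 by ring] at this
    _ = 2 * (∫⁻ x in M, ENNReal.ofReal ((p.fst (x + h) - p.fst x) ^ 2)) +
          2 * ∫⁻ x in M, ENNReal.ofReal ((p.fst (x + h) - c) ^ 2) := by
        have m : Measurable fun x => p.fst (x + h) := hmeas.comp (measurable_id.add_const h)
        have m₁ : Measurable fun x => ENNReal.ofReal ((p.fst (x + h) - p.fst x) ^ 2) :=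
          ENNReal.measurable_ofReal.comp ((m.sub hmeas).pow_const 2)
        have m₂ : Measurable fun x => ENNReal.ofReal ((p.fst (x + h) - c) ^ 2) :=
          ENNReal.measurable_ofReal.comp ((m.sub measurable_const).pow_const 2)
        rw [lintegral_add_left (m₁.const_mul 2), lintegral_const_mul _ m₁,
          lintegral_const_mul _ m₂]
    _ ≤ 2 * ENNReal.ofReal (‖h‖ ^ 2 * ‖p.snd‖ ^ 2) +
          2 * (C * ENNReal.ofReal (‖p.snd‖ ^ 2)) := by gcongr
    _ = _ := by
        rw [ENNReal.ofReal_mul (by positivity), add_mul, mul_assoc, mul_assoc]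

/-- Both constants approximate `v` on the overlap inside `Ω`. This is open and nonempty, so it has
positive measure, and the constants differ by a multiple of `‖∇v‖`. -/
theorem PoincareOn.union {Ω N₁ N₂ : Set (Space d)} (hΩ : Bornology.IsBounded Ω)
    (h₁ : PoincareOn Ω N₁) (h₂ : PoincareOn Ω N₂) (hΩo : IsOpen Ω) (ho₁ : IsOpen N₁)
    (ho₂ : IsOpen N₂) (hne : (N₁ ∩ N₂ ∩ Ω).Nonempty) : PoincareOn Ω (N₁ ∪ N₂) := by
  obtain ⟨C₁, hC₁, h₁⟩ := h₁
  obtain ⟨C₂, hC₂, h₂⟩ := h₂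
  set A := N₁ ∩ N₂ ∩ Ω with hA
  have hAo : IsOpen A := (ho₁.inter ho₂).inter hΩo
  have hA0 : volume A ≠ 0 := (hAo.measure_pos volume hne).ne'
  have hAt : volume A ≠ ⊤ := (hΩ.subset Set.inter_subset_right).measure_lt_top.ne
  have hΩt : volume Ω ≠ ⊤ := hΩ.measure_lt_top.ne
  refine ⟨C₁ + (2 * C₂ + 2 * ((2 * C₁ + 2 * C₂) / volume A * volume Ω)), ?_, fun p hp => ?_⟩
  · have : (2 * C₁ + 2 * C₂) / volume A ≠ ⊤ := ENNReal.div_ne_top (by finiteness) hA0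
    finiteness
  obtain ⟨c₁, hc₁⟩ := h₁ p hp
  obtain ⟨c₂, hc₂⟩ := h₂ p hp
  set G := ENNReal.ofReal (‖p.snd‖ ^ 2)
  have hmeas := measurable_coeFn p.fst
  have hm : ∀ c : ℝ, Measurable fun x => ENNReal.ofReal ((p.fst x - c) ^ 2) := fun c =>
    ENNReal.measurable_ofReal.comp ((hmeas.sub measurable_const).pow_const 2)
  have hconst : ENNReal.ofReal ((c₂ - c₁) ^ 2) ≤ (2 * C₁ + 2 * C₂) / volume A * G := by
    have : ENNReal.ofReal ((c₂ - c₁) ^ 2) * volume A ≤ (2 * C₁ + 2 * C₂) * G := by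
      rw [← setLIntegral_const]
      calc ∫⁻ _ in A, ENNReal.ofReal ((c₂ - c₁) ^ 2)
          ≤ ∫⁻ x in A, (2 * ENNReal.ofReal ((p.fst x - c₁) ^ 2) +
              2 * ENNReal.ofReal ((p.fst x - c₂) ^ 2)) := lintegral_mono fun x => by
            have := ofReal_sub_sq_le c₁ (p.fst x) c₂
            rwa [show (c₁ - c₂) ^ 2 = (c₂ - c₁) ^ 2 by ring,
              show (c₁ - p.fst x) ^ 2 = (p.fst x - c₁) ^ 2 by ring] at this
        _ = 2 * (∫⁻ x in A, ENNReal.ofReal ((p.fst x - c₁) ^ 2)) +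
              2 * ∫⁻ x in A, ENNReal.ofReal ((p.fst x - c₂) ^ 2) := by
            rw [lintegral_add_left ((hm _).const_mul 2), lintegral_const_mul _ (hm _),
              lintegral_const_mul _ (hm _)]
        _ ≤ 2 * (C₁ * G) + 2 * (C₂ * G) := by
            gcongr
            · exact (lintegral_mono_set (show A ⊆ N₁ ∩ Ω from fun x hx => ⟨hx.1.1, hx.2⟩)).trans hc₁
            · exact (lintegral_mono_set (show A ⊆ N₂ ∩ Ω from fun x hx => ⟨hx.1.2, hx.2⟩)).trans hc₂
        _ = _ := by ring
    rw [ENNReal.div_eq_inv_mul, mul_assoc, ← ENNReal.div_eq_inv_mul]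
    exact (ENNReal.le_div_iff_mul_le (.inl hA0) (.inl hAt)).2 this
  refine ⟨c₁, ?_⟩
  calc ∫⁻ x in (N₁ ∪ N₂) ∩ Ω, ENNReal.ofReal ((p.fst x - c₁) ^ 2)
      ≤ (∫⁻ x in N₁ ∩ Ω, ENNReal.ofReal ((p.fst x - c₁) ^ 2)) +
          ∫⁻ x in N₂ ∩ Ω, ENNReal.ofReal ((p.fst x - c₁) ^ 2) := by
        rw [Set.union_inter_distrib_right]
        exact lintegral_union_le _ _ _
    _ ≤ C₁ * G + ∫⁻ x in N₂ ∩ Ω, (2 * ENNReal.ofReal ((p.fst x - c₂) ^ 2) +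
          2 * ENNReal.ofReal ((c₂ - c₁) ^ 2)) := by
        gcongr
        exact ofReal_sub_sq_le _ _ _
    _ = C₁ * G + (2 * (∫⁻ x in N₂ ∩ Ω, ENNReal.ofReal ((p.fst x - c₂) ^ 2)) +
          2 * ENNReal.ofReal ((c₂ - c₁) ^ 2) * volume (N₂ ∩ Ω)) := by
        rw [lintegral_add_left ((hm _).const_mul 2), lintegral_const_mul _ (hm _),
          setLIntegral_const]
    _ ≤ C₁ * G + (2 * (C₂ * G) +
          2 * ((2 * C₁ + 2 * C₂) / volume A * G) * volume Ω) := by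
        gcongr
        exact Set.inter_subset_right
    _ = _ := by ring

/-- Every point of the closure of a Lipschitz domain has a neighborhood with a Poincaré inequality. -/
theorem IsLipschitzDomain.exists_nhds_poincareOn {Ω : Set (Space d)} (hΩ : IsLipschitzDomain Ω)
    {x : Space d} (hx : x ∈ closure Ω) : ∃ N, IsOpen N ∧ x ∈ N ∧ PoincareOn Ω N := by
  by_cases hxΩ : x ∈ Ω
  · obtain ⟨ε, hε, hball⟩ := Metric.isOpen_iff.1 hΩ.isOpen x hxΩ
    refine ⟨Metric.ball x (ε / 3), Metric.isOpen_ball, Metric.mem_ball_self (by positivity),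
      poincareOn_ball hΩ.isBounded (by positivity) ?_⟩
    rwa [mul_div_cancel₀ ε (by norm_num : (3 : ℝ) ≠ 0)]
  obtain ⟨ν, hν, K, γ, hγ, U, hU, hUΩ⟩ := hΩ.local_graph x
    ⟨hx, by rwa [hΩ.isOpen.interior_eq]⟩
  obtain ⟨ε, hε, hball⟩ := Metric.mem_nhds_iff.1 hU
  set π : Space d → Space d := fun y => y - ⟪ν, y⟫_ℝ • ν with hπ
  have hνν : ⟪ν, ν⟫_ℝ = 1 := by rw [real_inner_self_eq_norm_sq, hν]; norm_num
  have hinner : ∀ (y : Space d) (s : ℝ), ⟪ν, y + s • ν⟫_ℝ = ⟪ν, y⟫_ℝ + s := fun y s => by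
    rw [inner_add_right, real_inner_smul_right, hνν, mul_one]
  have hπs : ∀ (y : Space d) (s : ℝ), π (y + s • ν) = π y := fun y s => by
    simp only [hπ, hinner, add_smul]
    abel
  have hπlip : ∀ y z : Space d, ‖π y - π z‖ ≤ 2 * ‖y - z‖ := fun y z => by
    have e : π y - π z = (y - z) - ⟪ν, y - z⟫_ℝ • ν := by
      simp only [hπ, inner_sub_right, sub_smul]
      abel
    rw [e]
    refine (norm_sub_le _ _).trans ?_
    have := abs_real_inner_le_norm ν (y - z)
    rw [hν, one_mul] at this
    rw [norm_smul, hν, mul_one, Real.norm_eq_abs]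
    linarith
  have hγx : γ (π x) ≤ ⟪ν, x⟫_ℝ := by
    have hcont : Continuous fun y => γ (π y) :=
      hγ.continuous.comp (by fun_prop)
    have hcl : IsClosed {y | γ (π y) ≤ ⟪ν, y⟫_ℝ} :=
      isClosed_le hcont (continuous_const.inner continuous_id)
    have hmem : x ∈ closure (Metric.ball x ε ∩ Ω) :=
      Metric.isOpen_ball.inter_closure ⟨Metric.mem_ball_self hε, hx⟩
    refine closure_minimal ?_ hcl hmem
    rintro y ⟨hyb, hy⟩
    exact ((hUΩ y (hball hyb)).1 hy).le
  -- Lift `B(x, r)` by the height `L r`. On the ball of radius `3r` about the lifted center, the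
  -- horizontal part moves by at most `6r` and hence the graph by at most `6 K r`, while the height
  -- is more than `(L - 3) r` above that of `x`; the choice of `L` leaves a margin `r`. The radius
  -- is such that `(L + 4) r = ε / 2`, which keeps all points inside the chart.
  set L : ℝ := 6 * K + 4 with hL
  have hL4 : 4 ≤ L := by have := K.2; rw [hL]; linarith [K.coe_nonneg]
  set r : ℝ := ε / (2 * (L + 4)) with hr
  have hr0 : 0 < r := by positivity
  have hrε : (L + 4) * r < ε := by
    rw [hr, ← mul_div_assoc, div_lt_iff₀ (by positivity)]
    nlinarith
  have hbig : Metric.ball (x + (L * r) • ν) (3 * r) ⊆ Ω := by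
    intro y hy
    rw [Metric.mem_ball, dist_eq_norm] at hy
    have hyU : y ∈ U := hball <| by
      rw [Metric.mem_ball, dist_eq_norm]
      have h1 := norm_add_le (y - (x + (L * r) • ν)) ((L * r) • ν)
      rw [norm_smul, hν, mul_one, Real.norm_eq_abs, abs_of_pos (by positivity),
        show y - (x + (L * r) • ν) + (L * r) • ν = y - x by abel] at h1
      nlinarith
    refine (hUΩ y hyU).2 ?_
    have h1 : γ (π y) - γ (π x) ≤ K * (2 * (3 * r)) := by
      have := hγ.dist_le_mul (π y) (π x)
      rw [Real.dist_eq, dist_eq_norm, ← hπs x (L * r)] at this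
      rw [← hπs x (L * r)]
      refine (le_abs_self _).trans (this.trans ?_)
      have h2 := hπlip y (x + (L * r) • ν)
      gcongr
      linarith
    have h2 : ⟪ν, x⟫_ℝ + L * r - 3 * r < ⟪ν, y⟫_ℝ := by
      have h3 := abs_real_inner_le_norm ν (y - (x + (L * r) • ν))
      rw [hν, one_mul, inner_sub_right, hinner] at h3
      linarith [neg_abs_le (⟪ν, y⟫_ℝ - (⟪ν, x⟫_ℝ + L * r))]
    change γ (π y) < _
    have h3 : L * r = K * (2 * (3 * r)) + 4 * r := by rw [hL]; ring
    linarith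
  have hball' := poincareOn_ball hΩ.isBounded hr0 hbig
  refine ⟨Metric.ball x r, Metric.isOpen_ball, Metric.mem_ball_self hr0, ?_⟩
  -- Moving upwards from a point of `Ω` leaves the graph height unchanged and so stays in `Ω`; this
  -- is where the Lipschitz graph is used to reach the boundary.
  have hM := poincareOn_translate (M := Metric.ball x r ∩ Ω) hΩ.isBounded
    (Metric.isOpen_ball.inter hΩ.isOpen) hball' (h := (L * r) • ν) ?_ ?_
  · obtain ⟨C, hC, hM⟩ := hM
    refine ⟨C, hC, fun p hp => ?_⟩
    simpa [Set.inter_assoc] using hM p hp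
  · rintro y ⟨hy, hyΩ⟩ s hs
    rw [Metric.mem_ball, dist_eq_norm] at hy
    have hyU : y ∈ U := hball <| by
      rw [Metric.mem_ball, dist_eq_norm]
      nlinarith
    have hsL : 0 ≤ s * (L * r) := mul_nonneg hs.1 (by positivity)
    have hzU : y + s • (L * r) • ν ∈ U := hball <| by
      rw [Metric.mem_ball, dist_eq_norm, show y + s • (L * r) • ν - x = (y - x) + s • (L * r) • ν by abel]
      refine (norm_add_le _ _).trans_lt ?_
      rw [smul_smul, norm_smul, hν, mul_one, Real.norm_eq_abs, abs_of_nonneg hsL]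
      have : s * (L * r) ≤ L * r := mul_le_of_le_one_left (by positivity) hs.2
      nlinarith
    refine (hUΩ _ hzU).2 ?_
    have := (hUΩ y hyU).1 hyΩ
    change γ (π _) < _
    rw [smul_smul, hπs, hinner]
    exact this.trans_le (by linarith)
  · rintro y ⟨hy, -⟩
    simpa [Metric.mem_ball, dist_eq_norm] using hy

/-- Compactness of the closure gives a finite cover by good neighborhoods. Take a subfamily of
maximal cardinality whose union meets `Ω` and satisfies the inequality: if it missed part of `Ω`,
connectedness would provide an overlapping neighborhood to add. -/
theorem IsLipschitzDomain.poincareOn_univ {Ω : Set (Space d)} (hΩ : IsLipschitzDomain Ω) :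
    PoincareOn Ω Set.univ := by
  choose! N hNo hxN hN using fun x (hx : x ∈ closure Ω) => hΩ.exists_nhds_poincareOn hx
  obtain ⟨t, ht, hcov⟩ := hΩ.isBounded.isCompact_closure.elim_nhds_subcover N
    fun x hx => (hNo x hx).mem_nhds (hxN x hx)
  have hne : ∃ x ∈ t, (N x ∩ Ω).Nonempty := by
    obtain ⟨y, hy⟩ := hΩ.isConnected.nonempty
    obtain ⟨x, hx, hyx⟩ := Set.mem_iUnion₂.1 (hcov (subset_closure hy))
    exact ⟨x, hx, y, hyx, hy⟩
  classical
  let S : Finset (Finset (Space d)) := t.powerset.filter fun s =>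
    ((⋃ x ∈ s, N x) ∩ Ω).Nonempty ∧ PoincareOn Ω (⋃ x ∈ s, N x)
  have hS : S.Nonempty := by
    obtain ⟨x, hx, h⟩ := hne
    refine ⟨{x}, Finset.mem_filter.2 ⟨by simpa using hx, by simpa using h, ?_⟩⟩
    simpa using hN x (ht x hx)
  obtain ⟨s, hsS, hmax⟩ := S.exists_max_image Finset.card hS
  obtain ⟨hst, hsne, hsP⟩ := Finset.mem_filter.1 hsS
  rw [Finset.mem_powerset] at hst
  have ho : ∀ u : Finset (Space d), u ⊆ t → IsOpen (⋃ x ∈ u, N x) := fun u hu =>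
    isOpen_biUnion fun x hx => hNo x (ht x (hu hx))
  refine hsP.mono fun y hy => ?_
  by_contra hys
  have hcovs : Ω ⊆ (⋃ x ∈ s, N x) ∪ ⋃ x ∈ t \ s, N x := by
    intro w hw
    obtain ⟨x, hx, hwx⟩ := Set.mem_iUnion₂.1 (hcov (subset_closure hw))
    by_cases hxs : x ∈ s
    · exact .inl (Set.mem_biUnion hxs hwx)
    · exact .inr (Set.mem_biUnion (Finset.mem_sdiff.2 ⟨hx, hxs⟩) hwx)
  have hne' : (Ω ∩ ⋃ x ∈ t \ s, N x).Nonempty := by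
    obtain ⟨x, hx, hyx⟩ := Set.mem_iUnion₂.1 (hcov (subset_closure hy.2))
    exact ⟨y, hy.2, Set.mem_biUnion (Finset.mem_sdiff.2
      ⟨hx, fun hxs => hys (Set.mem_biUnion hxs hyx)⟩) hyx⟩
  -- The union of the chosen neighborhoods and the union of the remaining ones are open and cover
  -- the connected set `Ω`, so they meet inside `Ω`.
  obtain ⟨z, hzΩ, hz₁, hz₂⟩ := hΩ.isConnected.isPreconnected _ _ (ho s hst)
    (ho _ Finset.sdiff_subset) hcovs (by rwa [Set.inter_comm]) hne'
  obtain ⟨x, hx, hzx⟩ := Set.mem_iUnion₂.1 hz₂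
  rw [Finset.mem_sdiff] at hx
  have hU := hsP.union hΩ.isBounded (hN x (ht x hx.1)) hΩ.isOpen (ho s hst)
    (hNo x (ht x hx.1)) ⟨z, ⟨hz₁, hzx⟩, hzΩ⟩
  have e : (⋃ y ∈ insert x s, N y) = (⋃ y ∈ s, N y) ∪ N x := by
    rw [Finset.set_biUnion_insert, Set.union_comm]
  have := hmax (insert x s) (Finset.mem_filter.2 ⟨?_, ?_, ?_⟩)
  · rw [Finset.card_insert_of_notMem hx.2] at this
    omega
  · exact Finset.mem_powerset.2 (Finset.insert_subset hx.1 hst)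
  · rw [e]
    exact ⟨z, .inl hz₁, hzΩ⟩
  · rwa [e]

/-- The Poincaré inequality: `‖v - c‖ ≤ C ‖∇v‖` for some constant `c`. -/
theorem IsLipschitzDomain.poincare {Ω : Set (Space d)} (hΩ : IsLipschitzDomain Ω) :
    ∃ e : L2s Ω, (e =ᵐ[volume.restrict Ω] fun _ => 1) ∧ ∃ C : ℝ, 0 ≤ C ∧ ∀ p ∈ H1 Ω, ∃ c : ℝ,
      ‖p.fst - c • e‖ ≤ C * ‖p.snd‖ := by
  have : IsFiniteMeasure (volume.restrict Ω) := ⟨by simpa using hΩ.isBounded.measure_lt_top⟩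
  have he : MemLp (fun _ : Space d => (1 : ℝ)) 2 (volume.restrict Ω) := memLp_const 1
  obtain ⟨C, hC, h⟩ := hΩ.poincareOn_univ
  refine ⟨he.toLp, he.coeFn_toLp, √C.toReal, Real.sqrt_nonneg _, fun p hp => ?_⟩
  obtain ⟨c, hc⟩ := h p hp
  refine ⟨c, le_of_sq_le_sq ?_ (by positivity)⟩
  rw [Set.univ_inter] at hc
  have e₁ : eLpNorm (p.fst - c • he.toLp : L2s Ω) 2 (volume.restrict Ω) ^ 2 =
      ∫⁻ x in Ω, ENNReal.ofReal ((p.fst x - c) ^ 2) := by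
    rw [eLpNorm_two_sq]
    refine lintegral_congr_ae ?_
    filter_upwards [Lp.coeFn_sub p.fst (c • he.toLp), Lp.coeFn_smul c he.toLp, he.coeFn_toLp]
      with x h₁ h₂ h₃
    rw [h₁, Pi.sub_apply, h₂, Pi.smul_apply, h₃, smul_eq_mul, mul_one]
  rw [Lp.norm_def, ← ENNReal.toReal_pow, e₁, mul_pow, Real.sq_sqrt ENNReal.toReal_nonneg]
  refine ENNReal.toReal_le_of_le_ofReal (by positivity) (hc.trans (le_of_eq ?_))
  rw [ENNReal.ofReal_mul ENNReal.toReal_nonneg, ENNReal.ofReal_toReal hC]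

/-- The Poincaré inequality with the mean value replaced by a weighted mean, with a weight in
`H¹₀(Ω)`. -/
theorem IsLipschitzDomain.poincare_weighted {Ω : Set (Space d)} (hΩ : IsLipschitzDomain Ω) :
    ∃ q ∈ H10 Ω, ∃ C : ℝ, 0 ≤ C ∧ ∀ p ∈ H1 Ω, ‖p.fst‖ ≤ C * (‖p.snd‖ + |⟪p.fst, q.fst⟫_ℝ|) := by
  obtain ⟨e, he, C, hC, hP⟩ := hΩ.poincare
  obtain ⟨x, hx⟩ := hΩ.isConnected.nonempty
  obtain ⟨φ, hφs, hφc, hφd, hφr, hφx⟩ :=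
    exists_contDiff_tsupport_subset (n := ⊤) (hΩ.isOpen.mem_nhds hx)
  have hφ : IsTestFunction Ω φ := ⟨hφd, hφc, hφs⟩
  set q := hφ.pairGrad Ω
  -- The weight is a nonnegative bump function, so its mean is positive and the constant `c` can be
  -- recovered from `c m = (v, q) - (v - c, q)`.
  have hm : 0 < ⟪e, q.fst⟫_ℝ := by
    rw [hφ.inner_pairGrad_fst]
    have e₁ : ∫ x in Ω, e x * φ x = ∫ x, φ x := by
      rw [← setIntegral_eq_integral_of_forall_compl_eq_zero (s := Ω) fun x hx => hφ.eq_zero hx]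
      refine integral_congr_ae ?_
      filter_upwards [he] with x hx
      rw [hx, one_mul]
    rw [e₁]
    exact hφd.continuous.integral_pos_of_hasCompactSupport_nonneg_nonzero hφc
      (fun y => (hφr ⟨y, rfl⟩).1) (x := x) (by rw [hφx]; exact one_ne_zero)
  set m := ⟪e, q.fst⟫_ℝ
  refine ⟨q, hφ.pairGrad_mem_H10, C + ‖e‖ * (1 + C * ‖q.fst‖) / m, by positivity, fun p hp => ?_⟩
  obtain ⟨c, hc⟩ := hP p hp
  have h₁ : |c| * m ≤ |⟪p.fst, q.fst⟫_ℝ| + C * ‖p.snd‖ * ‖q.fst‖ := by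
    have e₂ : c * m = ⟪p.fst, q.fst⟫_ℝ - ⟪p.fst - c • e, q.fst⟫_ℝ := by
      rw [inner_sub_left, real_inner_smul_left]
      ring
    rw [← abs_of_pos hm, ← abs_mul, e₂]
    refine (abs_sub _ _).trans (add_le_add le_rfl ?_)
    exact (abs_real_inner_le_norm _ _).trans (mul_le_mul_of_nonneg_right hc (norm_nonneg _))
  have h₂ : ‖p.fst‖ ≤ C * ‖p.snd‖ + |c| * ‖e‖ := by
    calc ‖p.fst‖ = ‖(p.fst - c • e) + c • e‖ := by rw [sub_add_cancel]
      _ ≤ ‖p.fst - c • e‖ + ‖c • e‖ := norm_add_le _ _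
      _ ≤ _ := by
        rw [norm_smul, Real.norm_eq_abs]
        exact add_le_add hc le_rfl
  have h₃ : |c| ≤ (1 + C * ‖q.fst‖) * (‖p.snd‖ + |⟪p.fst, q.fst⟫_ℝ|) / m := by
    rw [le_div_iff₀ hm]
    refine h₁.trans ?_
    have := norm_nonneg p.snd
    have := abs_nonneg ⟪p.fst, q.fst⟫_ℝ
    have h₄ : 0 ≤ C * ‖q.fst‖ := by positivity
    nlinarith
  have h₅ := mul_le_mul_of_nonneg_right h₃ (norm_nonneg e)
  have h₆ : C * ‖p.snd‖ ≤ C * (‖p.snd‖ + |⟪p.fst, q.fst⟫_ℝ|) := by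
    gcongr
    linarith [abs_nonneg ⟪p.fst, q.fst⟫_ℝ]
  refine h₂.trans ((add_le_add h₆ h₅).trans (le_of_eq ?_))
  ring

/-! ### The first-order system

`u₁ + ∇u₄ = f₁`, `u₂ - div u₁ = f₂`, `u₃ - ∇u₂ = f₃`, `u₄ - div u₃ = f₄` for
`u₁ ∈ H₀(div, Ω)`, `u₂ ∈ H¹₀(Ω)`, `u₃ ∈ H(div, Ω)`, `u₄ ∈ H¹(Ω)`. -/

/-- An elementary absorption argument. -/
theorem add_le_of_sq_add_sq_le {K a₁ a₂ a₃ a₄ s : ℝ} (hK : 0 ≤ K) (ha₁ : 0 ≤ a₁)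
    (ha₃ : 0 ≤ a₃) (hs : 0 ≤ s) (h : a₁ ^ 2 + a₃ ^ 2 ≤ s * (a₁ + a₂ + a₃ + a₄))
    (h₂ : a₂ ≤ K * (a₁ + a₃ + s)) (h₄ : a₄ ≤ K * (a₁ + a₃ + s)) :
    a₁ + a₂ + a₃ + a₄ ≤ ((8 * K + 2) + 2 * K * (8 * K + 3)) * s := by
  -- If this failed, `s ≤ a₁ + a₃` could be absorbed in the bounds for `a₂` and `a₄`, giving `(a₁ +
  -- a₃)² ≤ 2 (a₁² + a₃²) ≤ 2 s (1 + 4K) (a₁ + a₃)`.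
  have hb : a₁ + a₃ ≤ (8 * K + 2) * s := by
    by_contra! hlt
    have hs1 : s ≤ a₁ + a₃ := by nlinarith
    have h5 : s * (a₁ + a₂ + a₃ + a₄) ≤ s * ((a₁ + a₃) + 2 * K * (2 * (a₁ + a₃))) := by
      refine mul_le_mul_of_nonneg_left ?_ hs
      have : K * (a₁ + a₃ + s) ≤ K * (2 * (a₁ + a₃)) := by
        refine mul_le_mul_of_nonneg_left ?_ hK
        linarith
      linarith
    have h6 : (a₁ + a₃) * (a₁ + a₃) ≤ (8 * K + 2) * s * (a₁ + a₃) := by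
      nlinarith [sq_nonneg (a₁ - a₃)]
    rcases hs.eq_or_lt with h0 | h0
    · rw [← h0] at hlt h6
      nlinarith
    · have : 0 < a₁ + a₃ := by linarith
      exact absurd (le_of_mul_le_mul_right h6 this) (not_le.2 hlt)
  have h7 : K * (a₁ + a₃ + s) ≤ K * ((8 * K + 3) * s) := by
    refine mul_le_mul_of_nonneg_left ?_ hK
    linarith
  nlinarith

theorem norm_le_fst_add_snd {E F : Type*} [NormedAddCommGroup E] [NormedAddCommGroup F]
    (p : WithLp 2 (E × F)) : ‖p‖ ≤ ‖p.fst‖ + ‖p.snd‖ := by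
  refine le_of_sq_le_sq ?_ (by positivity)
  rw [WithLp.prod_norm_sq_eq_of_L2]
  nlinarith [mul_nonneg (norm_nonneg p.fst) (norm_nonneg p.snd)]

/-- The a priori bound for the first-order system. -/
theorem IsLipschitzDomain.first_order_system_bound {Ω : Set (Space d)} (hΩ : IsLipschitzDomain Ω)
    (i : Fin d) :
    ∃ C : ℝ, 0 ≤ C ∧ ∀ u₁ ∈ Hdiv0 Ω, ∀ u₂ ∈ H10 Ω, ∀ u₃ ∈ Hdiv Ω, ∀ u₄ ∈ H1 Ω,
      ‖u₁‖ + ‖u₂‖ + ‖u₃‖ + ‖u₄‖ ≤ C * (‖u₁.fst + u₄.snd‖ + ‖u₂.fst - u₁.snd‖ +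
        ‖u₃.fst - u₂.snd‖ + ‖u₄.fst - u₃.snd‖) := by
  obtain ⟨CF, hCF, hF⟩ := friedrichs hΩ.isBounded i
  obtain ⟨q, hq, CP, hCP, hP⟩ := hΩ.poincare_weighted
  set K := CF + CP * (1 + ‖q.fst‖ + ‖q.snd‖) with hK
  have hK0 : 0 ≤ K := by positivity
  -- The equations bound the sum of the four derivative norms by the data plus the sum of the four
  -- function norms. The latter sum therefore enters twice, and the data once more.
  refine ⟨2 * ((8 * K + 2) + 2 * K * (8 * K + 3)) + 1, by positivity, ?_⟩
  intro u₁ h₁ u₂ h₂ u₃ h₃ u₄ h₄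
  set f₁ := u₁.fst + u₄.snd with hf₁
  set f₂ := u₂.fst - u₁.snd with hf₂
  set f₃ := u₃.fst - u₂.snd with hf₃
  set f₄ := u₄.fst - u₃.snd with hf₄
  have n1 := norm_nonneg f₁
  have n2 := norm_nonneg f₂
  have n3 := norm_nonneg f₃
  have n4 := norm_nonneg f₄
  have m1 := norm_nonneg u₁.fst
  have m2 := norm_nonneg u₂.fst
  have m3 := norm_nonneg u₃.fst
  have m4 := norm_nonneg u₄.fst
  -- Test the equations with `u₁`, `-u₄`, `u₃`, `u₂` respectively. The derivative terms cancel by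
  -- Green's formula for `(u₁, u₄)` and `(u₂, u₃)`, and the two products `(u₂, u₄)` cancel each
  -- other.
  have energy : ‖u₁.fst‖ ^ 2 + ‖u₃.fst‖ ^ 2 =
      ⟪f₁, u₁.fst⟫_ℝ - ⟪u₄.fst, f₂⟫_ℝ + ⟪f₄, u₂.fst⟫_ℝ + ⟪f₃, u₃.fst⟫_ℝ := by
    have g₁ := h₁.2 u₄ h₄
    have g₂ := inner_add_inner_eq_zero_of_mem_H10 h₂ h₃
    rw [← real_inner_self_eq_norm_sq, ← real_inner_self_eq_norm_sq]
    simp only [hf₁, hf₂, hf₃, hf₄, inner_add_left, inner_sub_left, inner_sub_right]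
    rw [real_inner_comm u₂.fst u₃.snd] at *
    linarith
  have b₁ : ‖u₁.fst‖ ^ 2 + ‖u₃.fst‖ ^ 2 ≤ (‖f₁‖ + ‖f₂‖ + ‖f₃‖ + ‖f₄‖) *
      (‖u₁.fst‖ + ‖u₂.fst‖ + ‖u₃.fst‖ + ‖u₄.fst‖) := by
    have c₁ := real_inner_le_norm f₁ u₁.fst
    have c₂ := (abs_le.1 (abs_real_inner_le_norm u₄.fst f₂)).1
    have c₃ := real_inner_le_norm f₄ u₂.fst
    have c₄ := real_inner_le_norm f₃ u₃.fst
    rw [energy]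
    nlinarith [mul_nonneg n1 m2, mul_nonneg n1 m3, mul_nonneg n1 m4, mul_nonneg n2 m1,
      mul_nonneg n2 m2, mul_nonneg n2 m3, mul_nonneg n3 m1, mul_nonneg n3 m2, mul_nonneg n3 m4,
      mul_nonneg n4 m1, mul_nonneg n4 m3, mul_nonneg n4 m4]
  have s1 : ‖u₄.snd‖ ≤ ‖f₁‖ + ‖u₁.fst‖ := by
    have := norm_sub_le f₁ u₁.fst
    rwa [hf₁, add_sub_cancel_left] at this
  have s2 : ‖u₁.snd‖ ≤ ‖f₂‖ + ‖u₂.fst‖ := by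
    have := norm_sub_le u₂.fst f₂
    rw [hf₂, sub_sub_cancel] at this
    linarith
  have s3 : ‖u₂.snd‖ ≤ ‖f₃‖ + ‖u₃.fst‖ := by
    have := norm_sub_le u₃.fst f₃
    rw [hf₃, sub_sub_cancel] at this
    linarith
  have s4 : ‖u₃.snd‖ ≤ ‖f₄‖ + ‖u₄.fst‖ := by
    have := norm_sub_le u₄.fst f₄
    rw [hf₄, sub_sub_cancel] at this
    linarith
  set s := ‖f₁‖ + ‖f₂‖ + ‖f₃‖ + ‖f₄‖ with hs
  have b₂ : ‖u₂.fst‖ ≤ K * (‖u₁.fst‖ + ‖u₃.fst‖ + s) := by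
    refine (hF u₂ h₂).trans ?_
    have hle : CF ≤ K := by rw [hK]; linarith [show 0 ≤ CP * (1 + ‖q.fst‖ + ‖q.snd‖) by positivity]
    exact mul_le_mul hle (by linarith) (norm_nonneg _) hK0
  have b₄ : ‖u₄.fst‖ ≤ K * (‖u₁.fst‖ + ‖u₃.fst‖ + s) := by
    refine (hP u₄ h₄).trans ?_
    have g := inner_add_inner_eq_zero_of_mem_H10 hq h₃
    -- Substitute `u₄ = f₄ + div u₃` and integrate by parts; there is no boundary term because the
    -- weight lies in `H¹₀(Ω)`. This is what replaces a mean value condition on `u₄`.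
    have e : ⟪u₄.fst, q.fst⟫_ℝ = ⟪f₄, q.fst⟫_ℝ - ⟪u₃.fst, q.snd⟫_ℝ := by
      rw [hf₄, inner_sub_left, real_inner_comm q.fst u₃.snd, real_inner_comm q.snd u₃.fst]
      linarith
    have e' : |⟪u₄.fst, q.fst⟫_ℝ| ≤ ‖f₄‖ * ‖q.fst‖ + ‖u₃.fst‖ * ‖q.snd‖ := by
      rw [e]
      exact (abs_sub _ _).trans (add_le_add (abs_real_inner_le_norm _ _)
        (abs_real_inner_le_norm _ _))
    have hle : CP * (1 + ‖q.fst‖ + ‖q.snd‖) ≤ K := by rw [hK]; linarith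
    refine le_trans ?_ (mul_le_mul_of_nonneg_right hle (by positivity))
    rw [mul_assoc]
    refine mul_le_mul_of_nonneg_left ?_ hCP
    have t1 : ‖f₄‖ * ‖q.fst‖ ≤ (‖u₁.fst‖ + ‖u₃.fst‖ + s) * ‖q.fst‖ := by gcongr; linarith
    have t2 : ‖u₃.fst‖ * ‖q.snd‖ ≤ (‖u₁.fst‖ + ‖u₃.fst‖ + s) * ‖q.snd‖ := by gcongr; linarith
    have t3 : ‖f₁‖ ≤ s := by linarith
    linarith
  have main := add_le_of_sq_add_sq_le hK0 m1 m3 (by positivity) b₁ b₂ b₄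
  have N1 := norm_le_fst_add_snd u₁
  have N2 := norm_le_fst_add_snd u₂
  have N3 := norm_le_fst_add_snd u₃
  have N4 := norm_le_fst_add_snd u₄
  linarith

/-- Right-hand sides `(f₁, f₂, f₃, f₄)` of the first-order system. -/
abbrev SystemData (Ω : Set (Space d)) : Type :=
  WithLp 2 (WithLp 2 (L2v Ω × L2s Ω) × WithLp 2 (L2v Ω × L2s Ω))

/-- The operator `(u₁, u₂, u₃, u₄) ↦ (u₁ + ∇u₄, u₂ - div u₁, u₃ - ∇u₂, u₄ - div u₃)`. -/
def systemOp (Ω : Set (Space d)) : (Hdiv0 Ω × H10 Ω × Hdiv Ω × H1 Ω) →L[ℝ]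
    SystemData Ω :=
  let D := Hdiv0 Ω × H10 Ω × Hdiv Ω × H1 Ω
  let u₁ : D →L[ℝ] PairDiv Ω := (Hdiv0 Ω).subtypeL.comp (.fst ℝ _ _)
  let u₂ : D →L[ℝ] PairGrad Ω := (H10 Ω).subtypeL.comp ((ContinuousLinearMap.fst ℝ _ _).comp (.snd ℝ _ _))
  let u₃ : D →L[ℝ] PairDiv Ω := (Hdiv Ω).subtypeL.comp
    ((ContinuousLinearMap.fst ℝ _ _).comp ((ContinuousLinearMap.snd ℝ _ _).comp (.snd ℝ _ _)))
  let u₄ : D →L[ℝ] PairGrad Ω := (H1 Ω).subtypeL.comp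
    ((ContinuousLinearMap.snd ℝ _ _).comp ((ContinuousLinearMap.snd ℝ _ _).comp (.snd ℝ _ _)))
  let e := (WithLp.prodContinuousLinearEquiv 2 ℝ (L2v Ω) (L2s Ω)).symm.toContinuousLinearMap
  (WithLp.prodContinuousLinearEquiv 2 ℝ (WithLp 2 (L2v Ω × L2s Ω))
      (WithLp 2 (L2v Ω × L2s Ω))).symm.toContinuousLinearMap.comp
    ((e.comp (((WithLp.fstL 2 ℝ _ _).comp u₁ + (WithLp.sndL 2 ℝ _ _).comp u₄).prod
        ((WithLp.fstL 2 ℝ _ _).comp u₂ - (WithLp.sndL 2 ℝ _ _).comp u₁))).prod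
      (e.comp (((WithLp.fstL 2 ℝ _ _).comp u₃ - (WithLp.sndL 2 ℝ _ _).comp u₂).prod
        ((WithLp.fstL 2 ℝ _ _).comp u₄ - (WithLp.sndL 2 ℝ _ _).comp u₃))))

theorem systemOp_apply (Ω : Set (Space d)) (u : Hdiv0 Ω × H10 Ω × Hdiv Ω × H1 Ω) :
    systemOp Ω u = WithLp.toLp 2
      (WithLp.toLp 2 ((u.1 : PairDiv Ω).fst + (u.2.2.2 : PairGrad Ω).snd,
        (u.2.1 : PairGrad Ω).fst - (u.1 : PairDiv Ω).snd),
      WithLp.toLp 2 ((u.2.2.1 : PairDiv Ω).fst - (u.2.1 : PairGrad Ω).snd,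
        (u.2.2.2 : PairGrad Ω).fst - (u.2.2.1 : PairDiv Ω).snd)) := rfl

/-- The a priori bound makes the operator bounded below on a complete space. Each of the four data
components is at most the full data norm, hence the factor 4. -/
theorem isClosed_range_systemOp {Ω : Set (Space d)} (hΩ : IsLipschitzDomain Ω) (i : Fin d) :
    IsClosed (Set.range (systemOp Ω)) := by
  have : CompleteSpace (Hdiv0 Ω) := (isClosed_Hdiv0 Ω).completeSpace_coe
  have : CompleteSpace (H10 Ω) := (isClosed_H10 Ω).completeSpace_coe
  have : CompleteSpace (Hdiv Ω) := (isClosed_Hdiv Ω).completeSpace_coe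
  have : CompleteSpace (H1 Ω) := (isClosed_H1 Ω).completeSpace_coe
  obtain ⟨C, hC, hb⟩ := hΩ.first_order_system_bound i
  have hanti : AntilipschitzWith (C * 4).toNNReal (systemOp Ω) := by
    refine ContinuousLinearMap.antilipschitz_of_bound _ fun u => ?_
    rw [Real.coe_toNNReal _ (by positivity)]
    have h := hb u.1 u.1.2 u.2.1 u.2.1.2 u.2.2.1 u.2.2.1.2 u.2.2.2 u.2.2.2.2
    have k₁ : ‖(systemOp Ω u).fst‖ ≤ ‖systemOp Ω u‖ := WithLp.norm_fst_le _ _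
    have k₂ : ‖(systemOp Ω u).snd‖ ≤ ‖systemOp Ω u‖ := WithLp.norm_snd_le _ _
    have k₃ : ‖(systemOp Ω u).fst.fst‖ ≤ _ := WithLp.norm_fst_le _ _
    have k₄ : ‖(systemOp Ω u).fst.snd‖ ≤ _ := WithLp.norm_snd_le _ _
    have k₅ : ‖(systemOp Ω u).snd.fst‖ ≤ _ := WithLp.norm_fst_le _ _
    have k₆ : ‖(systemOp Ω u).snd.snd‖ ≤ _ := WithLp.norm_snd_le _ _
    have hu : ‖u‖ ≤ ‖(u.1 : PairDiv Ω)‖ + ‖(u.2.1 : PairGrad Ω)‖ + ‖(u.2.2.1 : PairDiv Ω)‖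
        + ‖(u.2.2.2 : PairGrad Ω)‖ := by
      have a1 := norm_nonneg (u.1 : PairDiv Ω)
      have a2 := norm_nonneg (u.2.1 : PairGrad Ω)
      have a3 := norm_nonneg (u.2.2.1 : PairDiv Ω)
      have a4 := norm_nonneg (u.2.2.2 : PairGrad Ω)
      simp only [Prod.norm_def, Submodule.coe_norm]
      refine max_le (by linarith) (max_le (by linarith) (max_le (by linarith) (by linarith)))
    refine hu.trans (h.trans ?_)
    rw [mul_assoc]
    refine mul_le_mul_of_nonneg_left ?_ hC
    change ‖(systemOp Ω u).fst.fst‖ + ‖(systemOp Ω u).fst.snd‖ + ‖(systemOp Ω u).snd.fst‖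
      + ‖(systemOp Ω u).snd.snd‖ ≤ _
    linarith
  exact hanti.isClosed_range (systemOp Ω).uniformContinuous

/-- The first-order system operator has trivial cokernel. -/
theorem IsLipschitzDomain.eq_zero_of_orthogonal_system {Ω : Set (Space d)}
    (hΩ : IsLipschitzDomain Ω) (i : Fin d) {y₁ : L2v Ω} {y₂ : L2s Ω} {y₃ : L2v Ω} {y₄ : L2s Ω}
    (k₁ : ∀ u₁ ∈ Hdiv0 Ω, ⟪y₁, u₁.fst⟫_ℝ - ⟪y₂, u₁.snd⟫_ℝ = 0)
    (k₂ : ∀ u₂ ∈ H10 Ω, ⟪y₂, u₂.fst⟫_ℝ - ⟪y₃, u₂.snd⟫_ℝ = 0)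
    (k₃ : ∀ u₃ ∈ Hdiv Ω, ⟪y₃, u₃.fst⟫_ℝ - ⟪y₄, u₃.snd⟫_ℝ = 0)
    (k₄ : ∀ u₄ ∈ H1 Ω, ⟪y₁, u₄.snd⟫_ℝ + ⟪y₄, u₄.fst⟫_ℝ = 0) :
    y₁ = 0 ∧ y₂ = 0 ∧ y₃ = 0 ∧ y₄ = 0 := by
  -- The adjoint is the same system: `(y₁, y₄)`, `(y₄, -y₃)`, `(-y₃, y₂)`, `(y₂, -y₁)` lie in the
  -- four spaces and solve it with zero data. Orthogonality to test functions yields the weak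
  -- derivatives; orthogonality to all of `H¹(Ω)` and `H(div, Ω)` yields the boundary conditions on
  -- the first and second pair.
  have z₁ : (WithLp.toLp 2 (y₁, y₄) : PairDiv Ω) ∈ Hdiv0 Ω := by
    refine ⟨mem_Hdiv_iff.2 fun φ h => ?_, fun v hv => ?_⟩
    · rw [add_comm]
      exact k₄ _ h.pairGrad_mem_H1
    · rw [add_comm, real_inner_comm, real_inner_comm _ v.fst]
      exact k₄ v hv
  have z₂ : (WithLp.toLp 2 (y₄, -y₃) : PairGrad Ω) ∈ H10 Ω := by
    refine mem_H10_iff.2 fun τ hτ => ?_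
    change ⟪y₄, τ.snd⟫_ℝ + ⟪-y₃, τ.fst⟫_ℝ = 0
    rw [inner_neg_left]
    linarith [k₃ τ hτ]
  have z₃ : (WithLp.toLp 2 (-y₃, y₂) : PairDiv Ω) ∈ Hdiv Ω := by
    refine mem_Hdiv_iff.2 fun φ h => ?_
    change ⟪y₂, (h.pairGrad Ω).fst⟫_ℝ + ⟪-y₃, (h.pairGrad Ω).snd⟫_ℝ = 0
    rw [inner_neg_left]
    linarith [k₂ _ h.pairGrad_mem_H10]
  have z₄ : (WithLp.toLp 2 (y₂, -y₁) : PairGrad Ω) ∈ H1 Ω := by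
    refine mem_H1_iff.2 fun φ h j => ?_
    change ⟪y₂, (h.pairDiv Ω j).snd⟫_ℝ + ⟪-y₁, (h.pairDiv Ω j).fst⟫_ℝ = 0
    rw [inner_neg_left]
    linarith [k₁ _ (h.pairDiv_mem_Hdiv0 j)]
  obtain ⟨C, hC, hb⟩ := hΩ.first_order_system_bound i
  have hz := hb _ z₁ _ z₂ _ z₃ _ z₄
  simp only [WithLp.toLp_fst, WithLp.toLp_snd, add_neg_cancel, sub_self, norm_zero, add_zero,
    mul_zero] at hz
  -- The first and third pairs already contain all four unknowns.
  have z₁0 : (WithLp.toLp 2 (y₁, y₄) : PairDiv Ω) = 0 := by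
    rw [← norm_le_zero_iff]
    refine le_trans ?_ hz
    rw [add_assoc, add_assoc]
    exact le_add_of_nonneg_right (by positivity)
  have z₃0 : (WithLp.toLp 2 (-y₃, y₂) : PairDiv Ω) = 0 := by
    rw [← norm_le_zero_iff]
    refine le_trans ?_ hz
    rw [add_right_comm]
    exact le_add_of_nonneg_left (by positivity)
  have e₁ : y₁ = 0 := congrArg WithLp.fst z₁0
  have e₄ : y₄ = 0 := congrArg WithLp.snd z₁0
  have e₃ : y₃ = 0 := neg_eq_zero.1 (congrArg WithLp.fst z₃0)
  have e₂ : y₂ = 0 := congrArg WithLp.snd z₃0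
  exact ⟨e₁, e₂, e₃, e₄⟩

theorem inner_systemOp {Ω : Set (Space d)}
    (y : SystemData Ω)
    (u : Hdiv0 Ω × H10 Ω × Hdiv Ω × H1 Ω) : ⟪y, systemOp Ω u⟫_ℝ =
      ⟪y.fst.fst, (u.1 : PairDiv Ω).fst + (u.2.2.2 : PairGrad Ω).snd⟫_ℝ +
      ⟪y.fst.snd, (u.2.1 : PairGrad Ω).fst - (u.1 : PairDiv Ω).snd⟫_ℝ +
      (⟪y.snd.fst, (u.2.2.1 : PairDiv Ω).fst - (u.2.1 : PairGrad Ω).snd⟫_ℝ +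
      ⟪y.snd.snd, (u.2.2.2 : PairGrad Ω).fst - (u.2.2.1 : PairDiv Ω).snd⟫_ℝ) := by
  rw [systemOp_apply, WithLp.prod_inner_apply, WithLp.prod_inner_apply, WithLp.prod_inner_apply]
  rfl

/-- The first-order system is uniquely solvable for all right-hand sides. -/
theorem IsLipschitzDomain.first_order_system_surjective {Ω : Set (Space d)}
    (hΩ : IsLipschitzDomain Ω) (i : Fin d) (f₁ : L2v Ω) (f₂ : L2s Ω) (f₃ : L2v Ω) (f₄ : L2s Ω) :
    ∃ u₁ ∈ Hdiv0 Ω, ∃ u₂ ∈ H10 Ω, ∃ u₃ ∈ Hdiv Ω, ∃ u₄ ∈ H1 Ω,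
      u₁.fst + u₄.snd = f₁ ∧ u₂.fst - u₁.snd = f₂ ∧ u₃.fst - u₂.snd = f₃ ∧
        u₄.fst - u₃.snd = f₄ := by
  set R := (systemOp Ω).toLinearMap.range
  have hcl : IsClosed (R : Set (SystemData Ω)) := isClosed_range_systemOp hΩ i
  have : CompleteSpace R := hcl.completeSpace_coe
  have htop : R = ⊤ := by
    rw [← Submodule.orthogonal_eq_bot_iff, Submodule.eq_bot_iff]
    intro y hy
    have key : ∀ u : Hdiv0 Ω × H10 Ω × Hdiv Ω × H1 Ω, ⟪y, systemOp Ω u⟫_ℝ = 0 := fun u =>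
      (Submodule.mem_orthogonal' _ _).1 hy _ ⟨u, rfl⟩
    simp only [inner_systemOp] at key
    obtain ⟨e₁, e₂, e₃, e₄⟩ := hΩ.eq_zero_of_orthogonal_system i
      (fun u hu => by simpa [sub_eq_add_neg] using key (⟨u, hu⟩, 0, 0, 0))
      (fun u hu => by simpa [sub_eq_add_neg] using key (0, ⟨u, hu⟩, 0, 0))
      (fun u hu => by simpa [sub_eq_add_neg] using key (0, 0, ⟨u, hu⟩, 0))
      (fun u hu => by simpa using key (0, 0, 0, ⟨u, hu⟩))
    rw [← norm_le_zero_iff]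
    have n := norm_le_fst_add_snd y
    have n₁ := norm_le_fst_add_snd y.fst
    have n₂ := norm_le_fst_add_snd y.snd
    rw [e₁, e₂, norm_zero, norm_zero] at n₁
    rw [e₃, e₄, norm_zero, norm_zero] at n₂
    linarith
  have hmem : WithLp.toLp 2 (WithLp.toLp 2 (f₁, f₂), WithLp.toLp 2 (f₃, f₄)) ∈ R := by
    rw [htop]; trivial
  obtain ⟨u, hu⟩ := hmem
  have hu' := (systemOp_apply Ω u).symm.trans hu
  refine ⟨u.1, u.1.2, u.2.1, u.2.1.2, u.2.2.1, u.2.2.1.2, u.2.2.2, u.2.2.2.2, ?_, ?_, ?_, ?_⟩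
  · exact congrArg (fun z => z.fst.fst) hu'
  · exact congrArg (fun z => z.fst.snd) hu'
  · exact congrArg (fun z => z.snd.fst) hu'
  · exact congrArg (fun z => z.snd.snd) hu'

/-! ### Trace norms -/

section Traces

variable {Ω : Set (Space d)} {𝒯 : Mesh Ω}

theorem norm_fn_le (v : H1T 𝒯) : ‖fn v‖ ≤ ‖v‖ := WithLp.norm_fst_le _ (v : PairGrad Ω)

theorem norm_grad_le (v : H1T 𝒯) : ‖grad v‖ ≤ ‖v‖ := WithLp.norm_snd_le _ (v : PairGrad Ω)

theorem norm_field_le (τ : HdivT 𝒯) : ‖field τ‖ ≤ ‖τ‖ := WithLp.norm_fst_le _ (τ : PairDiv Ω)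

theorem norm_dive_le (τ : HdivT 𝒯) : ‖dive τ‖ ≤ ‖τ‖ := WithLp.norm_snd_le _ (τ : PairDiv Ω)

theorem inner_H1T (v w : H1T 𝒯) : ⟪v, w⟫_ℝ = ⟪fn v, fn w⟫_ℝ + ⟪grad v, grad w⟫_ℝ := by
  rw [Submodule.coe_inner, WithLp.prod_inner_apply]
  rfl

theorem inner_HdivT (τ σ : HdivT 𝒯) :
    ⟪τ, σ⟫_ℝ = ⟪field τ, field σ⟫_ℝ + ⟪dive τ, dive σ⟫_ℝ := by
  rw [Submodule.coe_inner, WithLp.prod_inner_apply]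
  rfl

theorem norm_sq_H1T (v : H1T 𝒯) : ‖v‖ ^ 2 = ‖fn v‖ ^ 2 + ‖grad v‖ ^ 2 :=
  WithLp.prod_norm_sq_eq_of_L2 (v : PairGrad Ω)

theorem norm_sq_HdivT (τ : HdivT 𝒯) : ‖τ‖ ^ 2 = ‖field τ‖ ^ 2 + ‖dive τ‖ ^ 2 :=
  WithLp.prod_norm_sq_eq_of_L2 (τ : PairDiv Ω)

variable (𝒯) in
/-- `H¹(Ω) ⊆ H¹(𝒯)`. -/
def toH1T {v : PairGrad Ω} (hv : v ∈ H1 Ω) : H1T 𝒯 := ⟨v, H1_le_brokenH1 𝒯.subset hv⟩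

variable (𝒯) in
/-- `H(div, Ω) ⊆ H(div, 𝒯)`. -/
def toHdivT {τ : PairDiv Ω} (hτ : τ ∈ Hdiv Ω) : HdivT 𝒯 := ⟨τ, Hdiv_le_brokenHdiv 𝒯.subset hτ⟩

/-- Cauchy–Schwarz for the crossed pairing. The constant 1 is what makes the extension norms equal
to the dual norms rather than merely equivalent. -/
theorem abs_traceGrad_le (v : H1T 𝒯) (τ : HdivT 𝒯) : |traceGrad 𝒯 v τ| ≤ ‖v‖ * ‖τ‖ := by
  have h₁ := abs_real_inner_le_norm (fn v) (dive τ)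
  have h₂ := abs_real_inner_le_norm (grad v) (field τ)
  rw [traceGrad_apply]
  refine (abs_add_le _ _).trans ((add_le_add h₁ h₂).trans ?_)
  refine abs_le_of_sq_le_sq' ?_ (by positivity) |>.2
  rw [mul_pow, norm_sq_H1T, norm_sq_HdivT]
  nlinarith [sq_nonneg (‖fn v‖ * ‖field τ‖ - ‖grad v‖ * ‖dive τ‖)]

theorem traceGrad_eq_zero_of_mem_Hdiv0 {v : H1T 𝒯} (hv : (v : PairGrad Ω) ∈ H1 Ω) {τ : HdivT 𝒯}
    (hτ : (τ : PairDiv Ω) ∈ Hdiv0 Ω) : traceGrad 𝒯 v τ = 0 :=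
  hτ.2 _ hv

theorem traceGrad_eq_zero_of_mem_H10 {v : H1T 𝒯} (hv : (v : PairGrad Ω) ∈ H10 Ω) {τ : HdivT 𝒯}
    (hτ : (τ : PairDiv Ω) ∈ Hdiv Ω) : traceGrad 𝒯 v τ = 0 :=
  inner_add_inner_eq_zero_of_mem_H10 hv hτ

/-- A functional on `H¹(𝒯)` that vanishes on `H¹₀(Ω)` is the normal trace of the field `∇v ∈ H(div, Ω)`,
`v` its Riesz representative. -/
theorem exists_traceDiv_eq {τ' : H1T 𝒯 →L[ℝ] ℝ}
    (h : ∀ v : H1T 𝒯, (v : PairGrad Ω) ∈ H10 Ω → τ' v = 0) :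
    ∃ σ : HdivT 𝒯, (σ : PairDiv Ω) ∈ Hdiv Ω ∧ traceDiv 𝒯 σ = τ' ∧ ‖σ‖ = ‖τ'‖ := by
  set v := (InnerProductSpace.toDual ℝ (H1T 𝒯)).symm τ' with hv
  have hvw : ∀ w, ⟪v, w⟫_ℝ = τ' w := fun w => InnerProductSpace.toDual_symm_apply
  -- For `φ ∈ C_c^∞(Ω)`, whose support may cross element interfaces, `(v, φ) + (∇v, ∇φ) = τ'(φ) =
  -- 0`. Hence the piecewise gradient has a global weak divergence, namely `v`.
  have hσ : (WithLp.toLp 2 (grad v, fn v) : PairDiv Ω) ∈ Hdiv Ω := by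
    refine mem_Hdiv_iff.2 fun φ hφ => ?_
    have := h (toH1T 𝒯 hφ.pairGrad_mem_H1) hφ.pairGrad_mem_H10
    rw [← hvw, inner_H1T] at this
    exact this
  refine ⟨toHdivT 𝒯 hσ, hσ, ?_, ?_⟩
  · ext w
    rw [← hvw, inner_H1T, traceDiv_apply, traceGrad_apply, real_inner_comm,
      real_inner_comm _ (grad w)]
    rfl
  · have hn : ‖v‖ = ‖τ'‖ := LinearIsometryEquiv.norm_map _ _
    rw [← hn, ← sq_eq_sq₀ (norm_nonneg _) (norm_nonneg _), norm_sq_H1T, norm_sq_HdivT, add_comm]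
    rfl

/-- A functional on `H(div, 𝒯)` that vanishes on `H₀(div, Ω)` is the trace of `div τ ∈ H¹(Ω)`,
`τ` its Riesz representative. -/
theorem exists_traceGrad_eq {v' : HdivT 𝒯 →L[ℝ] ℝ}
    (h : ∀ τ : HdivT 𝒯, (τ : PairDiv Ω) ∈ Hdiv0 Ω → v' τ = 0) :
    ∃ w : H1T 𝒯, (w : PairGrad Ω) ∈ H1 Ω ∧ traceGrad 𝒯 w = v' ∧ ‖w‖ = ‖v'‖ := by
  set τ := (InnerProductSpace.toDual ℝ (HdivT 𝒯)).symm v' with hτ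
  have hτσ : ∀ σ, ⟪τ, σ⟫_ℝ = v' σ := fun w => InnerProductSpace.toDual_symm_apply
  have hw : (WithLp.toLp 2 (dive τ, field τ) : PairGrad Ω) ∈ H1 Ω := by
    refine mem_H1_iff.2 fun φ hφ i => ?_
    have := h (toHdivT 𝒯 (hφ.pairDiv_mem_Hdiv i)) (hφ.pairDiv_mem_Hdiv0 i)
    rw [← hτσ, inner_HdivT, add_comm] at this
    exact this
  refine ⟨toH1T 𝒯 hw, hw, ?_, ?_⟩
  · ext σ
    rw [← hτσ, inner_HdivT, traceGrad_apply, add_comm]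
    rfl
  · have hn : ‖τ‖ = ‖v'‖ := LinearIsometryEquiv.norm_map _ _
    rw [← hn, ← sq_eq_sq₀ (norm_nonneg _) (norm_nonneg _), norm_sq_H1T, norm_sq_HdivT, add_comm]
    rfl

theorem mem_TrHdiv {τ' : H1T 𝒯 →L[ℝ] ℝ} :
    τ' ∈ TrHdiv 𝒯 ↔ ∃ τ : HdivT 𝒯, (τ : PairDiv Ω) ∈ Hdiv Ω ∧ traceDiv 𝒯 τ = τ' := Iff.rfl

theorem mem_TrHdiv0 {τ' : H1T 𝒯 →L[ℝ] ℝ} :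
    τ' ∈ TrHdiv0 𝒯 ↔ ∃ τ : HdivT 𝒯, (τ : PairDiv Ω) ∈ Hdiv0 Ω ∧ traceDiv 𝒯 τ = τ' := Iff.rfl

theorem mem_TrH1 {v' : HdivT 𝒯 →L[ℝ] ℝ} :
    v' ∈ TrH1 𝒯 ↔ ∃ v : H1T 𝒯, (v : PairGrad Ω) ∈ H1 Ω ∧ traceGrad 𝒯 v = v' := Iff.rfl

theorem mem_TrH10 {v' : HdivT 𝒯 →L[ℝ] ℝ} :
    v' ∈ TrH10 𝒯 ↔ ∃ v : H1T 𝒯, (v : PairGrad Ω) ∈ H10 Ω ∧ traceGrad 𝒯 v = v' := Iff.rfl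

theorem TrHdiv0_le_TrHdiv : TrHdiv0 𝒯 ≤ TrHdiv 𝒯 := fun _ ⟨τ, h, e⟩ => ⟨τ, h.1, e⟩

theorem TrH10_le_TrH1 : TrH10 𝒯 ≤ TrH1 𝒯 := fun _ ⟨v, h, e⟩ => ⟨v, H10_le_H1 Ω h, e⟩

/-- On `H^{-1/2}(𝒮)` the minimum extension norm is the norm of `H¹(𝒯)'`. -/
theorem normNegHalf_eq {τ' : H1T 𝒯 →L[ℝ] ℝ} (h : τ' ∈ TrHdiv 𝒯) : normNegHalf τ' = ‖τ'‖ := by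
  obtain ⟨σ, hσ, rfl⟩ := mem_TrHdiv.1 h
  refine le_antisymm ?_ (le_csInf ⟨_, σ, hσ, rfl, rfl⟩ ?_)
  -- The infimum is attained by the extension built from the Riesz representative.
  · obtain ⟨τ, hτ, he, hn⟩ := exists_traceDiv_eq (τ' := traceDiv 𝒯 σ) fun v hv => by
      rw [traceDiv_apply, traceGrad_eq_zero_of_mem_H10 hv hσ]
    refine csInf_le ⟨0, ?_⟩ ⟨τ, hτ, he, hn.symm⟩
    rintro r ⟨τ, -, -, rfl⟩
    exact norm_nonneg τ
  · rintro r ⟨τ, -, he, rfl⟩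
    rw [← he]
    refine ContinuousLinearMap.opNorm_le_bound _ (norm_nonneg _) fun v => ?_
    rw [traceDiv_apply, Real.norm_eq_abs, mul_comm]
    exact abs_traceGrad_le v τ

/-- On `H^{1/2}(𝒮)` the minimum extension norm is the norm of `H(div, 𝒯)'`. -/
theorem normHalf_eq {v' : HdivT 𝒯 →L[ℝ] ℝ} (h : v' ∈ TrH1 𝒯) : normHalf v' = ‖v'‖ := by
  obtain ⟨w, hw, rfl⟩ := mem_TrH1.1 h
  refine le_antisymm ?_ (le_csInf ⟨_, w, hw, rfl, rfl⟩ ?_)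
  · obtain ⟨v, hv, he, hn⟩ := exists_traceGrad_eq (v' := traceGrad 𝒯 w) fun τ hτ =>
      traceGrad_eq_zero_of_mem_Hdiv0 hw hτ
    refine csInf_le ⟨0, ?_⟩ ⟨v, hv, he, hn.symm⟩
    rintro r ⟨τ, -, -, rfl⟩
    exact norm_nonneg τ
  · rintro r ⟨v, -, he, rfl⟩
    rw [← he]
    exact ContinuousLinearMap.opNorm_le_bound _ (norm_nonneg _) fun τ => abs_traceGrad_le v τ

theorem normU_sq (u : Trial 𝒯) : normU u ^ 2 =
    ‖u.1.1‖ ^ 2 + ‖u.1.2.1‖ ^ 2 + ‖u.1.2.2.1‖ ^ 2 + ‖u.1.2.2.2‖ ^ 2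
      + ‖(u.2.1 : H1T 𝒯 →L[ℝ] ℝ)‖ ^ 2 + ‖(u.2.2.1 : HdivT 𝒯 →L[ℝ] ℝ)‖ ^ 2
      + ‖(u.2.2.2.1 : H1T 𝒯 →L[ℝ] ℝ)‖ ^ 2 + ‖(u.2.2.2.2 : HdivT 𝒯 →L[ℝ] ℝ)‖ ^ 2 := by
  have h₁ := normNegHalf_eq (TrHdiv0_le_TrHdiv u.2.1.2)
  have h₂ := normHalf_eq (TrH10_le_TrH1 u.2.2.1.2)
  have h₃ := normNegHalf_eq u.2.2.2.1.2
  have h₄ := normHalf_eq u.2.2.2.2.2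
  have key : ∀ {a b c d n₁ n₂ n₃ n₄ m₁ m₂ m₃ m₄ : ℝ}, n₁ = m₁ → n₂ = m₂ → n₃ = m₃ → n₄ = m₄ →
      √(a ^ 2 + b ^ 2 + c ^ 2 + d ^ 2 + n₁ ^ 2 + n₂ ^ 2 + n₃ ^ 2 + n₄ ^ 2) ^ 2 =
        a ^ 2 + b ^ 2 + c ^ 2 + d ^ 2 + m₁ ^ 2 + m₂ ^ 2 + m₃ ^ 2 + m₄ ^ 2 := by
    rintro a b c d n₁ n₂ n₃ n₄ _ _ _ _ rfl rfl rfl rfl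
    exact Real.sq_sqrt (by positivity)
  exact key h₁ h₂ h₃ h₄

theorem normU_nonneg (u : Trial 𝒯) : 0 ≤ normU u := Real.sqrt_nonneg _

theorem eq_zero_of_normU_eq_zero {u : Trial 𝒯} (h : normU u = 0) : u = 0 := by
  have hs := normU_sq u
  rw [h] at hs
  have e : ∀ {x : ℝ}, 0 ≤ x → x ^ 2 ≤ 0 → x = 0 := fun hx h =>
    pow_eq_zero_iff two_ne_zero |>.1 (le_antisymm h (sq_nonneg _))
  have p₁ := sq_nonneg ‖u.1.1‖
  have p₂ := sq_nonneg ‖u.1.2.1‖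
  have p₃ := sq_nonneg ‖u.1.2.2.1‖
  have p₄ := sq_nonneg ‖u.1.2.2.2‖
  have p₅ := sq_nonneg ‖(u.2.1 : H1T 𝒯 →L[ℝ] ℝ)‖
  have p₆ := sq_nonneg ‖(u.2.2.1 : HdivT 𝒯 →L[ℝ] ℝ)‖
  have p₇ := sq_nonneg ‖(u.2.2.2.1 : H1T 𝒯 →L[ℝ] ℝ)‖
  have p₈ := sq_nonneg ‖(u.2.2.2.2 : HdivT 𝒯 →L[ℝ] ℝ)‖
  have q₁ : ‖u.1.1‖ = 0 := e (norm_nonneg _) (by linarith)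
  have q₂ : ‖u.1.2.1‖ = 0 := e (norm_nonneg _) (by linarith)
  have q₃ : ‖u.1.2.2.1‖ = 0 := e (norm_nonneg _) (by linarith)
  have q₄ : ‖u.1.2.2.2‖ = 0 := e (norm_nonneg _) (by linarith)
  have q₅ : ‖(u.2.1 : H1T 𝒯 →L[ℝ] ℝ)‖ = 0 := e (ContinuousLinearMap.opNorm_nonneg _) (by linarith)
  have q₆ : ‖(u.2.2.1 : HdivT 𝒯 →L[ℝ] ℝ)‖ = 0 := e (ContinuousLinearMap.opNorm_nonneg _) (by linarith)
  have q₇ : ‖(u.2.2.2.1 : H1T 𝒯 →L[ℝ] ℝ)‖ = 0 := e (ContinuousLinearMap.opNorm_nonneg _) (by linarith)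
  have q₈ : ‖(u.2.2.2.2 : HdivT 𝒯 →L[ℝ] ℝ)‖ = 0 := e (ContinuousLinearMap.opNorm_nonneg _) (by linarith)
  rw [norm_eq_zero] at q₁ q₂ q₃ q₄
  have z : ∀ {E : Type} [NormedAddCommGroup E] [NormedSpace ℝ E] {f : E →L[ℝ] ℝ}, ‖f‖ = 0 → f = 0 :=
    fun h => norm_eq_zero.1 h
  exact Prod.ext (Prod.ext q₁ (Prod.ext q₂ (Prod.ext q₃ q₄))) (Prod.ext (Subtype.ext (z q₅))
    (Prod.ext (Subtype.ext (z q₆)) (Prod.ext (Subtype.ext (z q₇)) (Subtype.ext (z q₈)))))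

end Traces

/-! ### The variational formulation -/

section Formulation

variable {Ω : Set (Space d)} {𝒯 : Mesh Ω}

theorem bForm_add (u w : Trial 𝒯) (v : Test 𝒯) : bForm (u + w) v = bForm u v + bForm w v := by
  have key : ∀ {s₁ s₂ s₃ s₄ s₅ s₆ s₇ s₈ x₁ x₂ x₃ x₄ x₅ x₆ x₇ x₈ y₁ y₂ y₃ y₄ y₅ y₆ y₇ y₈ : ℝ},
      s₁ = x₁ + y₁ → s₂ = x₂ + y₂ → s₃ = x₃ + y₃ → s₄ = x₄ + y₄ → s₅ = x₅ + y₅ → s₆ = x₆ + y₆ →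
      s₇ = x₇ + y₇ → s₈ = x₈ + y₈ → s₁ - s₂ - s₃ - s₄ + s₅ + s₆ + s₇ + s₈ =
      (x₁ - x₂ - x₃ - x₄ + x₅ + x₆ + x₇ + x₈) + (y₁ - y₂ - y₃ - y₄ + y₅ + y₆ + y₇ + y₈) := by
    intros; subst_vars; ring
  exact key (inner_add_left u.1.1 w.1.1 _) (inner_add_left u.1.2.1 w.1.2.1 _)
    (inner_add_left u.1.2.2.1 w.1.2.2.1 _) (inner_add_left u.1.2.2.2 w.1.2.2.2 _) rfl rfl rfl rfl

theorem bForm_smul (c : ℝ) (u : Trial 𝒯) (v : Test 𝒯) : bForm (c • u) v = c * bForm u v := by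
  have key : ∀ {s₁ s₂ s₃ s₄ s₅ s₆ s₇ s₈ x₁ x₂ x₃ x₄ x₅ x₆ x₇ x₈ : ℝ},
      s₁ = c * x₁ → s₂ = c * x₂ → s₃ = c * x₃ → s₄ = c * x₄ → s₅ = c * x₅ → s₆ = c * x₆ →
      s₇ = c * x₇ → s₈ = c * x₈ → s₁ - s₂ - s₃ - s₄ + s₅ + s₆ + s₇ + s₈ =
      c * (x₁ - x₂ - x₃ - x₄ + x₅ + x₆ + x₇ + x₈) := by
    intros; subst_vars; ring
  exact key (real_inner_smul_left u.1.1 _ c) (real_inner_smul_left u.1.2.1 _ c)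
    (real_inner_smul_left u.1.2.2.1 _ c) (real_inner_smul_left u.1.2.2.2 _ c) rfl rfl rfl rfl

variable (𝒯) in
/-- The trial-to-test operator as a linear map. -/
def trialToTestₗ : Trial 𝒯 →ₗ[ℝ] Test 𝒯 where
  toFun := trialToTest
  map_add' u w := by
    have h : bFunctional (u + w) = bFunctional u + bFunctional w :=
      ContinuousLinearMap.ext fun v => bForm_add u w v
    rw [trialToTest, h, map_add]
    rfl
  map_smul' c u := by
    have h : bFunctional (c • u) = c • bFunctional u :=
      ContinuousLinearMap.ext fun v => bForm_smul c u v
    rw [trialToTest, h]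
    exact ((InnerProductSpace.toDual ℝ (Test 𝒯)).symm.map_smulₛₗ c (bFunctional u))

theorem abs_bForm_le_norm_trialToTest (u : Trial 𝒯) (v : Test 𝒯) :
    |bForm u v| ≤ ‖trialToTest u‖ * ‖v‖ :=
  (congrArg abs (inner_trialToTest u v)).symm.trans_le (abs_real_inner_le_norm (trialToTest u) v)

theorem norm_trialToTest_sq (u : Trial 𝒯) : ‖trialToTest u‖ ^ 2 = bForm u (trialToTest u) :=
  (real_inner_self_eq_norm_sq (trialToTest u)).symm.trans (inner_trialToTest u (trialToTest u))

variable (𝒯) in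
/-- The test function with components `v₁, v₂, v₃, v₄`. -/
def mkTest (v₁ : HdivT 𝒯) (v₂ : H1T 𝒯) (v₃ : HdivT 𝒯) (v₄ : H1T 𝒯) : Test 𝒯 :=
  WithLp.toLp 2 (WithLp.toLp 2 (v₁, v₂), WithLp.toLp 2 (v₃, v₄))

theorem norm_mkTest_le (v₁ : HdivT 𝒯) (v₂ : H1T 𝒯) (v₃ : HdivT 𝒯) (v₄ : H1T 𝒯) :
    ‖mkTest 𝒯 v₁ v₂ v₃ v₄‖ ≤ ‖v₁‖ + ‖v₂‖ + ‖v₃‖ + ‖v₄‖ := by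
  have h := norm_le_fst_add_snd (mkTest 𝒯 v₁ v₂ v₃ v₄)
  have h₁ : ‖(mkTest 𝒯 v₁ v₂ v₃ v₄).fst‖ ≤ ‖v₁‖ + ‖v₂‖ := norm_le_fst_add_snd _
  have h₂ : ‖(mkTest 𝒯 v₁ v₂ v₃ v₄).snd‖ ≤ ‖v₃‖ + ‖v₄‖ := norm_le_fst_add_snd _
  exact h.trans ((add_le_add h₁ h₂).trans_eq (add_assoc _ _ _).symm)

theorem bForm_mkTest (u : Trial 𝒯) (v₁ : HdivT 𝒯) (v₂ : H1T 𝒯) (v₃ : HdivT 𝒯) (v₄ : H1T 𝒯) :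
    bForm u (mkTest 𝒯 v₁ v₂ v₃ v₄) = ⟪u.1.1, field v₁ - grad v₄⟫_ℝ
      - ⟪u.1.2.1, fn v₄ + dive v₃⟫_ℝ - ⟪u.1.2.2.1, field v₃ + grad v₂⟫_ℝ
      - ⟪u.1.2.2.2, fn v₂ + dive v₁⟫_ℝ + (u.2.1 : H1T 𝒯 →L[ℝ] ℝ) v₄
      + (u.2.2.1 : HdivT 𝒯 →L[ℝ] ℝ) v₃ + (u.2.2.2.1 : H1T 𝒯 →L[ℝ] ℝ) v₂
      + (u.2.2.2.2 : HdivT 𝒯 →L[ℝ] ℝ) v₁ := rfl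

theorem norm_test1_le (v : Test 𝒯) : ‖test1 v‖ ≤ ‖v‖ :=
  (WithLp.norm_fst_le _ v.fst).trans (WithLp.norm_fst_le _ v)

theorem norm_test2_le (v : Test 𝒯) : ‖test2 v‖ ≤ ‖v‖ :=
  (WithLp.norm_snd_le _ v.fst).trans (WithLp.norm_fst_le _ v)

theorem norm_test3_le (v : Test 𝒯) : ‖test3 v‖ ≤ ‖v‖ :=
  (WithLp.norm_fst_le _ v.snd).trans (WithLp.norm_snd_le _ v)

theorem norm_test4_le (v : Test 𝒯) : ‖test4 v‖ ≤ ‖v‖ :=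
  (WithLp.norm_snd_le _ v.snd).trans (WithLp.norm_snd_le _ v)

/-- A conforming test function does not see the traces. -/
theorem bForm_mkTest_of_conforming (u : Trial 𝒯) {v₁ : HdivT 𝒯} {v₂ : H1T 𝒯} {v₃ : HdivT 𝒯}
    {v₄ : H1T 𝒯} (h₁ : (v₁ : PairDiv Ω) ∈ Hdiv0 Ω) (h₂ : (v₂ : PairGrad Ω) ∈ H10 Ω)
    (h₃ : (v₃ : PairDiv Ω) ∈ Hdiv Ω) (h₄ : (v₄ : PairGrad Ω) ∈ H1 Ω) :
    bForm u (mkTest 𝒯 v₁ v₂ v₃ v₄) = ⟪u.1.1, field v₁ - grad v₄⟫_ℝ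
      - ⟪u.1.2.1, fn v₄ + dive v₃⟫_ℝ - ⟪u.1.2.2.1, field v₃ + grad v₂⟫_ℝ
      - ⟪u.1.2.2.2, fn v₂ + dive v₁⟫_ℝ := by
  obtain ⟨τ₁, hτ₁, k₁⟩ := mem_TrHdiv0.1 u.2.1.2
  obtain ⟨z₂, hz₂, k₂⟩ := mem_TrH10.1 u.2.2.1.2
  obtain ⟨τ₃, hτ₃, k₃⟩ := mem_TrHdiv.1 u.2.2.2.1.2
  obtain ⟨z₄, hz₄, k₄⟩ := mem_TrH1.1 u.2.2.2.2.2
  have g₁ : (u.2.1 : H1T 𝒯 →L[ℝ] ℝ) v₄ = 0 :=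
    (DFunLike.congr_fun k₁ v₄).symm.trans ((traceDiv_apply 𝒯 τ₁ v₄).trans
      (traceGrad_eq_zero_of_mem_Hdiv0 h₄ hτ₁))
  have g₂ : (u.2.2.1 : HdivT 𝒯 →L[ℝ] ℝ) v₃ = 0 :=
    (DFunLike.congr_fun k₂ v₃).symm.trans (traceGrad_eq_zero_of_mem_H10 hz₂ h₃)
  have g₃ : (u.2.2.2.1 : H1T 𝒯 →L[ℝ] ℝ) v₂ = 0 :=
    (DFunLike.congr_fun k₃ v₂).symm.trans ((traceDiv_apply 𝒯 τ₃ v₂).trans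
      (traceGrad_eq_zero_of_mem_H10 h₂ hτ₃))
  have g₄ : (u.2.2.2.2 : HdivT 𝒯 →L[ℝ] ℝ) v₁ = 0 :=
    (DFunLike.congr_fun k₄ v₁).symm.trans (traceGrad_eq_zero_of_mem_Hdiv0 hz₄ h₁)
  have key : ∀ {a t₁ t₂ t₃ t₄ : ℝ}, t₁ = 0 → t₂ = 0 → t₃ = 0 → t₄ = 0 →
      a + t₁ + t₂ + t₃ + t₄ = a := by
    intros; subst_vars; ring
  exact (bForm_mkTest u v₁ v₂ v₃ v₄).trans (key g₁ g₂ g₃ g₄)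

theorem abs_inner_le_two_mul {E : Type*} [NormedAddCommGroup E] [InnerProductSpace ℝ E]
    {x y : E} {A B : ℝ} (hx : ‖x‖ ≤ A) (hy : ‖y‖ ≤ 2 * B) : |⟪x, y⟫_ℝ| ≤ 2 * (A * B) := by
  have := mul_le_mul hx hy (norm_nonneg y) ((norm_nonneg x).trans hx)
  exact (abs_real_inner_le_norm x y).trans (by linarith)

theorem norm_add_le_two_mul {E : Type*} [NormedAddCommGroup E] {x y : E} {B : ℝ} (hx : ‖x‖ ≤ B)
    (hy : ‖y‖ ≤ B) : ‖x + y‖ ≤ 2 * B := (norm_add_le x y).trans (by linarith)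

theorem norm_sub_le_two_mul {E : Type*} [NormedAddCommGroup E] {x y : E} {B : ℝ} (hx : ‖x‖ ≤ B)
    (hy : ‖y‖ ≤ B) : ‖x - y‖ ≤ 2 * B := (norm_sub_le x y).trans (by linarith)

/-- `b` is bounded, uniformly in the mesh. -/
theorem bForm_le (u : Trial 𝒯) (v : Test 𝒯) : bForm u v ≤ 12 * (normU u * ‖v‖) := by
  have sq : ∀ {s a b c e a' b' c' e' : ℝ}, 0 ≤ s →
      s ^ 2 = a ^ 2 + b ^ 2 + c ^ 2 + e ^ 2 + a' ^ 2 + b' ^ 2 + c' ^ 2 + e' ^ 2 →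
      (a ≤ s ∧ b ≤ s ∧ c ≤ s ∧ e ≤ s) ∧ a' ≤ s ∧ b' ≤ s ∧ c' ≤ s ∧ e' ≤ s := by
    intro s a b c e a' b' c' e' hs h
    have := sq_nonneg a; have := sq_nonneg b; have := sq_nonneg c; have := sq_nonneg e
    have := sq_nonneg a'; have := sq_nonneg b'; have := sq_nonneg c'; have := sq_nonneg e'
    refine ⟨⟨?_, ?_, ?_, ?_⟩, ?_, ?_, ?_, ?_⟩ <;>
      exact le_of_sq_le_sq (by linarith) hs
  -- Four field terms, each tested with a sum or difference of two components, and four trace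
  -- dualities: `4 · 2 + 4 = 12`.
  have key : ∀ {M x₁ x₂ x₃ x₄ x₅ x₆ x₇ x₈ : ℝ}, |x₁| ≤ 2 * M → |x₂| ≤ 2 * M → |x₃| ≤ 2 * M →
      |x₄| ≤ 2 * M → |x₅| ≤ M → |x₆| ≤ M → |x₇| ≤ M → |x₈| ≤ M →
      x₁ - x₂ - x₃ - x₄ + x₅ + x₆ + x₇ + x₈ ≤ 12 * M := by
    intro M x₁ x₂ x₃ x₄ x₅ x₆ x₇ x₈ h₁ h₂ h₃ h₄ h₅ h₆ h₇ h₈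
    linarith [(abs_le.1 h₁).2, (abs_le.1 h₂).1, (abs_le.1 h₃).1, (abs_le.1 h₄).1, (abs_le.1 h₅).2,
      (abs_le.1 h₆).2, (abs_le.1 h₇).2, (abs_le.1 h₈).2]
  obtain ⟨⟨n₁, n₂, n₃, n₄⟩, n₅, n₆, n₇, n₈⟩ := sq (normU_nonneg u) (normU_sq u)
  have t₁ := norm_test1_le v
  have t₂ := norm_test2_le v
  have t₃ := norm_test3_le v
  have t₄ := norm_test4_le v
  exact key
    (abs_inner_le_two_mul n₁ (norm_sub_le_two_mul ((norm_field_le _).trans t₁)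
      ((norm_grad_le _).trans t₄)))
    (abs_inner_le_two_mul n₂ (norm_add_le_two_mul ((norm_fn_le _).trans t₄)
      ((norm_dive_le _).trans t₃)))
    (abs_inner_le_two_mul n₃ (norm_add_le_two_mul ((norm_field_le _).trans t₃)
      ((norm_grad_le _).trans t₂)))
    (abs_inner_le_two_mul n₄ (norm_add_le_two_mul ((norm_fn_le _).trans t₂)
      ((norm_dive_le _).trans t₁)))
    ((u.2.1 : H1T 𝒯 →L[ℝ] ℝ).le_of_opNorm_le_of_le n₅ t₄)
    ((u.2.2.1 : HdivT 𝒯 →L[ℝ] ℝ).le_of_opNorm_le_of_le n₆ t₃)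
    ((u.2.2.2.1 : H1T 𝒯 →L[ℝ] ℝ).le_of_opNorm_le_of_le n₇ t₂)
    ((u.2.2.2.2 : HdivT 𝒯 →L[ℝ] ℝ).le_of_opNorm_le_of_le n₈ t₁)

/-- `𝔗 : 𝔘 → 𝔙(𝒯)` is bounded, with a bound independent of the mesh. -/
theorem norm_trialToTest_le (u : Trial 𝒯) : ‖trialToTest u‖ ≤ 12 * normU u := by
  have key : ∀ {a b N : ℝ}, 0 ≤ N → 0 ≤ a → a ^ 2 = b → b ≤ 12 * (N * a) → a ≤ 12 * N := by
    intro a b N hN ha h h'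
    by_contra! hlt
    nlinarith
  exact key (normU_nonneg u) (norm_nonneg _) (norm_trialToTest_sq u) (bForm_le u _)

end Formulation

/-! ### Uniform inf-sup stability and solvability -/

section Stability

/-- The factor 4 is `(a + b + c + e)² ≤ 4 (a² + b² + c² + e²)`, after which one factor of the sum
cancels. -/
theorem add_le_of_sum_sq_le {C a b c e N V B : ℝ} (hC : 0 ≤ C) (hN : 0 ≤ N)
    (hV : V ≤ C * (a + e + c + b))
    (hB : B = a ^ 2 + b ^ 2 + c ^ 2 + e ^ 2) (hBV : B ≤ N * V) : a + b + c + e ≤ 4 * C * N := by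
  have hle := hBV.trans (mul_le_mul_of_nonneg_left hV hN)
  have hsq : (a + b + c + e) * (a + b + c + e) ≤ 4 * C * N * (a + b + c + e) := by
    nlinarith [sq_nonneg (a - b), sq_nonneg (a - c), sq_nonneg (a - e), sq_nonneg (b - c),
      sq_nonneg (b - e), sq_nonneg (c - e)]
  by_contra! hlt
  have hpos : 0 < a + b + c + e := lt_of_le_of_lt (by positivity) hlt
  exact absurd (le_of_mul_le_mul_right hsq hpos) (not_le.2 hlt)

set_option maxHeartbeats 800000 in
/-- The field components of `u` are controlled by `b(u, ·)`, uniformly in the mesh: test with the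
conforming solution of the adjoint problem. -/
theorem IsLipschitzDomain.exists_field_bound {Ω : Set (Space d)} (hΩ : IsLipschitzDomain Ω)
    (i : Fin d) : ∃ C : ℝ, 0 ≤ C ∧ ∀ (𝒯 : Mesh Ω) (u : Trial 𝒯),
      ‖u.1.1‖ + ‖u.1.2.1‖ + ‖u.1.2.2.1‖ + ‖u.1.2.2.2‖ ≤ C * ‖trialToTest u‖ := by
  obtain ⟨C, hC, hb⟩ := hΩ.first_order_system_bound i
  refine ⟨4 * C, by positivity, fun 𝒯 u => ?_⟩
  obtain ⟨w₁, h₁, w₂, h₂, w₃, h₃, w₄, h₄, e₁, e₂, e₃, e₄⟩ :=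
    -- With `v = (w₁, -w₂, w₃, -w₄)` this choice of data makes the four test arguments of `b` equal
    -- to `u₁`, `-u₂`, `-u₃`, `-u₄`, so that `b(u, v)` is the sum of the squared field norms.
    hΩ.first_order_system_surjective i u.1.1 u.1.2.2.2 (-u.1.2.2.1) u.1.2.1
  have hw := hb w₁ h₁ w₂ h₂ w₃ h₃ w₄ h₄
  rw [e₁, e₂, e₃, e₄, norm_neg] at hw
  have b₂ : -w₂ ∈ H10 Ω := neg_mem h₂
  have b₄ : -w₄ ∈ H1 Ω := neg_mem h₄
  obtain ⟨v₁, k₁⟩ : ∃ v : HdivT 𝒯, (v : PairDiv Ω) = w₁ := ⟨toHdivT 𝒯 h₁.1, rfl⟩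
  obtain ⟨v₂, k₂⟩ : ∃ v : H1T 𝒯, (v : PairGrad Ω) = -w₂ := ⟨toH1T 𝒯 (H10_le_H1 Ω b₂), rfl⟩
  obtain ⟨v₃, k₃⟩ : ∃ v : HdivT 𝒯, (v : PairDiv Ω) = w₃ := ⟨toHdivT 𝒯 h₃, rfl⟩
  obtain ⟨v₄, k₄⟩ : ∃ v : H1T 𝒯, (v : PairGrad Ω) = -w₄ := ⟨toH1T 𝒯 b₄, rfl⟩
  have a₁ : field v₁ - grad v₄ = u.1.1 := by
    change (v₁ : PairDiv Ω).fst - (v₄ : PairGrad Ω).snd = _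
    rw [k₁, k₄, WithLp.neg_snd, sub_neg_eq_add, e₁]
  have a₂ : fn v₄ + dive v₃ = -u.1.2.1 := by
    change (v₄ : PairGrad Ω).fst + (v₃ : PairDiv Ω).snd = _
    rw [k₃, k₄, WithLp.neg_fst, ← e₄, neg_sub, neg_add_eq_sub]
  have a₃ : field v₃ + grad v₂ = -u.1.2.2.1 := by
    change (v₃ : PairDiv Ω).fst + (v₂ : PairGrad Ω).snd = _
    rw [k₂, k₃, WithLp.neg_snd, ← sub_eq_add_neg, e₃]
  have a₄ : fn v₂ + dive v₁ = -u.1.2.2.2 := by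
    change (v₂ : PairGrad Ω).fst + (v₁ : PairDiv Ω).snd = _
    rw [k₁, k₂, WithLp.neg_fst, ← e₂, neg_sub, neg_add_eq_sub]
  have hv : ‖mkTest 𝒯 v₁ v₂ v₃ v₄‖ ≤
      C * (‖u.1.1‖ + ‖u.1.2.2.2‖ + ‖u.1.2.2.1‖ + ‖u.1.2.1‖) := by
    refine (norm_mkTest_le _ _ _ _).trans (le_trans (le_of_eq ?_) hw)
    change ‖(v₁ : PairDiv Ω)‖ + ‖(v₂ : PairGrad Ω)‖ + ‖(v₃ : PairDiv Ω)‖ + ‖(v₄ : PairGrad Ω)‖ = _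
    rw [k₁, k₂, k₃, k₄, norm_neg, norm_neg]
  have hB : bForm u (mkTest 𝒯 v₁ v₂ v₃ v₄) =
      ‖u.1.1‖ ^ 2 + ‖u.1.2.1‖ ^ 2 + ‖u.1.2.2.1‖ ^ 2 + ‖u.1.2.2.2‖ ^ 2 := by
    refine (bForm_mkTest_of_conforming u (k₁ ▸ h₁) (k₂ ▸ b₂) (k₃ ▸ h₃) (k₄ ▸ b₄)).trans ?_
    rw [a₁, a₂, a₃, a₄, inner_neg_right, inner_neg_right, inner_neg_right,
      real_inner_self_eq_norm_sq, real_inner_self_eq_norm_sq, real_inner_self_eq_norm_sq,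
      real_inner_self_eq_norm_sq, sub_neg_eq_add, sub_neg_eq_add, sub_neg_eq_add]
  have hle := (le_abs_self _).trans (abs_bForm_le_norm_trialToTest u (mkTest 𝒯 v₁ v₂ v₃ v₄))
  exact add_le_of_sum_sq_le hC (norm_nonneg _) hv hB hle

variable {Ω : Set (Space d)} {𝒯 : Mesh Ω}

/-- A test function with a single nonzero component isolates one trace. What remains besides `b` are
pairings with two fields, which are already under control; the three lemmas below do the same for
the other traces. -/
theorem trace_component₁ (u : Trial 𝒯) (v : H1T 𝒯) : (u.2.1 : H1T 𝒯 →L[ℝ] ℝ) v =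
    bForm u (mkTest 𝒯 0 0 0 v) + (⟪u.1.1, grad v⟫_ℝ + ⟪u.1.2.1, fn v⟫_ℝ) := by
  rw [bForm_mkTest]
  simp only [map_zero, zero_sub, add_zero, inner_neg_right, inner_zero_right]
  ring

theorem trace_component₂ (u : Trial 𝒯) (v : HdivT 𝒯) : (u.2.2.1 : HdivT 𝒯 →L[ℝ] ℝ) v =
    bForm u (mkTest 𝒯 0 0 v 0) + (⟪u.1.2.1, dive v⟫_ℝ + ⟪u.1.2.2.1, field v⟫_ℝ) := by
  rw [bForm_mkTest]
  simp only [map_zero, sub_zero, zero_add, add_zero, inner_zero_right]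
  ring

theorem trace_component₃ (u : Trial 𝒯) (v : H1T 𝒯) : (u.2.2.2.1 : H1T 𝒯 →L[ℝ] ℝ) v =
    bForm u (mkTest 𝒯 0 v 0 0) + (⟪u.1.2.2.1, grad v⟫_ℝ + ⟪u.1.2.2.2, fn v⟫_ℝ) := by
  rw [bForm_mkTest]
  simp only [map_zero, sub_zero, zero_add, add_zero, inner_zero_right]
  ring

theorem trace_component₄ (u : Trial 𝒯) (v : HdivT 𝒯) : (u.2.2.2.2 : HdivT 𝒯 →L[ℝ] ℝ) v =
    bForm u (mkTest 𝒯 v 0 0 0) + (⟪-u.1.1, field v⟫_ℝ + ⟪u.1.2.2.2, dive v⟫_ℝ) := by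
  rw [bForm_mkTest]
  simp only [map_zero, sub_zero, zero_add, add_zero, inner_zero_right, inner_neg_left]
  ring

theorem abs_add_inner_le {E F : Type*} [NormedAddCommGroup E] [InnerProductSpace ℝ E]
    [NormedAddCommGroup F] [InnerProductSpace ℝ F] {x a : E} {y b : F} {B C N V W t : ℝ}
    (ht : t = B + (⟪x, a⟫_ℝ + ⟪y, b⟫_ℝ)) (hB : |B| ≤ N * W) (hN : 0 ≤ N) (hW : W ≤ V)
    (hxy : ‖x‖ + ‖y‖ ≤ C * N) (ha : ‖a‖ ≤ V) (hb : ‖b‖ ≤ V) : ‖t‖ ≤ (1 + C) * N * V := by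
  have i₁ := abs_real_inner_le_norm x a
  have i₂ := abs_real_inner_le_norm y b
  have j₁ := mul_le_mul_of_nonneg_left ha (norm_nonneg x)
  have j₂ := mul_le_mul_of_nonneg_left hb (norm_nonneg y)
  have j₃ := mul_le_mul_of_nonneg_left hW hN
  have j₄ := mul_le_mul_of_nonneg_right hxy ((norm_nonneg a).trans ha)
  have := abs_add_le B (⟪x, a⟫_ℝ + ⟪y, b⟫_ℝ)
  have := abs_add_le ⟪x, a⟫_ℝ ⟪y, b⟫_ℝ
  rw [ht, Real.norm_eq_abs]
  linarith

theorem sum_sq_le_add_four_mul_sq {a b c e a' b' c' e' A D : ℝ} (ha : 0 ≤ a) (hb : 0 ≤ b)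
    (hc : 0 ≤ c) (he : 0 ≤ e) (ha' : 0 ≤ a') (hb' : 0 ≤ b') (hc' : 0 ≤ c') (he' : 0 ≤ e')
    (hA : a + b + c + e ≤ A) (h₁ : a' ≤ D) (h₂ : b' ≤ D) (h₃ : c' ≤ D) (h₄ : e' ≤ D) :
    a ^ 2 + b ^ 2 + c ^ 2 + e ^ 2 + a' ^ 2 + b' ^ 2 + c' ^ 2 + e' ^ 2 ≤ (A + 4 * D) ^ 2 := by
  have s : a ^ 2 + b ^ 2 + c ^ 2 + e ^ 2 ≤ (a + b + c + e) ^ 2 := by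
    nlinarith [mul_nonneg ha hb, mul_nonneg ha hc, mul_nonneg ha he, mul_nonneg hb hc,
      mul_nonneg hb he, mul_nonneg hc he]
  have s' : (a + b + c + e) ^ 2 ≤ A ^ 2 := pow_le_pow_left₀ (by positivity) hA 2
  have hA0 : 0 ≤ A := le_trans (by positivity) hA
  have hD0 : 0 ≤ D := ha'.trans h₁
  have r₁ := pow_le_pow_left₀ ha' h₁ 2
  have r₂ := pow_le_pow_left₀ hb' h₂ 2
  have r₃ := pow_le_pow_left₀ hc' h₃ 2
  have r₄ := pow_le_pow_left₀ he' h₄ 2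
  nlinarith [mul_nonneg hA0 hD0, sq_nonneg D]

/-- The inf-sup condition for `b`, uniformly in the mesh. -/
theorem IsLipschitzDomain.exists_normU_le {Ω : Set (Space d)} (hΩ : IsLipschitzDomain Ω)
    (i : Fin d) : ∃ C : ℝ, 0 ≤ C ∧ ∀ (𝒯 : Mesh Ω) (u : Trial 𝒯),
      normU u ≤ C * ‖trialToTest u‖ := by
  obtain ⟨C, hC, hb⟩ := hΩ.exists_field_bound i
  -- The fields contribute `C`; each of the four traces contributes 1 from `b(u, ·)` and `C` from
  -- the fields paired with its test function.
  refine ⟨C + 4 * (1 + C), by positivity, fun 𝒯 u => ?_⟩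
  have hf := hb 𝒯 u
  have p₁ := norm_nonneg u.1.1
  have p₂ := norm_nonneg u.1.2.1
  have p₃ := norm_nonneg u.1.2.2.1
  have p₄ := norm_nonneg u.1.2.2.2
  have hN : 0 ≤ ‖trialToTest u‖ := norm_nonneg (trialToTest u)
  have hD : 0 ≤ (1 + C) * ‖trialToTest u‖ := mul_nonneg (by linarith) hN
  have pair : ∀ {a b c e A : ℝ}, 0 ≤ a → 0 ≤ b → 0 ≤ c → 0 ≤ e → a + b + c + e ≤ A →
      a + b ≤ A ∧ b + c ≤ A ∧ c + e ≤ A ∧ a + e ≤ A := fun _ _ _ _ _ =>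
    ⟨by linarith, by linarith, by linarith, by linarith⟩
  obtain ⟨s₁, s₂, s₃, s₄⟩ := pair p₁ p₂ p₃ p₄ hf
  have norm_le : ∀ (v₁ : HdivT 𝒯) (v₂ : H1T 𝒯) (v₃ : HdivT 𝒯) (v₄ : H1T 𝒯) {V : ℝ},
      ‖v₁‖ + ‖v₂‖ + ‖v₃‖ + ‖v₄‖ = V → ‖mkTest 𝒯 v₁ v₂ v₃ v₄‖ ≤ V :=
    fun v₁ v₂ v₃ v₄ V h => (norm_mkTest_le v₁ v₂ v₃ v₄).trans_eq h
  have t₁ : ‖(u.2.1 : H1T 𝒯 →L[ℝ] ℝ)‖ ≤ (1 + C) * ‖trialToTest u‖ :=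
    ContinuousLinearMap.opNorm_le_bound _ hD fun v =>
      abs_add_inner_le (trace_component₁ u v) (abs_bForm_le_norm_trialToTest u _) hN
        (norm_le 0 0 0 v (by rw [norm_zero, norm_zero, add_zero, add_zero, zero_add])) s₁
        (norm_grad_le v) (norm_fn_le v)
  have t₂ : ‖(u.2.2.1 : HdivT 𝒯 →L[ℝ] ℝ)‖ ≤ (1 + C) * ‖trialToTest u‖ :=
    ContinuousLinearMap.opNorm_le_bound _ hD fun v =>
      abs_add_inner_le (trace_component₂ u v) (abs_bForm_le_norm_trialToTest u _) hN
        (norm_le 0 0 v 0 (by rw [norm_zero, norm_zero, add_zero, add_zero, zero_add])) s₂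
        (norm_dive_le v) (norm_field_le v)
  have t₃ : ‖(u.2.2.2.1 : H1T 𝒯 →L[ℝ] ℝ)‖ ≤ (1 + C) * ‖trialToTest u‖ :=
    ContinuousLinearMap.opNorm_le_bound _ hD fun v =>
      abs_add_inner_le (trace_component₃ u v) (abs_bForm_le_norm_trialToTest u _) hN
        (norm_le 0 v 0 0 (by rw [norm_zero, norm_zero, add_zero, add_zero, zero_add])) s₃
        (norm_grad_le v) (norm_fn_le v)
  have t₄ : ‖(u.2.2.2.2 : HdivT 𝒯 →L[ℝ] ℝ)‖ ≤ (1 + C) * ‖trialToTest u‖ :=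
    ContinuousLinearMap.opNorm_le_bound _ hD fun v =>
      abs_add_inner_le (trace_component₄ u v) (abs_bForm_le_norm_trialToTest u _) hN
        (norm_le v 0 0 0 (by rw [norm_zero, norm_zero, add_zero, add_zero, add_zero]))
        ((congrArg (· + _) (norm_neg u.1.1)).trans_le s₄) (norm_field_le v) (norm_dive_le v)
  have key := (normU_sq u).trans_le (sum_sq_le_add_four_mul_sq p₁ p₂ p₃ p₄
    (ContinuousLinearMap.opNorm_nonneg _) (ContinuousLinearMap.opNorm_nonneg _)
    (ContinuousLinearMap.opNorm_nonneg _) (ContinuousLinearMap.opNorm_nonneg _) hf t₁ t₂ t₃ t₄)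
  refine (le_of_sq_le_sq key (add_nonneg (mul_nonneg hC hN) (mul_nonneg (by norm_num) hD))).trans_eq ?_
  ring

/-- The conforming solution with data `(f, 0, 0, 0)`, accompanied by its own traces. The trace
dualities are exactly the terms of elementwise integration by parts, turning `b(u, v)` into the
strong residuals tested with `v`. -/
theorem IsLipschitzDomain.exists_isSolution {Ω : Set (Space d)} (hΩ : IsLipschitzDomain Ω)
    (i : Fin d) (𝒯 : Mesh Ω) (f : L2v Ω) : ∃ u : Trial 𝒯, IsSolution f u := by
  obtain ⟨w₁, h₁, w₂, h₂, w₃, h₃, w₄, h₄, e₁, e₂, e₃, e₄⟩ :=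
    hΩ.first_order_system_surjective i f 0 0 0
  rw [sub_eq_zero] at e₂ e₃ e₄
  obtain ⟨u₁, k₁⟩ : ∃ v : HdivT 𝒯, (v : PairDiv Ω) = w₁ := ⟨toHdivT 𝒯 h₁.1, rfl⟩
  obtain ⟨u₂, k₂⟩ : ∃ v : H1T 𝒯, (v : PairGrad Ω) = w₂ := ⟨toH1T 𝒯 (H10_le_H1 Ω h₂), rfl⟩
  obtain ⟨u₃, k₃⟩ : ∃ v : HdivT 𝒯, (v : PairDiv Ω) = w₃ := ⟨toHdivT 𝒯 h₃, rfl⟩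
  obtain ⟨u₄, k₄⟩ : ∃ v : H1T 𝒯, (v : PairGrad Ω) = w₄ := ⟨toH1T 𝒯 h₄, rfl⟩
  subst k₁ k₂ k₃ k₄
  have a₁ : field u₁ + grad u₄ = f := e₁
  have a₂ : fn u₂ = dive u₁ := e₂
  have a₃ : field u₃ = grad u₂ := e₃
  have a₄ : fn u₄ = dive u₃ := e₄
  refine ⟨((field u₁, fn u₂, field u₃, fn u₄), (⟨traceDiv 𝒯 u₁, mem_TrHdiv0.2 ⟨u₁, h₁, rfl⟩⟩,
    ⟨traceGrad 𝒯 u₂, mem_TrH10.2 ⟨u₂, h₂, rfl⟩⟩, ⟨traceDiv 𝒯 u₃, mem_TrHdiv.2 ⟨u₃, h₃, rfl⟩⟩,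
    ⟨traceGrad 𝒯 u₄, mem_TrH1.2 ⟨u₄, h₄, rfl⟩⟩)), fun v => ?_⟩
  change ⟪field u₁, field (test1 v) - grad (test4 v)⟫_ℝ - ⟪fn u₂, fn (test4 v) + dive (test3 v)⟫_ℝ
    - ⟪field u₃, field (test3 v) + grad (test2 v)⟫_ℝ - ⟪fn u₄, fn (test2 v) + dive (test1 v)⟫_ℝ
    + (⟪dive u₁, fn (test4 v)⟫_ℝ + ⟪field u₁, grad (test4 v)⟫_ℝ)
    + (⟪fn u₂, dive (test3 v)⟫_ℝ + ⟪grad u₂, field (test3 v)⟫_ℝ)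
    + (⟪dive u₃, fn (test2 v)⟫_ℝ + ⟪field u₃, grad (test2 v)⟫_ℝ)
    + (⟪fn u₄, dive (test1 v)⟫_ℝ + ⟪grad u₄, field (test1 v)⟫_ℝ) = ⟪f, field (test1 v)⟫_ℝ
  rw [← a₁, ← a₂, ← a₃, ← a₄]
  simp only [inner_add_left, inner_add_right, inner_sub_right]
  ring

/-! ### Least-squares minimization over finite-dimensional subspaces -/

section Galerkin

variable {U V : Type*} [AddCommGroup U] [Module ℝ U] [NormedAddCommGroup V]
  [InnerProductSpace ℝ V]

/-- The solution is the preimage in `S` of the orthogonal projection of `T u` onto `T(S)`, whose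
existence is guaranteed by finite dimension. -/
theorem existsUnique_galerkin {T : U →ₗ[ℝ] V} (hT : Function.Injective T) (S : Submodule ℝ U)
    [FiniteDimensional ℝ S] (u : U) :
    ∃! s : U, s ∈ S ∧ ∀ δ ∈ S, ⟪T s, T δ⟫_ℝ = ⟪T u, T δ⟫_ℝ := by
  obtain ⟨s, hs, he⟩ := Submodule.mem_map.1 ((S.map T).starProjection_apply_mem (T u))
  have hsol : ∀ δ ∈ S, ⟪T s, T δ⟫_ℝ = ⟪T u, T δ⟫_ℝ := fun δ hδ => by
    rw [he, ← sub_eq_zero, ← inner_sub_left, ← neg_sub, inner_neg_left, neg_eq_zero]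
    exact Submodule.starProjection_inner_eq_zero _ _ (Submodule.mem_map_of_mem hδ)
  refine ⟨s, ⟨hs, hsol⟩, fun w ⟨hw, hwsol⟩ => hT (sub_eq_zero.1 ?_)⟩
  have hmem := sub_mem hw hs
  rw [← inner_self_eq_zero (𝕜 := ℝ), inner_sub_left, ← map_sub, hsol _ hmem, hwsol _ hmem, sub_self]

/-- Galerkin orthogonality and Pythagoras for `u - w = (u - s) + (s - w)`. -/
theorem norm_map_sub_galerkin_le {T : U →ₗ[ℝ] V} {S : Submodule ℝ U} {u s : U} (hs : s ∈ S)
    (h : ∀ δ ∈ S, ⟪T s, T δ⟫_ℝ = ⟪T u, T δ⟫_ℝ) {w : U} (hw : w ∈ S) :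
    ‖T (u - s)‖ ≤ ‖T (u - w)‖ := by
  have h0 : ⟪T (u - s), T (s - w)⟫_ℝ = 0 := by
    rw [map_sub T u s, inner_sub_left, h _ (sub_mem hs hw), sub_self]
  refine le_of_sq_le_sq ?_ (norm_nonneg _)
  rw [← sub_add_sub_cancel u s w, map_add, norm_add_sq_real, h0]
  linarith [sq_nonneg ‖T (s - w)‖]

end Galerkin

/-- The load can be replaced by `b(u, ·)`, and both sides are then inner products with `𝔗δu`: the
scheme is the normal equation of a least-squares problem. -/
theorem isDPGSolution_iff {Ω : Set (Space d)} {𝒯 : Mesh Ω} {f : L2v Ω} {u : Trial 𝒯}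
    (hu : IsSolution f u) {Uh : Submodule ℝ (Trial 𝒯)} {uh : Trial 𝒯} :
    IsDPGSolution f Uh uh ↔ uh ∈ Uh ∧ ∀ δu ∈ Uh,
      ⟪trialToTestₗ 𝒯 uh, trialToTestₗ 𝒯 δu⟫_ℝ = ⟪trialToTestₗ 𝒯 u, trialToTestₗ 𝒯 δu⟫_ℝ := by
  refine and_congr_right fun _ => forall₂_congr fun δu _ => ?_
  have h₁ : ⟪trialToTestₗ 𝒯 uh, trialToTestₗ 𝒯 δu⟫_ℝ = bForm uh (trialToTest δu) :=
    inner_trialToTest uh (trialToTest δu)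
  have h₂ : ⟪trialToTestₗ 𝒯 u, trialToTestₗ 𝒯 δu⟫_ℝ = load f (trialToTest δu) :=
    (inner_trialToTest u (trialToTest δu)).trans (hu _)
  rw [h₁, h₂]

end Stability

end DPG

end

/-! ### Well-posedness and quasi-optimality -/

theorem mainTheorem2 (d : ℕ) (hd : 2 ≤ d) (Ω : Set (DPG.Space d))
    (hΩ : DPG.IsLipschitzDomain Ω) (hsc : IsSimplyConnected Ω) :
    ∃ C : ℝ, 0 < C ∧ ∀ (𝒯 : DPG.Mesh Ω) (f : DPG.L2v Ω),
      (∃! u : DPG.Trial 𝒯, DPG.IsSolution f u) ∧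
      ∀ u : DPG.Trial 𝒯, DPG.IsSolution f u →
        ∀ Uh : Submodule ℝ (DPG.Trial 𝒯), FiniteDimensional ℝ Uh →
          (∃! uh : DPG.Trial 𝒯, DPG.IsDPGSolution f Uh uh) ∧
          ∀ uh : DPG.Trial 𝒯, DPG.IsDPGSolution f Uh uh →
            ∀ w ∈ Uh, DPG.normU (u - uh) ≤ C * DPG.normU (u - w) := by
  -- The index is the coordinate direction used in the Friedrichs inequality; any direction serves.
  obtain ⟨C, hC, hstab⟩ := hΩ.exists_normU_le ⟨0, by omega⟩
  -- Stability constant times continuity constant; the summand 1 only ensures strict positivity.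
  refine ⟨C * 12 + 1, by positivity, fun 𝒯 f => ?_⟩
  have hinj : Function.Injective (DPG.trialToTestₗ 𝒯) := by
    refine (injective_iff_map_eq_zero _).2 fun u hu => ?_
    refine DPG.eq_zero_of_normU_eq_zero (le_antisymm ?_ (DPG.normU_nonneg u))
    refine (hstab 𝒯 u).trans_eq ?_
    change C * ‖DPG.trialToTestₗ 𝒯 u‖ = 0
    rw [hu, norm_zero, mul_zero]
  constructor
  · obtain ⟨u, hu⟩ := hΩ.exists_isSolution ⟨0, by omega⟩ 𝒯 f
    refine ⟨u, hu, fun w hw => hinj ?_⟩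
    have h : DPG.bFunctional w = DPG.bFunctional u :=
      ContinuousLinearMap.ext fun v => (hw v).trans (hu v).symm
    exact congrArg (InnerProductSpace.toDual ℝ (DPG.Test 𝒯)).symm h
  intro u hu Uh hUh
  constructor
  · simp only [DPG.isDPGSolution_iff hu]
    exact DPG.existsUnique_galerkin hinj Uh u
  · intro uh huh w hw
    obtain ⟨h₁, h₂⟩ := (DPG.isDPGSolution_iff hu).1 huh
    have hle : ‖DPG.trialToTest (u - uh)‖ ≤ ‖DPG.trialToTest (u - w)‖ :=
      DPG.norm_map_sub_galerkin_le h₁ h₂ hw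
    refine (hstab 𝒯 (u - uh)).trans ((mul_le_mul_of_nonneg_left
      (hle.trans (DPG.norm_trialToTest_le (u - w))) hC).trans ?_)
    rw [← mul_assoc]
    exact mul_le_mul_of_nonneg_right (by linarith) (DPG.normU_nonneg (u - w))
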